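/- **Setting.** Fix a finite predicate signature containing a special $0$-ary predicate $\bot$. A database $D$ is a set of facts (ground atoms) with no $\bot$-fact. A *CQ* is a formula $\exists \vec y\,\gamma$, where $\gamma$ is a nonempty finite conjunction of predicate atoms and inequality atoms $t\neq t'$ (with $t,t'$ variables or constants) and every variable of $\vec y$ occurs in $\gamma$; we write $\mathrm{Conj}(q)=\gamma$, $\mathrm{PA}(q)$ for its set of predicate atoms and $\mathrm{Ineq}(\gamma)$ for its inequalities. A CQ is *safe* if each of its variables occurs in a predicate atom of $\gamma$, and *Boolean* if it has no free variable. A *safe BUCQ* is a nonempty finite disjunction of safe Boolean CQs. A *dependency* is a sentence $\tau=\forall \vec x\,(\gamma\to Q)$ such that $\exists\vec x\,\gamma$ is a safe Boolean CQ, $Q$ is a nonempty finite disjunction of CQs whose free variables are among $\vec x$, and $Q$ becomes a safe BUCQ when its free variables are replaced by constants; $\mathrm{body}(\tau)=\gamma$, $\mathrm{head}(\tau)=Q$, and $\mathrm{CQ}(Q)$ is the set of disjuncts of $Q$. It is *linear* if $\gamma$ has exactly one predicate atom. Let $\Sigma$ be a finite set of dependencies. Its dependency graph has vertex set $\Sigma$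 and an edge from $\tau_1$ to $\tau_2$ iff some predicate of a predicate atom in the head of $\tau_1$ occurs in the body of $\tau_2$; $\Sigma$ is *acyclic* if this graph has no cycle. A topological order $\langle\tau_1,\dots,\tau_h\rangle$ of $\Sigma$ is an enumeration without repetitions such that $\tau_j$ is not reachable from $\tau_i$ by a nonempty path whenever $j\le i$. A *repair* of $\langle\Sigma,D\rangle$ is an inclusion-maximal subset of $D$ that satisfies $\Sigma$. $\langle\Sigma,D\rangle$ *AR-entails* $Q$ if every repair satisfies $Q$, and *IAR-entails* $Q$ if the intersection of all repairs satisfies $Q$. **The sentence.** Let $\Sigma$ be acyclic with all dependencies linear, with topological order $\langle\tau_1,\dots,\tau_h\rangle$. For an atom $\alpha$, put $\Psi^{wc}(\alpha,\emptyset)=\mathit{true}$ and $$\Psi^{wc}(\alpha,\{\tau_k,\dots,\tau_h\})=\bigwedge_{i}\Big(G_i\to\bigvee_{q\in \mathrm{CQ}(\mathrm{head}(\tau_i))}\exists\vec z\,\Big(\sigma_i(\mathrm{Conj}(q))\wedge\bigwedge_{\beta\in \mathrm{PA}(q)}\Psi^{wc}(\sigma_i(\beta),\{\tau_{i+1},\dots,\tau_h\})\Big)\Big),$$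 where $i$ ranges over those $i\in\{k,\dots,h\}$ for which the predicate atom of $\mathrm{body}(\tau_i)$ (with the variables of $\tau_i$ renamed apart from those of $\alpha$) unifies with $\alpha$; $\sigma_i$ is the most general unifier that replaces body variables in preference to variables of $\alpha$, and it acts on the head of $\tau_i$ without touching the quantified variables of $q$; $\vec z$ are the quantified variables of $q$; and $G_i$ is the conjunction of the equalities $y=\sigma_i(y)$ for the variables $y$ of $\alpha$ with $\sigma_i(y)\ne y$ and of the inequalities $\sigma_i(\mathrm{Ineq}(\mathrm{body}(\tau_i)))$ (when $G_i$ is empty, the prefix "$G_i\to$" is absent). For a safe Boolean CQ $q=\exists\vec x\,\gamma$ let $$\Psi^{iar}(q,\Sigma)=\exists\vec x\,\Big(\gamma\wedge\bigwedge_{\alpha\in \mathrm{PA}(q)}\Psi^{wc}(\alpha,\Sigma)\Big),$$ and for a safe BUCQ $Q$ let $\Psi^{iar}(Q,\Sigma)=\bigvee_{q\in \mathrm{CQ}(Q)}\Psi^{iar}(q,\Sigma)$. **Theorem.** Let $\Sigma$ be a finite acyclic set of linear dependencies. Then $\Sigma$ has a topological order, and for every topological order used to build the formulas and every safe BUCQ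 $Q$, $\Psi^{iar}(Q,\Sigma)$ is a first-order sentence such that for every database $D$ $$\langle\Sigma,D\rangle \text{ IAR-entails } Q\iff D\models\Psi^{iar}(Q,\Sigma)\iff \langle\Sigma,D\rangle \text{ AR-entails } Q .$$ Moreover, for each fixed such $\Sigma$ and each fixed safe BUCQ $Q$, the problems of deciding, given a (finite) database $D$, whether $\langle\Sigma,D\rangle$ IAR-entails $Q$, and whether it AR-entails $Q$, are in logspace-uniform $\mathrm{AC}^0$ (data complexity). Here the constants are identified with natural numbers, and a database with constants in $\{0,\dots,m-1\}$ is encoded by concatenating, over the predicates $p$ in a fixed order, the $m^{\mathrm{arity}(p)}$ bits of the characteristic function of $p$; $\mathrm{AC}^0$ means constant-depth, polynomial-size, unbounded fan-in Boolean circuits $C_n$, a description of which is computable from $1^n$ by a Turing machine in space $O(\log n)$. -/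

import Mathlib

/-!
 Databases, disjunctive embedded dependencies with inequalities, repairs, AR- and IAR-entailment,
 the first-order rewriting for acyclic and linear dependencies, and logspace-uniform AC⁰.
-/

namespace CQA

/-! ### Signatures, databases, first-order formulas -/

/-- A finite predicate signature with a distinguished predicate `⊥` of arity `0`. -/
structure Signature where
  numPred : ℕ
  arity : Fin numPred → ℕ
  bot : Fin numPred
  arity_bot : arity bot = 0

/-- Terms. Variables and constants are both named by natural numbers. -/
inductive Term where
  | var (x : ℕ)
  | const (c : ℕ)
  deriving DecidableEq

/-- A (possibly non-ground) predicate atom `p(t₁, …, tₙ)`. -/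
structure Atom (S : Signature) where
  pred : Fin S.numPred
  args : Fin (S.arity pred) → Term

/-- A ground atom. -/
structure GroundAtom (S : Signature) where
  pred : Fin S.numPred
  args : Fin (S.arity pred) → ℕ

/-- The databases over `S`: sets of facts that contain no fact with predicate `⊥`. -/
def IsDatabase {S : Signature} (D : Set (GroundAtom S)) : Prop :=
  ∀ f ∈ D, f.pred ≠ S.bot

def Term.eval (v : ℕ → ℕ) : Term → ℕ
  | .var x => v x
  | .const c => c

def Term.vars : Term → List ℕ
  | .var x => [x]
  | .const _ => []

def Term.subst (σ : ℕ → Term) : Term → Term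
  | .var x => σ x
  | .const c => .const c

def Atom.ground {S : Signature} (v : ℕ → ℕ) (α : Atom S) : GroundAtom S :=
  ⟨α.pred, fun i => (α.args i).eval v⟩

def Atom.vars {S : Signature} (α : Atom S) : List ℕ :=
  (List.ofFn α.args).flatMap Term.vars

def Atom.subst {S : Signature} (σ : ℕ → Term) (α : Atom S) : Atom S :=
  ⟨α.pred, fun i => (α.args i).subst σ⟩

/-- First-order formulas (relational calculus) over `S`. -/
inductive FO (S : Signature) where
  | top
  | bot
  | atom (α : Atom S)
  | eq (s t : Term)
  | neg (φ : FO S)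
  | and (φ ψ : FO S)
  | or (φ ψ : FO S)
  | ex (x : ℕ) (φ : FO S)
  | all (x : ℕ) (φ : FO S)

namespace FO

variable {S : Signature}

/-- `D, v ⊨ φ`: quantifiers range over all constants. -/
def Holds (D : Set (GroundAtom S)) : (ℕ → ℕ) → FO S → Prop
  | _, .top => True
  | _, .bot => False
  | v, .atom α => α.ground v ∈ D
  | v, .eq s t => s.eval v = t.eval v
  | v, .neg φ => ¬ Holds D v φ
  | v, .and φ ψ => Holds D v φ ∧ Holds D v ψ
  | v, .or φ ψ => Holds D v φ ∨ Holds D v ψ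
  | v, .ex x φ => ∃ c : ℕ, Holds D (Function.update v x c) φ
  | v, .all x φ => ∀ c : ℕ, Holds D (Function.update v x c) φ

def freeVars : FO S → Set ℕ
  | .top => ∅
  | .bot => ∅
  | .atom α => {x | x ∈ α.vars}
  | .eq s t => {x | x ∈ s.vars ∨ x ∈ t.vars}
  | .neg φ => freeVars φ
  | .and φ ψ => freeVars φ ∪ freeVars ψ
  | .or φ ψ => freeVars φ ∪ freeVars ψ
  | .ex x φ => freeVars φ \ {x}
  | .all x φ => freeVars φ \ {x}

def IsSentence (φ : FO S) : Prop := φ.freeVars = ∅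

def imp (φ ψ : FO S) : FO S := .or (.neg φ) ψ

def bigAnd (l : List (FO S)) : FO S := l.foldr FO.and .top

def bigOr (l : List (FO S)) : FO S := l.foldr FO.or .bot

def exs (xs : List ℕ) (φ : FO S) : FO S := xs.foldr FO.ex φ

def alls (xs : List ℕ) (φ : FO S) : FO S := xs.foldr FO.all φ

/-- The formula `(⋀ gs) → φ`, and just `φ` if there is no guard. -/
def guarded : List (FO S) → FO S → FO S
  | [], φ => φ
  | g :: gs, φ => imp (bigAnd (g :: gs)) φ

end FO

/-- `D ⊨ φ` for a sentence `φ`. -/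
def Models {S : Signature} (D : Set (GroundAtom S)) (φ : FO S) : Prop :=
  ∀ v : ℕ → ℕ, FO.Holds D v φ

/-! ### Queries and dependencies -/

/-- A conjunction of predicate atoms and inequality atoms `s ≠ t`. -/
structure Conj (S : Signature) where
  atoms : List (Atom S)
  ineqs : List (Term × Term)

namespace Conj

variable {S : Signature}

/-- The variables that occur in predicate atoms. -/
def atomVars (γ : Conj S) : List ℕ := γ.atoms.flatMap Atom.vars

/-- All variables. -/
def vars (γ : Conj S) : List ℕ :=
  γ.atomVars ++ γ.ineqs.flatMap (fun e => e.1.vars ++ e.2.vars)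

def subst (σ : ℕ → Term) (γ : Conj S) : Conj S :=
  ⟨γ.atoms.map (Atom.subst σ), γ.ineqs.map (fun e => (e.1.subst σ, e.2.subst σ))⟩

def ineqFOs (γ : Conj S) : List (FO S) := γ.ineqs.map (fun e => .neg (.eq e.1 e.2))

def toFO (γ : Conj S) : FO S := FO.bigAnd (γ.atoms.map FO.atom ++ γ.ineqFOs)

/-- At least one conjunct. -/
def IsNonempty (γ : Conj S) : Prop := γ.atoms ≠ [] ∨ γ.ineqs ≠ []

end Conj

/-- A conjunctive query with inequalities `∃ bound, conj`. -/
structure CQ (S : Signature) where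
  bound : List ℕ
  conj : Conj S

namespace CQ

variable {S : Signature}

def toFO (q : CQ S) : FO S := FO.exs q.bound q.conj.toFO

/-- Well-formedness: a nonempty conjunction, and every quantified variable occurs in it. -/
def IsCQ (q : CQ S) : Prop :=
  q.conj.IsNonempty ∧ ∀ x ∈ q.bound, x ∈ q.conj.vars

/-- A safe Boolean CQ: no free variable, and every variable occurs in a predicate atom. -/
def IsSafeBCQ (q : CQ S) : Prop :=
  q.IsCQ ∧ (∀ x ∈ q.conj.vars, x ∈ q.bound) ∧ ∀ x ∈ q.conj.vars, x ∈ q.conj.atomVars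

/-- Rename all variables of `q`, free or bound, by `x ↦ x + N`. -/
def shift (N : ℕ) (q : CQ S) : CQ S :=
  ⟨q.bound.map (· + N), q.conj.subst (fun x => .var (x + N))⟩

/-- The substitution that acts as `σ` on the free variables of `q` and fixes the bound ones. -/
def freeSubst (q : CQ S) (σ : ℕ → Term) : ℕ → Term :=
  fun x => if x ∈ q.bound then .var x else σ x

end CQ

/-- A union of conjunctive queries with inequalities. -/
abbrev UCQ (S : Signature) := List (CQ S)

def UCQ.toFO {S : Signature} (Q : UCQ S) : FO S := FO.bigOr (Q.map CQ.toFO)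

/-- A safe Boolean UCQ. -/
def UCQ.IsSafeBUCQ {S : Signature} (Q : UCQ S) : Prop :=
  Q ≠ [] ∧ ∀ q ∈ Q, q.IsSafeBCQ

/-- The formula `∀ univ, (body → head)`. -/
structure Dependency (S : Signature) where
  univ : List ℕ
  body : Conj S
  head : UCQ S

namespace Dependency

variable {S : Signature}

def toFO (τ : Dependency S) : FO S :=
  FO.alls τ.univ (FO.imp τ.body.toFO τ.head.toFO)

/-- `τ` is a disjunctive embedded dependency with inequalities: `∃ univ, body` is a safe BCQ, the
free variables of the head are among `univ`, and the head becomes a safe BUCQ once its free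
variables are replaced by constants. -/
def IsDED (τ : Dependency S) : Prop :=
  (CQ.mk τ.univ τ.body).IsSafeBCQ ∧
  τ.head ≠ [] ∧
  ∀ q ∈ τ.head, q.IsCQ ∧
    (∀ x ∈ q.conj.vars, x ∉ q.bound → x ∈ τ.univ) ∧
    (∀ x ∈ q.bound, x ∈ q.conj.atomVars)

/-- The body contains exactly one predicate atom (as a set). -/
def IsLinear (τ : Dependency S) : Prop :=
  ∃ α, ∀ β, β ∈ τ.body.atoms ↔ β = α

/-- Rename all variables of `τ` by `x ↦ x + N`. -/
def shift (N : ℕ) (τ : Dependency S) : Dependency S :=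
  ⟨τ.univ.map (· + N), τ.body.subst (fun x => .var (x + N)), τ.head.map (CQ.shift N)⟩

end Dependency

/-- The edge relation of the dependency graph of `Γ`. -/
def DepEdge {S : Signature} (Γ : Finset (Dependency S)) (τ₁ τ₂ : Dependency S) : Prop :=
  τ₁ ∈ Γ ∧ τ₂ ∈ Γ ∧
    ∃ q ∈ τ₁.head, ∃ α ∈ q.conj.atoms, ∃ β ∈ τ₂.body.atoms, α.pred = β.pred

def IsAcyclic {S : Signature} (Γ : Finset (Dependency S)) : Prop :=
  ∀ τ, ¬ Relation.TransGen (DepEdge Γ) τ τ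

/-- `l` enumerates `Γ` without repetitions, and no element of `l` reaches itself or an earlier
element in the dependency graph. -/
def IsTopologicalOrder {S : Signature} (Γ : Finset (Dependency S)) (l : List (Dependency S)) :
    Prop :=
  l.Nodup ∧ (∀ τ, τ ∈ l ↔ τ ∈ Γ) ∧
    ∀ i j : Fin l.length, j ≤ i → ¬ Relation.TransGen (DepEdge Γ) (l.get i) (l.get j)

/-! ### Repairs and entailment -/

def IsConsistent {S : Signature} (Γ : Finset (Dependency S)) (D : Set (GroundAtom S)) : Prop :=
  ∀ τ ∈ Γ, Models D τ.toFO

/-- The repairs of `⟨Γ, D⟩`: the maximal consistent subsets of `D`. -/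
def repairs {S : Signature} (Γ : Finset (Dependency S)) (D : Set (GroundAtom S)) : Set (Set (GroundAtom S)) :=
  {R | Maximal (fun E => E ⊆ D ∧ IsConsistent Γ E) R}

def AREntails {S : Signature} (Γ : Finset (Dependency S)) (D : Set (GroundAtom S)) (φ : FO S) : Prop :=
  ∀ R ∈ repairs Γ D, Models R φ

def IAREntails {S : Signature} (Γ : Finset (Dependency S)) (D : Set (GroundAtom S)) (φ : FO S) : Prop :=
  Models (⋂₀ repairs Γ D) φ

/-! ### Unification and the rewriting -/

/-- The substitution that first applies `σ` and then replaces `x` by `t`. -/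
def composeSingle (σ : ℕ → Term) (x : ℕ) (t : Term) : ℕ → Term :=
  fun y => (σ y).subst (fun z => if z = x then t else .var z)

/-- Extend `σ` to a most general unifier of a list of pairs of terms, if there is one. In each pair
a variable on the left is replaced in preference to one on the right. -/
def unify : List (Term × Term) → (ℕ → Term) → Option (ℕ → Term)
  | [], σ => some σ
  | (s, t) :: l, σ =>
    if s.subst σ = t.subst σ then unify l σ
    else match s.subst σ, t.subst σ with
      | .var x, t' => unify l (composeSingle σ x t')
      | .const c, .var y => unify l (composeSingle σ y (.const c))
      | .const _, .const _ => none

/-- The most general unifier of two atoms, with the variables of `β` replaced first. -/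
def mgu {S : Signature} (β α : Atom S) : Option (ℕ → Term) :=
  if h : β.pred = α.pred then
    unify (List.ofFn fun i => (β.args i, α.args (i.cast (congrArg S.arity h)))) .var
  else none

/-- The most general unifier of `α` with the body atom of a linear dependency. -/
def bodyUnify {S : Signature} (α : Atom S) (τ : Dependency S) : Option (ℕ → Term) :=
  match τ.body.atoms with
  | [] => none
  | β :: _ => mgu β α

/-- A number larger than all variables of `α`. -/
def Atom.fresh {S : Signature} (α : Atom S) : ℕ := α.vars.foldr max 0 + 1

/-- The condition under which an instance of `α` is an instance of the body of `τ`, where `σ` is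
the most general unifier of `α` with the body atom: the equalities that `σ` imposes on the
variables of `α`, and the inequalities of the body. It is empty if `σ` fixes the variables of `α`
and the body contains no inequality. -/
def bodyGuard {S : Signature} (α : Atom S) (τ : Dependency S) (σ : ℕ → Term) : List (FO S) :=
  (α.vars.filter (fun y => σ y ≠ .var y)).map (fun y => .eq (.var y) (σ y)) ++
    (τ.body.subst σ).ineqFOs

/-- The weak-consistency formula `Ψ^wc(α, {τ₁, …, τₕ})`. The variables of each dependency are
renamed apart from those of the atom. -/
def psiWc {S : Signature} : List (Dependency S) → Atom S → FO S
  | [], _ => .top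
  | τ :: l, α =>
    .and
      (match bodyUnify α (τ.shift α.fresh) with
        | none => .top
        | some σ =>
          FO.guarded (bodyGuard α (τ.shift α.fresh) σ)
            (FO.bigOr ((τ.shift α.fresh).head.map fun q =>
              FO.exs q.bound
                (.and (q.conj.subst (q.freeSubst σ)).toFO
                  (FO.bigAnd (q.conj.atoms.map fun β =>
                    psiWc l (β.subst (q.freeSubst σ))))))))
      (psiWc l α)

/-- `Ψ^iar(q, Σ)` for a BCQ `q`. -/
def psiIarCQ {S : Signature} (l : List (Dependency S)) (q : CQ S) : FO S :=
  FO.exs q.bound (.and q.conj.toFO (FO.bigAnd (q.conj.atoms.map (psiWc l))))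

/-- `Ψ^iar(Q, Σ)` for a BUCQ `Q`, where `l` is a topological order of `Σ`. -/
def psiIar {S : Signature} (l : List (Dependency S)) (Q : UCQ S) : FO S :=
  FO.bigOr (Q.map (psiIarCQ l))

/-! ### Circuits -/

/-- Names of gates. -/
abbrev Label := List ℕ

/-- Gates of unbounded fan-in; `and []` and `or []` are the constants. -/
inductive Gate where
  | input (i : ℕ)
  | not (a : Label)
  | and (as : List Label)
  | or (as : List Label)

/-- A Boolean circuit: named gates listed so that each gate uses gates named before it, and the
name of the output gate. (A name that has not been introduced stands for the constant false.) -/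
structure Circuit where
  gates : List (Label × Gate)
  output : Label

def Gate.value (w : List Bool) (env : Label → Bool) : Gate → Bool
  | .input i => w.getD i false
  | .not a => !(env a)
  | .and as => as.all env
  | .or as => as.any env

def Gate.fanIn : Gate → ℕ
  | .input _ => 0
  | .not _ => 1
  | .and as => as.length
  | .or as => as.length

def Gate.depth (env : Label → ℕ) : Gate → ℕ
  | .input _ => 0
  | .not a => env a + 1
  | .and as => (as.map env).foldr max 0 + 1
  | .or as => (as.map env).foldr max 0 + 1

namespace Circuit

/-- The value of the output gate on the input `w`. -/
def eval (C : Circuit) (w : List Bool) : Bool :=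
  C.gates.foldl (fun env g => Function.update env g.1 (g.2.value w env)) (fun _ => false) C.output

/-- The number of gates and wires. -/
def size (C : Circuit) : ℕ := (C.gates.map fun g => g.2.fanIn + 1).sum

/-- The length of a longest path that ends in the output gate. -/
def depth (C : Circuit) : ℕ :=
  C.gates.foldl (fun env g => Function.update env g.1 (g.2.depth env)) (fun _ => 0) C.output

end Circuit

/-- The alphabet for descriptions of circuits. -/
inductive DescSym where
  | tick | numEnd | labelEnd | inp | neg | conj | disj | gateEnd

def describeNum (i : ℕ) : List DescSym := List.replicate i .tick ++ [.numEnd]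

def describeLabel (a : Label) : List DescSym := a.flatMap describeNum ++ [.labelEnd]

def describeGate : Gate → List DescSym
  | .input i => .inp :: describeNum i
  | .not a => .neg :: describeLabel a
  | .and as => .conj :: as.flatMap describeLabel
  | .or as => .disj :: as.flatMap describeLabel

/-- The description of a circuit as a string. -/
def Circuit.describe (C : Circuit) : List DescSym :=
  C.gates.flatMap (fun g => describeLabel g.1 ++ describeGate g.2 ++ [.gateEnd]) ++
    describeLabel C.output

/-! ### Logarithmic space and AC⁰ -/

inductive Move where
  | left | stay | right

/-- The content of a cell of the input tape, which has end markers. -/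
inductive InputCell where
  | leftEnd
  | bit (b : Bool)
  | rightEnd

/-- A deterministic Turing machine with a read-only input tape, scanned by finitely many two-way
heads, finitely many work tapes, and a write-only output tape. (A position on the input takes
logarithmic space, so that the number of input heads does not affect what can be computed in
logarithmic space.) The machine halts when `next` returns `none`. -/
structure Transducer (Out : Type) where
  State : Type
  Cell : Type
  finite_state : Finite State
  finite_cell : Finite Cell
  numHeads : ℕ
  numTapes : ℕ
  start : State
  blank : Cell
  next : State → (Fin numHeads → InputCell) → (Fin numTapes → Cell) →
    Option (State × (Fin numHeads → Move) × (Fin numTapes → Cell × Move) × List Out)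

/-- A configuration. The input `w` occupies the cells `1, …, |w|` between the two end markers; work
tapes are infinite to the right. -/
structure Transducer.Config {Out : Type} (M : Transducer Out) where
  state : M.State
  inHead : Fin M.numHeads → ℕ
  tape : Fin M.numTapes → ℕ → M.Cell
  workHead : Fin M.numTapes → ℕ
  output : List Out

def Move.apply : Move → ℕ → ℕ
  | .left, i => i - 1
  | .stay, i => i
  | .right, i => i + 1

def readInput (w : List Bool) : ℕ → InputCell
  | 0 => .leftEnd
  | i + 1 => if h : i < w.length then .bit w[i] else .rightEnd

namespace Transducer

variable {Out : Type} (M : Transducer Out)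

def init : M.Config where
  state := M.start
  inHead := fun _ => 0
  tape := fun _ _ => M.blank
  workHead := fun _ => 0
  output := []

/-- One step on the input `w`. Input heads do not move beyond the end markers. -/
def step (w : List Bool) (c : M.Config) : Option M.Config :=
  (M.next c.state (fun h => readInput w (c.inHead h)) (fun k => c.tape k (c.workHead k))).map
    fun r =>
      { state := r.1
        inHead := fun h => min ((r.2.1 h).apply (c.inHead h)) (w.length + 1)
        tape := fun k => Function.update (c.tape k) (c.workHead k) (r.2.2.1 k).1
        workHead := fun k => (r.2.2.1 k).2.apply (c.workHead k)
        output := c.output ++ r.2.2.2 }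

def Reachable (w : List Bool) (c : M.Config) : Prop :=
  Relation.ReflTransGen (fun a b => M.step w a = some b) M.init c

/-- On the input `w`, the machine halts with output `out`, and its work heads never leave the cells
`0, …, s`. -/
def OutputsInSpace (w : List Bool) (s : ℕ) (out : List Out) : Prop :=
  (∀ c, M.Reachable w c → ∀ k, c.workHead k ≤ s) ∧
    ∃ c, M.Reachable w c ∧ M.step w c = none ∧ c.output = out

end Transducer

/-- A description of the `n`-th circuit can be computed from `1ⁿ` in space `O(log n)`. -/
def IsLogspaceUniform (C : ℕ → Circuit) : Prop :=
  ∃ (M : Transducer DescSym) (c : ℕ), ∀ n : ℕ,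
    M.OutputsInSpace (List.replicate n true) (c * (Nat.log 2 n + 1)) (C n).describe

/-- Logspace-uniform AC⁰: constant depth, polynomial size, unbounded fan-in. -/
def InAC0 (L : Set (List Bool)) : Prop :=
  ∃ C : ℕ → Circuit,
    IsLogspaceUniform C ∧
    (∃ c : ℕ, ∀ n, (C n).size ≤ c * (n + 1) ^ c) ∧
    (∃ d : ℕ, ∀ n, (C n).depth ≤ d) ∧
    ∀ w : List Bool, (C w.length).eval w = true ↔ w ∈ L

/-! ### The decision problems -/

/-- All constants of `D` are smaller than `m`. -/
def ConstantsBelow {S : Signature} (m : ℕ) (D : Set (GroundAtom S)) : Prop :=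
  ∀ f ∈ D, ∀ i, f.args i < m

open Classical in
/-- The usual binary encoding of a database over the constants `0, …, m - 1`: for each predicate of
arity `a`, in order, the `m ^ a` bits of its characteristic function. -/
noncomputable def encodeDB {S : Signature} (m : ℕ) (D : Set (GroundAtom S)) : List Bool :=
  List.ofFn fun j : Fin (∑ p : Fin S.numPred, m ^ S.arity p) =>
    let k := finSigmaFinEquiv.symm j
    decide ((⟨k.1, fun i => ((finFunctionFinEquiv.symm k.2) i : ℕ)⟩ : GroundAtom S) ∈ D)

/-- The encodings of the databases with the property `P`. -/
def dataProblem {S : Signature} (P : Set (GroundAtom S) → Prop) : Set (List Bool) :=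
  {w | ∃ (m : ℕ) (D : Set (GroundAtom S)),
    IsDatabase D ∧ ConstantsBelow m D ∧ w = encodeDB m D ∧ P D}

end CQA

open CQA

namespace CQA

/-! ### Evaluation of terms, atoms and formulas -/

section Semantics

variable {S : Signature}

/-! With one body atom, a dependency makes its demand on each fact separately, and the demand is
monotone: it asks for witnesses in the set. Hence there is a largest consistent subset of `D`, which
is the only repair, and AR- and IAR-entailment coincide. Acyclicity makes this repair definable in
finitely many steps. Call a fact weakly consistent (`WeaklyConsistent`) for a list of dependencies
if, for every dependency of the list that it triggers, `D` contains head witnesses that are weakly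
consistent for the rest of the list. Facts of a consistent subset are weakly consistent
(`weaklyConsistent_of_mem`). Conversely, a witness for `τ` cannot trigger `τ` or an earlier
dependency of a topological order, so checking it against the later ones is enough, and the weakly
consistent facts form a consistent set (`isConsistent_weaklyConsistent`). This gives
`repairs_eq_singleton`.

The formula `psiWc` expresses weak consistency (`holdsIn_psiWc`). Since terms are flat, the most
general unifier describes all common instances of the body atom and `α`: the guard says that the
given instance of `α` is one of them, and the unifier then determines the values of all body
variables. `psiIar` therefore evaluates the query in the repair (`holdsIn_psiIar`).

Safety makes the rewriting domain independent. All equivalences are proved for quantifiers ranging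
over any set `A` that contains the constants of `D` (`FO.HoldsIn`): `A = Set.univ` gives the
first-order statement, and `A = {c | c < m}` gives a sentence that a circuit can evaluate. In the
circuit quantifiers become gates of fan-in `m`, so the depth depends on the formula only and the
size is polynomial. Gate names are paths in the evaluation tree; for uniformity they are written by
nested loops of a machine without work tapes, whose input heads are its counters (`Fragment`). The
number `m` is not given, so the circuit for length `n` takes the disjunction over all `m ≤ n` with
the right encoding length (`eval_foCircuit`). -/

theorem Term.eval_congr {u v : ℕ → ℕ} {t : Term} (h : ∀ x ∈ t.vars, u x = v x) :
    t.eval u = t.eval v := by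
  cases t <;> simp_all [Term.eval, Term.vars]

theorem Term.eval_subst (σ : ℕ → Term) (v : ℕ → ℕ) (t : Term) :
    (t.subst σ).eval v = t.eval fun x => (σ x).eval v := by
  cases t <;> rfl

theorem Term.mem_vars_subst {σ : ℕ → Term} {t : Term} {y : ℕ} :
    y ∈ (t.subst σ).vars ↔ ∃ x ∈ t.vars, y ∈ (σ x).vars := by
  cases t <;> simp [Term.subst, Term.vars]

theorem Atom.mem_vars {α : Atom S} {x : ℕ} : x ∈ α.vars ↔ ∃ i, x ∈ (α.args i).vars := by
  simp [Atom.vars, List.mem_flatMap, List.mem_ofFn]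

theorem Atom.ground_congr {u v : ℕ → ℕ} {α : Atom S} (h : ∀ x ∈ α.vars, u x = v x) :
    α.ground u = α.ground v := by
  simp only [Atom.ground]
  congr 1
  funext i
  exact Term.eval_congr fun x hx => h x (Atom.mem_vars.2 ⟨i, hx⟩)

theorem Atom.ground_subst (σ : ℕ → Term) (v : ℕ → ℕ) (α : Atom S) :
    (α.subst σ).ground v = α.ground fun x => (σ x).eval v := by
  simp only [Atom.ground, Atom.subst, Term.eval_subst]

theorem Atom.mem_vars_subst {σ : ℕ → Term} {α : Atom S} {y : ℕ} :
    y ∈ (α.subst σ).vars ↔ ∃ x ∈ α.vars, y ∈ (σ x).vars := by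
  rw [Atom.mem_vars]
  simp only [Atom.mem_vars, Atom.subst, Term.mem_vars_subst]
  constructor
  · rintro ⟨i, x, hx, hy⟩
    exact ⟨x, ⟨i, hx⟩, hy⟩
  · rintro ⟨x, ⟨i, hx⟩, hy⟩
    exact ⟨i, x, hx, hy⟩

theorem Atom.lt_fresh {α : Atom S} {x : ℕ} (hx : x ∈ α.vars) : x < α.fresh := by
  have : ∀ l : List ℕ, x ∈ l → x ≤ l.foldr max 0 := by
    intro l
    induction l with
    | nil => simp
    | cons a l ih =>
      intro h
      rcases List.mem_cons.1 h with rfl | h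
      · simp
      · exact (ih h).trans (by simp)
  exact Nat.lt_succ_of_le (this _ hx)

/-- The values of the variables of an atom occur in its ground instance. -/
theorem Atom.exists_args_eq {α : Atom S} (v : ℕ → ℕ) {x : ℕ} (hx : x ∈ α.vars) :
    ∃ i, (α.ground v).args i = v x := by
  obtain ⟨i, hi⟩ := Atom.mem_vars.1 hx
  refine ⟨i, ?_⟩
  cases hα : α.args i with
  | var y =>
    rw [hα] at hi
    simp only [Term.vars, List.mem_singleton] at hi
    subst hi
    simp [Atom.ground, hα, Term.eval]
  | const c => simp [hα, Term.vars] at hi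

/-! ### First-order satisfaction over a restricted domain -/

namespace FO

/-- Satisfaction with quantifiers that range over `A`. -/
def HoldsIn (A : Set ℕ) (D : Set (GroundAtom S)) : (ℕ → ℕ) → FO S → Prop
  | _, .top => True
  | _, .bot => False
  | v, .atom α => α.ground v ∈ D
  | v, .eq s t => s.eval v = t.eval v
  | v, .neg φ => ¬ HoldsIn A D v φ
  | v, .and φ ψ => HoldsIn A D v φ ∧ HoldsIn A D v ψ
  | v, .or φ ψ => HoldsIn A D v φ ∨ HoldsIn A D v ψ
  | v, .ex x φ => ∃ c ∈ A, HoldsIn A D (Function.update v x c) φ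
  | v, .all x φ => ∀ c ∈ A, HoldsIn A D (Function.update v x c) φ

variable {A : Set ℕ} {D : Set (GroundAtom S)}

theorem holdsIn_univ {v : ℕ → ℕ} {φ : FO S} : HoldsIn Set.univ D v φ ↔ Holds D v φ := by
  induction φ generalizing v <;> simp_all [HoldsIn, Holds]

theorem holdsIn_bigAnd {v : ℕ → ℕ} {l : List (FO S)} :
    HoldsIn A D v (bigAnd l) ↔ ∀ φ ∈ l, HoldsIn A D v φ := by
  induction l with
  | nil => simp [bigAnd, HoldsIn]
  | cons φ l ih =>
    rw [show bigAnd (φ :: l) = .and φ (bigAnd l) from rfl]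
    simp [HoldsIn, ih]

theorem holdsIn_bigOr {v : ℕ → ℕ} {l : List (FO S)} :
    HoldsIn A D v (bigOr l) ↔ ∃ φ ∈ l, HoldsIn A D v φ := by
  induction l with
  | nil => simp [bigOr, HoldsIn]
  | cons φ l ih =>
    rw [show bigOr (φ :: l) = .or φ (bigOr l) from rfl]
    simp [HoldsIn, ih]

theorem holdsIn_guarded {v : ℕ → ℕ} {gs : List (FO S)} {φ : FO S} :
    HoldsIn A D v (guarded gs φ) ↔ ((∀ g ∈ gs, HoldsIn A D v g) → HoldsIn A D v φ) := by
  cases gs with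
  | nil => simp [guarded]
  | cons g gs =>
    rw [← holdsIn_bigAnd]
    simp only [guarded, imp, HoldsIn]
    tauto

theorem holdsIn_exs {v : ℕ → ℕ} {xs : List ℕ} {φ : FO S} :
    HoldsIn A D v (exs xs φ) ↔
      ∃ u : ℕ → ℕ, (∀ x, x ∉ xs → u x = v x) ∧ (∀ x ∈ xs, u x ∈ A) ∧ HoldsIn A D u φ := by
  induction xs generalizing v with
  | nil =>
    simp only [exs, List.foldr_nil, List.not_mem_nil, not_false_eq_true, forall_const, false_imp_iff,
      true_and]
    constructor
    · exact fun h => ⟨v, fun _ => rfl, h⟩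
    · rintro ⟨u, hu, h⟩
      rwa [← funext hu]
  | cons x xs ih =>
    rw [show exs (x :: xs) φ = .ex x (exs xs φ) from rfl]
    simp only [HoldsIn, ih, List.mem_cons, not_or]
    constructor
    · rintro ⟨c, hc, u, hu, huA, h⟩
      refine ⟨u, fun y hy => ?_, ?_, h⟩
      · rw [hu y hy.2, Function.update_of_ne hy.1]
      · rintro y (rfl | hy)
        -- A name may be quantified again in the tail; the outer choice `c` counts only if it is
        -- not.
        · by_cases hm : y ∈ xs
          · exact huA y hm
          · rw [hu y hm]
            simpa using hc
        · exact huA y hy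
    · rintro ⟨u, hu, huA, h⟩
      refine ⟨u x, huA x (Or.inl rfl), u, fun y hy => ?_, fun y hy => huA y (Or.inr hy), h⟩
      by_cases hyx : y = x
      · subst hyx; simp
      · rw [Function.update_of_ne hyx, hu y ⟨hyx, hy⟩]

theorem holds_alls {v : ℕ → ℕ} {xs : List ℕ} {φ : FO S} :
    Holds D v (alls xs φ) ↔ ∀ u : ℕ → ℕ, (∀ x, x ∉ xs → u x = v x) → Holds D u φ := by
  induction xs generalizing v with
  | nil =>
    constructor
    · intro h u hu
      rwa [show u = v from funext fun x => hu x (by simp)]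
    · exact fun h => h v fun _ _ => rfl
  | cons x xs ih =>
    rw [show alls (x :: xs) φ = .all x (alls xs φ) from rfl]
    simp only [Holds, ih, List.mem_cons, not_or]
    constructor
    · intro h u hu
      refine h (u x) u fun y hy => ?_
      by_cases hyx : y = x
      · subst hyx; simp
      · rw [Function.update_of_ne hyx, hu y ⟨hyx, hy⟩]
    · intro h c u hu
      exact h u fun y hy => by rw [hu y hy.2, Function.update_of_ne hy.1]

theorem freeVars_bigAnd {l : List (FO S)} {V : Set ℕ} (h : ∀ φ ∈ l, φ.freeVars ⊆ V) :
    (bigAnd l).freeVars ⊆ V := by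
  induction l with
  | nil => simp [bigAnd, freeVars]
  | cons φ l ih =>
    rw [show bigAnd (φ :: l) = .and φ (bigAnd l) from rfl]
    exact Set.union_subset (h φ (by simp)) (ih fun ψ hψ => h ψ (by simp [hψ]))

theorem freeVars_bigOr {l : List (FO S)} {V : Set ℕ} (h : ∀ φ ∈ l, φ.freeVars ⊆ V) :
    (bigOr l).freeVars ⊆ V := by
  induction l with
  | nil => simp [bigOr, freeVars]
  | cons φ l ih =>
    rw [show bigOr (φ :: l) = .or φ (bigOr l) from rfl]
    exact Set.union_subset (h φ (by simp)) (ih fun ψ hψ => h ψ (by simp [hψ]))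

theorem freeVars_guarded {gs : List (FO S)} {φ : FO S} {V : Set ℕ}
    (hg : ∀ g ∈ gs, g.freeVars ⊆ V) (hφ : φ.freeVars ⊆ V) : (guarded gs φ).freeVars ⊆ V := by
  cases gs with
  | nil => exact hφ
  | cons g gs => exact Set.union_subset (freeVars_bigAnd hg) hφ

theorem freeVars_exs {xs : List ℕ} {φ : FO S} :
    (exs xs φ).freeVars = φ.freeVars \ {x | x ∈ xs} := by
  induction xs with
  | nil => simp [exs]
  | cons x xs ih =>
    rw [show exs (x :: xs) φ = .ex x (exs xs φ) from rfl]
    ext y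
    simp only [freeVars, ih, Set.mem_sdiff, Set.mem_ofPred_eq, Set.mem_singleton_iff, List.mem_cons]
    tauto

end FO

/-! ### Conjunctions under a valuation -/

namespace Conj

/-- Satisfaction of a conjunction under a valuation. -/
def Holds (D : Set (GroundAtom S)) (v : ℕ → ℕ) (γ : Conj S) : Prop :=
  (∀ α ∈ γ.atoms, α.ground v ∈ D) ∧ ∀ e ∈ γ.ineqs, e.1.eval v ≠ e.2.eval v

variable {A : Set ℕ} {D : Set (GroundAtom S)}

theorem holdsIn_ineqFOs {v : ℕ → ℕ} {γ : Conj S} :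
    (∀ φ ∈ γ.ineqFOs, FO.HoldsIn A D v φ) ↔ ∀ e ∈ γ.ineqs, e.1.eval v ≠ e.2.eval v := by
  rw [ineqFOs, List.forall_mem_map]
  rfl

theorem holdsIn_toFO {v : ℕ → ℕ} {γ : Conj S} : FO.HoldsIn A D v γ.toFO ↔ γ.Holds D v := by
  rw [toFO, FO.holdsIn_bigAnd, List.forall_mem_append, holdsIn_ineqFOs, Holds]
  simp [FO.HoldsIn]

theorem mem_atomVars {γ : Conj S} {x : ℕ} : x ∈ γ.atomVars ↔ ∃ α ∈ γ.atoms, x ∈ α.vars := by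
  simp [atomVars]

theorem mem_vars {γ : Conj S} {x : ℕ} : x ∈ γ.vars ↔
    (∃ α ∈ γ.atoms, x ∈ α.vars) ∨ ∃ e ∈ γ.ineqs, x ∈ e.1.vars ∨ x ∈ e.2.vars := by
  simp [vars, atomVars]

theorem holds_congr {u v : ℕ → ℕ} {γ : Conj S} (h : ∀ x ∈ γ.vars, u x = v x) :
    γ.Holds D u ↔ γ.Holds D v := by
  refine and_congr (forall₂_congr fun α hα => ?_) (forall₂_congr fun e he => ?_)
  · rw [Atom.ground_congr fun x hx => h x (mem_vars.2 (Or.inl ⟨α, hα, hx⟩))]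
  · rw [Term.eval_congr fun x hx => h x (mem_vars.2 (Or.inr ⟨e, he, Or.inl hx⟩)),
      Term.eval_congr fun x hx => h x (mem_vars.2 (Or.inr ⟨e, he, Or.inr hx⟩))]

theorem holds_subst {σ : ℕ → Term} {v : ℕ → ℕ} {γ : Conj S} :
    (γ.subst σ).Holds D v ↔ γ.Holds D fun x => (σ x).eval v := by
  simp only [Holds, subst, List.forall_mem_map, Atom.ground_subst, Term.eval_subst]

theorem mem_vars_subst {σ : ℕ → Term} {γ : Conj S} {y : ℕ} :
    y ∈ (γ.subst σ).vars ↔ ∃ x ∈ γ.vars, y ∈ (σ x).vars := by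
  simp only [mem_vars, subst, List.mem_map, exists_exists_and_eq_and, Atom.mem_vars_subst,
    Term.mem_vars_subst]
  constructor
  · rintro (⟨α, hα, x, hx, hy⟩ | ⟨e, he, ⟨x, hx, hy⟩ | ⟨x, hx, hy⟩⟩)
    · exact ⟨x, Or.inl ⟨α, hα, hx⟩, hy⟩
    · exact ⟨x, Or.inr ⟨e, he, Or.inl hx⟩, hy⟩
    · exact ⟨x, Or.inr ⟨e, he, Or.inr hx⟩, hy⟩
  · rintro ⟨x, (⟨α, hα, hx⟩ | ⟨e, he, hx | hx⟩), hy⟩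
    · exact Or.inl ⟨α, hα, x, hx, hy⟩
    · exact Or.inr ⟨e, he, Or.inl ⟨x, hx, hy⟩⟩
    · exact Or.inr ⟨e, he, Or.inr ⟨x, hx, hy⟩⟩

/-- The source of domain independence: a variable in a predicate atom takes its value from an
argument of a fact of `D`, so safe quantifiers may be restricted to `A`. -/
theorem mem_of_holds {v : ℕ → ℕ} {γ : Conj S} (hA : ∀ f ∈ D, ∀ i, f.args i ∈ A)
    (h : γ.Holds D v) {x : ℕ} (hx : x ∈ γ.atomVars) : v x ∈ A := by
  obtain ⟨α, hα, hx⟩ := mem_atomVars.1 hx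
  obtain ⟨i, hi⟩ := Atom.exists_args_eq v hx
  exact hi ▸ hA _ (h.1 α hα) i

theorem freeVars_ineqFOs {γ : Conj S} : ∀ φ ∈ γ.ineqFOs, φ.freeVars ⊆ {x | x ∈ γ.vars} := by
  intro φ hφ x hx
  obtain ⟨e, he, rfl⟩ := List.mem_map.1 hφ
  exact mem_vars.2 (Or.inr ⟨e, he, hx⟩)

theorem freeVars_toFO {γ : Conj S} : γ.toFO.freeVars ⊆ {x | x ∈ γ.vars} := by
  refine FO.freeVars_bigAnd fun φ hφ => ?_
  rcases List.mem_append.1 hφ with hφ | hφ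
  · obtain ⟨α, hα, rfl⟩ := List.mem_map.1 hφ
    exact fun x hx => mem_vars.2 (Or.inl ⟨α, hα, hx⟩)
  · exact freeVars_ineqFOs φ hφ

end Conj

/-- `Models` already ranges over all valuations, so the universal prefix is absorbed and consistency
becomes a statement about valuations alone. -/
theorem Dependency.models_toFO {D : Set (GroundAtom S)} {τ : Dependency S} :
    Models D τ.toFO ↔ ∀ u, τ.body.Holds D u → ∃ q ∈ τ.head, ∃ u' : ℕ → ℕ,
      (∀ x, x ∉ q.bound → u' x = u x) ∧ q.conj.Holds D u' := by
  have key : ∀ u, FO.Holds D u (FO.imp τ.body.toFO τ.head.toFO) ↔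
      (τ.body.Holds D u → ∃ q ∈ τ.head, ∃ u' : ℕ → ℕ,
        (∀ x, x ∉ q.bound → u' x = u x) ∧ q.conj.Holds D u') := by
    intro u
    rw [FO.imp, FO.Holds, FO.Holds, ← FO.holdsIn_univ, ← FO.holdsIn_univ, Conj.holdsIn_toFO,
      UCQ.toFO, FO.holdsIn_bigOr, ← imp_iff_not_or]
    simp [CQ.toFO, FO.holdsIn_exs, Conj.holdsIn_toFO]
  simp only [Models, Dependency.toFO, FO.holds_alls, key]
  exact ⟨fun h u => h u u fun _ _ => rfl, fun h _ u _ => h u⟩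

end Semantics

/-! ### Unification -/

section Unification

/-- The valuation `w` satisfies all equations `y = σ y`. -/
def Solves (w : ℕ → ℕ) (σ : ℕ → Term) : Prop := ∀ y, w y = (σ y).eval w

/-- The variables that `σ` introduces are fixed by `σ`. -/
def IsIdem (σ : ℕ → Term) : Prop := ∀ y z, σ y = .var z → σ z = .var z

/-- All variables of `t` belong to `V`. -/
def Term.VarsIn (V : Set ℕ) (t : Term) : Prop := ∀ x ∈ t.vars, x ∈ V

theorem Term.subst_eq_var_of_isIdem {σ : ℕ → Term} (h : IsIdem σ) {t : Term} {z : ℕ}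
    (ht : t.subst σ = .var z) : σ z = .var z := by
  cases t with
  | var y => exact h y z ht
  | const c => simp [Term.subst] at ht

/-- The binding of `x` stays idempotent because its target is a constant or a variable that is
already fixed and different from `x`. No occurs check is needed for flat terms. -/
theorem isIdem_composeSingle {σ : ℕ → Term} (h : IsIdem σ) {x : ℕ} {t : Term}
    (ht : ∀ z, t = .var z → σ z = .var z ∧ z ≠ x) : IsIdem (composeSingle σ x t) := by
  intro y z hyz
  have key : σ z = .var z ∧ z ≠ x := by
    cases hy : σ y with
    | const c => simp [composeSingle, hy, Term.subst] at hyz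
    | var a =>
      simp only [composeSingle, hy, Term.subst] at hyz
      split_ifs at hyz with hax
      · exact ht z hyz
      · cases hyz
        exact ⟨h y _ hy, hax⟩
  simp [composeSingle, key.1, Term.subst, key.2]

theorem eval_composeSingle {w : ℕ → ℕ} {σ : ℕ → Term} {x : ℕ} {t : Term}
    (hx : w x = t.eval w) (y : ℕ) : (composeSingle σ x t y).eval w = (σ y).eval w := by
  rw [composeSingle, Term.eval_subst]
  congr 1
  funext z
  split_ifs with hz
  · rw [hz, hx]
  · rfl

theorem solves_composeSingle {w : ℕ → ℕ} {σ : ℕ → Term} {x : ℕ} {t : Term}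
    (hσx : σ x = .var x) :
    Solves w (composeSingle σ x t) ↔ Solves w σ ∧ w x = t.eval w := by
  constructor
  · intro h
    have hx : w x = t.eval w := by
      have := h x
      simpa [composeSingle, hσx, Term.subst] using this
    exact ⟨fun y => by rw [← eval_composeSingle hx]; exact h y, hx⟩
  · rintro ⟨h, hx⟩ y
    rw [eval_composeSingle hx]
    exact h y

theorem Solves.eval_subst {w : ℕ → ℕ} {σ : ℕ → Term} (h : Solves w σ) (t : Term) :
    (t.subst σ).eval w = t.eval w := by
  rw [Term.eval_subst]
  congr 1
  exact (funext h).symm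

/-- Being most general is used only in semantic form: the valuations that solve the unifier are
exactly the solutions of the equations. Each recursion step replaces one equation by an equivalent
binding. -/
theorem unify_spec (l : List (Term × Term)) (σ₀ : ℕ → Term) (h₀ : IsIdem σ₀) :
    (unify l σ₀ = none → ∀ w, Solves w σ₀ → ¬ ∀ p ∈ l, p.1.eval w = p.2.eval w) ∧
    ∀ σ, unify l σ₀ = some σ → IsIdem σ ∧
      ∀ w, Solves w σ ↔ Solves w σ₀ ∧ ∀ p ∈ l, p.1.eval w = p.2.eval w := by
  induction l generalizing σ₀ with
  | nil => simp [unify, h₀]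
  | cons p l ih =>
    obtain ⟨s, t⟩ := p
    simp only [List.forall_mem_cons]
    rw [unify]
    split_ifs with hst
    · have heq : ∀ w, Solves w σ₀ → s.eval w = t.eval w := fun w hw => by
        rw [← hw.eval_subst s, ← hw.eval_subst t, hst]
      obtain ⟨h1, h2⟩ := ih σ₀ h₀
      refine ⟨fun hn w hw h => h1 hn w hw h.2, fun σ hσ => ⟨(h2 σ hσ).1, fun w => ?_⟩⟩
      rw [(h2 σ hσ).2]
      exact ⟨fun h => ⟨h.1, heq w h.1, h.2⟩, fun h => ⟨h.1, h.2.2⟩⟩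
    -- Common to replacing a variable on the left and one on the right: for solutions of `σ₀`, the
    -- new binding is equivalent to `s = t`.
    · have step : ∀ x t', σ₀ x = .var x → (∀ z, t' = .var z → σ₀ z = .var z ∧ z ≠ x) →
          (∀ w, Solves w σ₀ → (w x = t'.eval w ↔ s.eval w = t.eval w)) →
          (unify l (composeSingle σ₀ x t') = none →
            ∀ w, Solves w σ₀ → ¬ (s.eval w = t.eval w ∧ ∀ p ∈ l, p.1.eval w = p.2.eval w)) ∧
          ∀ σ, unify l (composeSingle σ₀ x t') = some σ → IsIdem σ ∧
            ∀ w, Solves w σ ↔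
              Solves w σ₀ ∧ s.eval w = t.eval w ∧ ∀ p ∈ l, p.1.eval w = p.2.eval w := by
        intro x t' hx ht' hiff
        obtain ⟨h1, h2⟩ := ih _ (isIdem_composeSingle h₀ ht')
        refine ⟨fun hn w hw h => ?_, fun σ hσ => ⟨(h2 σ hσ).1, fun w => ?_⟩⟩
        · exact h1 hn w ((solves_composeSingle hx).2 ⟨hw, (hiff w hw).2 h.1⟩) h.2
        · rw [(h2 σ hσ).2, solves_composeSingle hx]
          constructor
          · rintro ⟨⟨a, b⟩, c⟩
            exact ⟨a, (hiff w a).1 b, c⟩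
          · rintro ⟨a, b, c⟩
            exact ⟨⟨a, (hiff w a).2 b⟩, c⟩
      cases hs : s.subst σ₀ with
      | var x =>
        refine step x (t.subst σ₀) (Term.subst_eq_var_of_isIdem h₀ hs) (fun z hz => ?_) ?_
        · refine ⟨Term.subst_eq_var_of_isIdem h₀ hz, ?_⟩
          rintro rfl
          exact hst (hs.trans hz.symm)
        · intro w hw
          rw [← hw.eval_subst s, ← hw.eval_subst t, hs]
          rfl
      | const c =>
        cases ht : t.subst σ₀ with
        | var y =>
          refine step y (.const c) (Term.subst_eq_var_of_isIdem h₀ ht) (by simp) ?_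
          intro w hw
          rw [← hw.eval_subst s, ← hw.eval_subst t, hs, ht]
          exact eq_comm
        | const d =>
          refine ⟨fun _ w hw h => ?_, by simp⟩
          have := h.1
          rw [← hw.eval_subst s, ← hw.eval_subst t, hs, ht] at this
          simp only [Term.eval] at this
          exact hst (by rw [hs, ht, this])

theorem Term.VarsIn.subst {V : Set ℕ} {σ : ℕ → Term} {t : Term} (ht : t.VarsIn V)
    (hσ : ∀ y ∈ V, (σ y).VarsIn V) : (t.subst σ).VarsIn V := by
  intro y hy
  obtain ⟨x, hx, hy⟩ := Term.mem_vars_subst.1 hy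
  exact hσ x (ht x hx) y hy

/-- This is where the preference for replacing left variables pays off. With `V` the variables of
`α`, every body variable ends up as a constant or a variable of `α`, and anything not mapped into
`V` is left fixed. The first fact bounds the free variables of the rewriting; the second excludes
capture by head quantifiers. -/
theorem unify_varsIn {V : Set ℕ} (l : List (Term × Term)) (σ₀ : ℕ → Term)
    (hl : ∀ p ∈ l, p.2.VarsIn V) (hV : ∀ y ∈ V, (σ₀ y).VarsIn V)
    (h₀ : ∀ y, (σ₀ y).VarsIn V ∨ σ₀ y = .var y) {σ : ℕ → Term} (hσ : unify l σ₀ = some σ) :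
    (∀ y, (σ y).VarsIn V ∨ σ y = .var y) ∧ (∀ y, (σ₀ y).VarsIn V → (σ y).VarsIn V) ∧
      ∀ p ∈ l, ∀ x ∈ p.1.vars, (σ x).VarsIn V := by
  induction l generalizing σ₀ with
  | nil =>
    simp only [unify, Option.some.injEq] at hσ
    subst hσ
    exact ⟨h₀, fun _ => id, by simp⟩
  | cons p l ih =>
    obtain ⟨s, t⟩ := p
    simp only [List.forall_mem_cons] at hl ⊢
    have htV : (t.subst σ₀).VarsIn V := hl.1.subst hV
    rw [unify] at hσ
    split_ifs at hσ with hst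
    · obtain ⟨h1, h2, h3⟩ := ih σ₀ hl.2 hV h₀ hσ
      refine ⟨h1, h2, fun x hx => h2 x ?_, h3⟩
      cases s with
      | var y =>
        simp only [Term.vars, List.mem_singleton] at hx
        subst hx
        rw [show σ₀ x = t.subst σ₀ from hst]
        exact htV
      | const c => simp [Term.vars] at hx
    · have mono : ∀ x t', t'.VarsIn V → ∀ a : Term, a.VarsIn V →
          (a.subst fun z => if z = x then t' else .var z).VarsIn V := by
        intro x t' ht' a ha y hy
        obtain ⟨b, hb, hy⟩ := Term.mem_vars_subst.1 hy
        split_ifs at hy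
        · exact ht' y hy
        · simp only [Term.vars, List.mem_singleton] at hy
          exact hy ▸ ha b hb
      have step : ∀ x t', t'.VarsIn V → unify l (composeSingle σ₀ x t') = some σ →
          (∀ y, (σ y).VarsIn V ∨ σ y = .var y) ∧
          (∀ y, (composeSingle σ₀ x t' y).VarsIn V → (σ y).VarsIn V) ∧
          (∀ y, (σ₀ y).VarsIn V → (σ y).VarsIn V) ∧
          ∀ p ∈ l, ∀ x ∈ p.1.vars, (σ x).VarsIn V := by
        intro x t' ht' h
        obtain ⟨h1, h2, h3⟩ := ih _ hl.2 (fun y hy => mono x t' ht' _ (hV y hy)) (fun y => by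
          rcases h₀ y with h | h
          · exact Or.inl (mono x t' ht' _ h)
          · simp only [h, Term.subst]
            split_ifs with hyx
            · exact Or.inl ht'
            · exact Or.inr rfl) h
        exact ⟨h1, h2, fun y hy => h2 y (mono x t' ht' _ hy), h3⟩
      cases hs : s.subst σ₀ with
      | var x =>
        rw [hs] at hσ
        obtain ⟨h1, h2, h3, h4⟩ := step x _ htV hσ
        refine ⟨h1, h3, fun y hy => ?_, h4⟩
        cases s with
        | var a =>
          simp only [Term.vars, List.mem_singleton] at hy
          subst hy
          refine h2 y ?_
          simp only [composeSingle, show σ₀ y = .var x from hs, Term.subst, if_true]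
          exact htV
        | const c => simp [Term.vars] at hy
      | const c =>
        have hsV : ∀ y ∈ s.vars, (σ₀ y).VarsIn V := by
          intro y hy
          cases s with
          | var a =>
            simp only [Term.vars, List.mem_singleton] at hy
            subst hy
            rw [show σ₀ y = .const c from hs]
            simp [Term.VarsIn, Term.vars]
          | const c => simp [Term.vars] at hy
        cases ht : t.subst σ₀ with
        | var y =>
          rw [hs, ht] at hσ
          obtain ⟨h1, h2, h3, h4⟩ := step y (.const c) (by simp [Term.VarsIn, Term.vars]) hσ
          exact ⟨h1, h3, fun z hz => h3 z (hsV z hz), h4⟩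
        | const d =>
          rw [hs, ht] at hσ
          simp at hσ

variable {S : Signature}

theorem mgu_eq_none {β α : Atom S} (h : mgu β α = none) (w : ℕ → ℕ) :
    β.ground w ≠ α.ground w := by
  obtain ⟨p, b⟩ := β
  obtain ⟨p', a⟩ := α
  intro hw
  have hp : p = p' := congrArg GroundAtom.pred hw
  subst hp
  simp only [Atom.ground, GroundAtom.mk.injEq, heq_eq_eq, true_and] at hw
  rw [mgu, dif_pos rfl] at h
  refine (unify_spec _ _ fun _ z _ => rfl).1 h w (fun _ => rfl) fun q hq => ?_
  obtain ⟨i, rfl⟩ := List.mem_ofFn.1 hq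
  exact congrFun hw i

theorem mgu_eq_some {β α : Atom S} {σ : ℕ → Term} (h : mgu β α = some σ) :
    IsIdem σ ∧ (∀ w, Solves w σ ↔ β.ground w = α.ground w) ∧
      (∀ y, (σ y).VarsIn {x | x ∈ α.vars} ∨ σ y = .var y) ∧
      (∀ y ∈ α.vars, (σ y).VarsIn {x | x ∈ α.vars}) ∧
      ∀ y ∈ β.vars, (σ y).VarsIn {x | x ∈ α.vars} := by
  obtain ⟨p, b⟩ := β
  obtain ⟨p', a⟩ := α
  by_cases hp : p = p'
  · subst hp
    rw [mgu, dif_pos rfl] at h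
    have hself : ∀ y (V : Set ℕ), y ∈ V → (Term.var y).VarsIn V := by
      intro y V hy x hx
      simp only [Term.vars, List.mem_singleton] at hx
      exact hx ▸ hy
    obtain ⟨h1, h2⟩ := (unify_spec _ _ fun _ z _ => rfl).2 σ h
    obtain ⟨h3, h4, h5⟩ := unify_varsIn (V := {x | x ∈ (⟨p, a⟩ : Atom S).vars}) _ _
      (fun q hq => by
        obtain ⟨i, rfl⟩ := List.mem_ofFn.1 hq
        exact fun x hx => Atom.mem_vars.2 ⟨i, hx⟩)
      (fun y hy => hself y _ hy) (fun y => Or.inr rfl) h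
    refine ⟨h1, fun w => ?_, h3, fun y hy => h4 y (hself y _ hy), fun y hy => ?_⟩
    · rw [h2]
      simp only [Atom.ground, GroundAtom.mk.injEq, heq_eq_eq, true_and, List.forall_mem_ofFn_iff]
      exact ⟨fun h => funext h.2, fun h => ⟨fun _ => rfl, fun i => congrFun h i⟩⟩
    · obtain ⟨i, hi⟩ := Atom.mem_vars.1 hy
      exact h5 _ (List.mem_ofFn.2 ⟨i, rfl⟩) y hi
  · rw [mgu, dif_neg hp] at h
    simp at h

end Unification

/-! ### Weak consistency and the unique repair -/

section Rewriting

variable {S : Signature}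

/-- The facts that satisfy the dependencies of a list in `D`, where the facts that witness the head
of a dependency have to satisfy the dependencies after it. -/
def WeaklyConsistent (D : Set (GroundAtom S)) : List (Dependency S) → GroundAtom S → Prop
  | [], _ => True
  | τ :: l, f =>
    (∀ u, (∀ β ∈ τ.body.atoms, β.ground u = f) → (∀ e ∈ τ.body.ineqs, e.1.eval u ≠ e.2.eval u) →
      ∃ q ∈ τ.head, ∃ u' : ℕ → ℕ, (∀ x, x ∉ q.bound → u' x = u x) ∧ q.conj.Holds D u' ∧
        ∀ β ∈ q.conj.atoms, WeaklyConsistent D l (β.ground u')) ∧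
    WeaklyConsistent D l f

/-! ### The rewriting expresses weak consistency -/

/-- For a linear dependency, the guard of the rewriting says that the atom is an instance of the
body. -/
theorem holdsIn_bodyGuard {A : Set ℕ} {D : Set (GroundAtom S)} {α β : Atom S} {τ : Dependency S}
    {σ : ℕ → Term}
    (hσ : mgu (β.subst fun x => .var (x + α.fresh)) α = some σ) (v : ℕ → ℕ) :
    (∀ g ∈ bodyGuard α (τ.shift α.fresh) σ, FO.HoldsIn A D v g) ↔
      β.ground (fun x => (σ (x + α.fresh)).eval v) = α.ground v ∧
      ∀ e ∈ τ.body.ineqs, e.1.eval (fun x => (σ (x + α.fresh)).eval v) ≠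
        e.2.eval (fun x => (σ (x + α.fresh)).eval v) := by
  obtain ⟨hidem, hsolve, -, hα, -⟩ := mgu_eq_some hσ
  rw [bodyGuard, List.forall_mem_append, Conj.holdsIn_ineqFOs]
  refine and_congr ?_ ?_
  · have h1 : (∀ g ∈ (α.vars.filter fun y => σ y ≠ .var y).map fun y => FO.eq (.var y) (σ y),
        FO.HoldsIn A D v g) ↔ ∀ y ∈ α.vars, v y = (σ y).eval v := by
      rw [List.forall_mem_map]
      simp only [FO.HoldsIn, List.mem_filter, decide_eq_true_eq, and_imp]
      refine forall₂_congr fun y _ => ⟨fun h => ?_, fun h _ => h⟩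
      by_cases hy : σ y = .var y
      · rw [hy]; rfl
      · exact h hy
    rw [h1]
    constructor
    · intro h
      -- By idempotence, evaluating `σ` under any `v` gives a solution; the guard says that this
      -- solution agrees with `v` on `α`.
      have hw : Solves (fun x => (σ x).eval v) σ := by
        intro y
        refine Term.eval_congr (u := v) fun z hz => ?_
        cases hy : σ y with
        | var a =>
          rw [hy] at hz
          simp only [Term.vars, List.mem_singleton] at hz
          subst hz
          rw [hidem y z hy]
          rfl
        | const c => simp [hy, Term.vars] at hz
      have := (hsolve _).1 hw
      rw [Atom.ground_subst] at this
      exact this.trans (Atom.ground_congr fun y hy => (h y hy).symm)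
    · intro h y hy
      -- Variables of `α` lie below `α.fresh` and renamed body variables do not, so the two
      -- valuations can be glued.
      have hw : Solves (fun x => if x < α.fresh then v x else (σ x).eval v) σ := by
        rw [hsolve, Atom.ground_subst]
        refine Eq.trans ?_ (h.trans ?_)
        · refine Atom.ground_congr fun x _ => ?_
          simp [Term.eval]
        · exact Atom.ground_congr fun x hx => by simp [Atom.lt_fresh hx]
      have := hw y
      simp only [Atom.lt_fresh hy, if_true] at this
      rw [this]
      exact Term.eval_congr fun z hz => by simp [Atom.lt_fresh (hα y hy z hz)]
  · simp only [Conj.subst, Dependency.shift, List.forall_mem_map, Term.eval_subst]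
    rfl

theorem holdsIn_shift_conj {A : Set ℕ} {D : Set (GroundAtom S)} {l : List (Dependency S)}
    (h : ∀ α v, FO.HoldsIn A D v (psiWc l α) ↔ WeaklyConsistent D l (α.ground v)) {q : CQ S}
    {N : ℕ} {θ : ℕ → Term} {w : ℕ → ℕ} :
    FO.HoldsIn A D w (.and ((q.shift N).conj.subst θ).toFO
      (FO.bigAnd ((q.shift N).conj.atoms.map fun β => psiWc l (β.subst θ)))) ↔
    q.conj.Holds D (fun x => (θ (x + N)).eval w) ∧
      ∀ β ∈ q.conj.atoms, WeaklyConsistent D l (β.ground fun x => (θ (x + N)).eval w) := by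
  rw [FO.HoldsIn, Conj.holdsIn_toFO, Conj.holds_subst, CQ.shift, Conj.holds_subst,
    FO.holdsIn_bigAnd, List.forall_mem_map, Conj.subst, List.forall_mem_map]
  simp only [h, Atom.ground_subst]
  rfl

/-- Weak consistency quantifies over all body instances equal to the fact, whereas the formula
inspects only the one given by the unifier. They agree because a linear body has all its variables
in one atom, so the fact determines their values. -/
theorem holdsIn_psiWc {A : Set ℕ} {D : Set (GroundAtom S)} (hA : ∀ f ∈ D, ∀ i, f.args i ∈ A)
    (l : List (Dependency S)) (hl : ∀ τ ∈ l, τ.IsDED ∧ τ.IsLinear) (α : Atom S) (v : ℕ → ℕ) :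
    FO.HoldsIn A D v (psiWc l α) ↔ WeaklyConsistent D l (α.ground v) := by
  induction l generalizing α v with
  | nil => simp [psiWc, FO.HoldsIn, WeaklyConsistent]
  | cons τ l ih =>
    have ih := ih fun τ hτ => hl τ (List.mem_cons_of_mem _ hτ)
    obtain ⟨hτ, β, hβ⟩ := hl τ List.mem_cons_self
    rw [psiWc, WeaklyConsistent, FO.HoldsIn]
    refine and_congr ?_ (ih α v)
    have hbody : bodyUnify α (τ.shift α.fresh) = mgu (β.subst fun x => .var (x + α.fresh)) α := by
      cases hb : τ.body.atoms with
      | nil => simp [hb] at hβ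
      | cons b t =>
        -- Linearity concerns the set of body atoms; the list may repeat `β`, but its first entry is
        -- `β` in any case.
        have : b = β := (hβ b).1 (by simp [hb])
        simp [bodyUnify, Dependency.shift, Conj.subst, hb, this]
    have huniv : ∀ x ∈ τ.univ, x ∈ β.vars := by
      intro x hx
      have := hτ.1.2.2 x (hτ.1.1.2 x hx)
      obtain ⟨γ, hγ, hx⟩ := Conj.mem_atomVars.1 this
      exact (hβ γ).1 hγ ▸ hx
    have hineq : ∀ e ∈ τ.body.ineqs, ∀ x, x ∈ e.1.vars ∨ x ∈ e.2.vars → x ∈ β.vars :=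
      fun e he x hx => huniv x (hτ.1.2.1 x (Conj.mem_vars.2 (Or.inr ⟨e, he, hx⟩)))
    rw [hbody]
    simp only [hβ, forall_eq]
    cases hσ : mgu (β.subst fun x => .var (x + α.fresh)) α with
    | none =>
      simp only [FO.HoldsIn, true_iff]
      intro u hu
      -- Gluing `v` and the shifted `u` would give a common instance, although there is no unifier.
      refine absurd ?_ (mgu_eq_none hσ fun x => if x < α.fresh then v x else u (x - α.fresh))
      rw [Atom.ground_subst]
      refine Eq.trans ?_ (hu.trans ?_)
      · exact Atom.ground_congr fun x _ => by simp [Term.eval]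
      · exact Atom.ground_congr fun x hx => by simp [Atom.lt_fresh hx]
    | some σ =>
      obtain ⟨-, hsolve, hran, -, hβv⟩ := mgu_eq_some hσ
      simp only [FO.holdsIn_guarded, holdsIn_bodyGuard hσ, FO.holdsIn_bigOr]
      have huniq : ∀ u, β.ground u = α.ground v → ∀ x ∈ β.vars,
          u x = (σ (x + α.fresh)).eval v := by
        intro u hu x hx
        have hw : Solves (fun x => if x < α.fresh then v x else u (x - α.fresh)) σ := by
          rw [hsolve, Atom.ground_subst]
          refine Eq.trans ?_ (hu.trans ?_)
          · exact Atom.ground_congr fun x _ => by simp [Term.eval]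
          · exact Atom.ground_congr fun x hx => by simp [Atom.lt_fresh hx]
        have := hw (x + α.fresh)
        simp only [Nat.not_lt.2 (Nat.le_add_left _ _), if_false, Nat.add_sub_cancel] at this
        rw [this]
        refine Term.eval_congr fun z hz => ?_
        have hz := hβv (x + α.fresh) (Atom.mem_vars_subst.2 ⟨x, hx, by simp [Term.vars]⟩) z hz
        simp [Atom.lt_fresh hz]
      have hrhs : (∃ φ ∈ (τ.shift α.fresh).head.map fun q =>
            FO.exs q.bound (.and (q.conj.subst (q.freeSubst σ)).toFO
              (FO.bigAnd (q.conj.atoms.map fun β => psiWc l (β.subst (q.freeSubst σ))))),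
            FO.HoldsIn A D v φ) ↔
          ∃ q ∈ τ.head, ∃ u' : ℕ → ℕ, (∀ x, x ∉ q.bound → u' x = (σ (x + α.fresh)).eval v) ∧
            q.conj.Holds D u' ∧ ∀ β ∈ q.conj.atoms, WeaklyConsistent D l (β.ground u') := by
        have hmem : ∀ (q : CQ S) x, x + α.fresh ∈ (q.shift α.fresh).bound ↔ x ∈ q.bound := by
          intro q x
          simp [CQ.shift]
        have hθ : ∀ (q : CQ S) x, (q.shift α.fresh).freeSubst σ (x + α.fresh) =
            if x ∈ q.bound then .var (x + α.fresh) else σ (x + α.fresh) :=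
          fun q x => if_congr (hmem q x) rfl rfl
        -- No capture: the image of a free variable either uses variables of `α`, which are smaller
        -- than all renamed ones, or is that renamed free variable itself.
        have hout : ∀ (q : CQ S) x, x ∉ q.bound → ∀ z ∈ (σ (x + α.fresh)).vars,
            z ∉ (q.shift α.fresh).bound := by
          intro q x hx z hz
          rcases hran (x + α.fresh) with h | h
          · have := Atom.lt_fresh (h z hz)
            simp only [CQ.shift, List.mem_map, not_exists, not_and]
            omega
          · rw [h] at hz
            simp only [Term.vars, List.mem_singleton] at hz
            rw [hz, hmem]
            exact hx
        simp only [Dependency.shift, List.mem_map, exists_exists_and_eq_and, FO.holdsIn_exs,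
          holdsIn_shift_conj ih, hθ]
        refine exists_congr fun q => and_congr_right fun hq => ?_
        constructor
        · rintro ⟨w, hw, -, h⟩
          have hval : (fun x => (if x ∈ q.bound then Term.var (x + α.fresh)
              else σ (x + α.fresh)).eval w) =
              fun x => if x ∈ q.bound then w (x + α.fresh) else (σ (x + α.fresh)).eval v := by
            funext x
            split_ifs with hx
            · rfl
            · exact Term.eval_congr fun z hz => hw z (hout q x hx z hz)
          rw [hval] at h
          exact ⟨_, fun x hx => if_neg hx, h⟩
        · rintro ⟨u, hu, h⟩
          have hval : (fun x => (if x ∈ q.bound then Term.var (x + α.fresh)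
              else σ (x + α.fresh)).eval fun y =>
                if y ∈ (q.shift α.fresh).bound then u (y - α.fresh) else v y) = u := by
            funext x
            split_ifs with hx
            · have := (hmem q x).2 hx
              simp only [Term.eval, this, if_true, Nat.add_sub_cancel]
            · rw [hu x hx]
              exact Term.eval_congr fun z hz => if_neg (hout q x hx z hz)
          refine ⟨fun y => if y ∈ (q.shift α.fresh).bound then u (y - α.fresh) else v y,
            fun x hx => if_neg hx, fun x hx => ?_, ?_⟩
          · simp only [if_pos hx]
            obtain ⟨y, hy, rfl⟩ := List.mem_map.1 hx
            rw [Nat.add_sub_cancel]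
            -- Safety of the head puts the witness in `A`.
            exact Conj.mem_of_holds hA h.1 ((hτ.2.2 q hq).2.2 y hy)
          · rw [hval]
            exact h
      rw [hrhs]
      constructor
      · intro h u hu hi
        have hux := huniq u hu
        have hi' : ∀ e ∈ τ.body.ineqs, e.1.eval (fun x => (σ (x + α.fresh)).eval v) ≠
            e.2.eval (fun x => (σ (x + α.fresh)).eval v) := by
          intro e he
          rw [← Term.eval_congr fun x hx => hux x (hineq e he x (Or.inl hx)),
            ← Term.eval_congr fun x hx => hux x (hineq e he x (Or.inr hx))]
          exact hi e he
        obtain ⟨q, hq, u', hu', h1, h2⟩ :=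
          h ⟨(Atom.ground_congr fun x hx => (hux x hx).symm).trans hu, hi'⟩
        -- The unifier and `u` agree on the universal variables only, so the witness is patched with
        -- `u` outside the quantified variables; the variables of `q` do not see this.
        have hagree : ∀ x ∈ q.conj.vars, (if x ∈ q.bound then u' x else u x) = u' x := by
          intro x hx
          split_ifs with hb
          · rfl
          · rw [hu' x hb, hux x (huniv x ((hτ.2.2 q hq).2.1 x hx hb))]
        refine ⟨q, hq, fun x => if x ∈ q.bound then u' x else u x, fun x hx => if_neg hx,
          (Conj.holds_congr hagree).2 h1, fun γ hγ => ?_⟩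
        rw [Atom.ground_congr fun x hx => hagree x (Conj.mem_vars.2 (Or.inl ⟨γ, hγ, hx⟩))]
        exact h2 γ hγ
      · intro h hg
        exact h _ hg.1 hg.2

/-- The unifier sends the universal variables, hence all free variables of the head, to terms over
`α`; new variables occur only under the quantifiers of the head. -/
theorem freeVars_psiWc (l : List (Dependency S)) (hl : ∀ τ ∈ l, τ.IsDED ∧ τ.IsLinear)
    (α : Atom S) : (psiWc l α).freeVars ⊆ {x | x ∈ α.vars} := by
  induction l generalizing α with
  | nil => simp [psiWc, FO.freeVars]
  | cons τ l ih =>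
    have ih := ih fun τ hτ => hl τ (List.mem_cons_of_mem _ hτ)
    obtain ⟨hτ, β, hβ⟩ := hl τ List.mem_cons_self
    rw [psiWc]
    refine Set.union_subset ?_ (ih α)
    have hbody : bodyUnify α (τ.shift α.fresh) = mgu (β.subst fun x => .var (x + α.fresh)) α := by
      cases hb : τ.body.atoms with
      | nil => simp [hb] at hβ
      | cons b t =>
        have : b = β := (hβ b).1 (by simp [hb])
        simp [bodyUnify, Dependency.shift, Conj.subst, hb, this]
    rw [hbody]
    cases hσ : mgu (β.subst fun x => .var (x + α.fresh)) α with
    | none => simp [FO.freeVars]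
    | some σ =>
      obtain ⟨-, -, -, hαv, hβv⟩ := mgu_eq_some hσ
      have huniv : ∀ x ∈ τ.univ, ∀ y ∈ (σ (x + α.fresh)).vars, y ∈ α.vars := by
        intro x hx
        have := hτ.1.2.2 x (hτ.1.1.2 x hx)
        obtain ⟨γ, hγ, hx⟩ := Conj.mem_atomVars.1 this
        rw [(hβ γ).1 hγ] at hx
        exact hβv _ (Atom.mem_vars_subst.2 ⟨x, hx, by simp [Term.vars]⟩)
      refine FO.freeVars_guarded ?_ (FO.freeVars_bigOr ?_)
      · intro g hg
        rcases List.mem_append.1 hg with hg | hg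
        · obtain ⟨y, hy, rfl⟩ := List.mem_map.1 hg
          have hy := (List.mem_filter.1 hy).1
          rintro x (hx | hx)
          · simp only [Term.vars, List.mem_singleton] at hx
            exact hx ▸ hy
          · exact hαv y hy x hx
        · refine (Conj.freeVars_ineqFOs g hg).trans fun y hy => ?_
          obtain ⟨x, hx, hy⟩ := Conj.mem_vars_subst.1 hy
          obtain ⟨z, hz, hz'⟩ := Conj.mem_vars_subst.1 hx
          simp only [Term.vars, List.mem_singleton] at hz'
          subst hz'
          exact huniv z (hτ.1.2.1 z hz) y hy
      · intro φ hφ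
        obtain ⟨q', hq', rfl⟩ := List.mem_map.1 hφ
        obtain ⟨q, hq, rfl⟩ := List.mem_map.1 hq'
        rw [FO.freeVars_exs, Set.sdiff_subset_iff]
        have hsub : ∀ x ∈ q.conj.vars, ∀ y ∈ ((q.shift α.fresh).freeSubst σ (x + α.fresh)).vars,
            y ∈ (q.shift α.fresh).bound ∨ y ∈ α.vars := by
          intro x hx y hy
          simp only [CQ.freeSubst] at hy
          split_ifs at hy with hb
          · simp only [Term.vars, List.mem_singleton] at hy
            exact Or.inl (hy ▸ hb)
          · refine Or.inr (huniv x ((hτ.2.2 q hq).2.1 x hx fun h => hb ?_) y hy)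
            exact List.mem_map.2 ⟨x, h, rfl⟩
        have hsub' : ∀ x ∈ (q.shift α.fresh).conj.vars,
            ∀ y ∈ ((q.shift α.fresh).freeSubst σ x).vars,
            y ∈ (q.shift α.fresh).bound ∨ y ∈ α.vars := by
          intro x hx
          obtain ⟨z, hz, hz'⟩ := Conj.mem_vars_subst.1 hx
          simp only [Term.vars, List.mem_singleton] at hz'
          subst hz'
          exact hsub z hz
        refine Set.union_subset (Conj.freeVars_toFO.trans fun y hy => ?_)
          (FO.freeVars_bigAnd fun φ hφ => ?_)
        · obtain ⟨x, hx, hy⟩ := Conj.mem_vars_subst.1 hy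
          exact hsub' x hx y hy
        · obtain ⟨γ, hγ, rfl⟩ := List.mem_map.1 hφ
          refine (ih _).trans fun y hy => ?_
          obtain ⟨x, hx, hy⟩ := Atom.mem_vars_subst.1 hy
          exact hsub' x (Conj.mem_vars.2 (Or.inl ⟨γ, hγ, hx⟩)) y hy

theorem isSentence_psiIar {l : List (Dependency S)} (hl : ∀ τ ∈ l, τ.IsDED ∧ τ.IsLinear)
    {Q : UCQ S} (hQ : Q.IsSafeBUCQ) : (psiIar l Q).IsSentence := by
  refine Set.subset_empty_iff.1 (FO.freeVars_bigOr fun φ hφ => ?_)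
  obtain ⟨q, hq, rfl⟩ := List.mem_map.1 hφ
  rw [psiIarCQ, FO.freeVars_exs, Set.sdiff_subset_iff, Set.union_empty]
  refine Set.union_subset (Conj.freeVars_toFO.trans (hQ.2 q hq).2.1)
    (FO.freeVars_bigAnd fun φ hφ => ?_)
  obtain ⟨α, hα, rfl⟩ := List.mem_map.1 hφ
  exact (freeVars_psiWc l hl α).trans fun x hx =>
    (hQ.2 q hq).2.1 x (Conj.mem_vars.2 (Or.inl ⟨α, hα, hx⟩))

/-- Requiring weak consistency of each matched atom amounts to matching the query in the set of
weakly consistent facts. -/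
theorem holdsIn_psiIar {A : Set ℕ} {D : Set (GroundAtom S)} (hA : ∀ f ∈ D, ∀ i, f.args i ∈ A)
    {l : List (Dependency S)} (hl : ∀ τ ∈ l, τ.IsDED ∧ τ.IsLinear) {Q : UCQ S}
    (hQ : Q.IsSafeBUCQ) (v : ℕ → ℕ) :
    FO.HoldsIn A D v (psiIar l Q) ↔
      Models {f | f ∈ D ∧ WeaklyConsistent D l f} Q.toFO := by
  -- Boolean queries have no free variables, so the outer valuation is immaterial.
  have hex : ∀ q ∈ Q, ∀ (E : Set (GroundAtom S)) (v v' : ℕ → ℕ),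
      (∃ u : ℕ → ℕ, (∀ x, x ∉ q.bound → u x = v x) ∧ q.conj.Holds E u) →
      ∃ u : ℕ → ℕ, (∀ x, x ∉ q.bound → u x = v' x) ∧ q.conj.Holds E u := by
    rintro q hq E v v' ⟨u, -, h⟩
    refine ⟨fun x => if x ∈ q.bound then u x else v' x, fun x hx => if_neg hx, ?_⟩
    exact (Conj.holds_congr fun x hx => if_pos ((hQ.2 q hq).2.1 x hx)).2 h
  have h1 : FO.HoldsIn A D v (psiIar l Q) ↔ ∃ q ∈ Q, ∃ u : ℕ → ℕ,
      (∀ x, x ∉ q.bound → u x = v x) ∧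
        q.conj.Holds {f | f ∈ D ∧ WeaklyConsistent D l f} u := by
    simp only [psiIar, FO.holdsIn_bigOr, List.mem_map, exists_exists_and_eq_and, psiIarCQ,
      FO.holdsIn_exs, FO.HoldsIn, Conj.holdsIn_toFO, FO.holdsIn_bigAnd, forall_exists_index,
      and_imp, forall_apply_eq_imp_iff₂, holdsIn_psiWc hA l hl]
    refine exists_congr fun q => and_congr_right fun hq => exists_congr fun u =>
      and_congr_right fun _ => ?_
    constructor
    · rintro ⟨-, h, h'⟩
      exact ⟨fun α hα => ⟨h.1 α hα, h' α hα⟩, h.2⟩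
    · rintro ⟨h, h'⟩
      have hh : q.conj.Holds D u := ⟨fun α hα => (h α hα).1, h'⟩
      exact ⟨fun x hx => Conj.mem_of_holds hA hh ((hQ.2 q hq).2.2 x ((hQ.2 q hq).1.2 x hx)), hh,
        fun α hα => (h α hα).2⟩
  have h2 : ∀ v', FO.Holds {f | f ∈ D ∧ WeaklyConsistent D l f} v' Q.toFO ↔ ∃ q ∈ Q,
      ∃ u : ℕ → ℕ, (∀ x, x ∉ q.bound → u x = v' x) ∧
        q.conj.Holds {f | f ∈ D ∧ WeaklyConsistent D l f} u := by
    intro v'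
    rw [← FO.holdsIn_univ, UCQ.toFO, FO.holdsIn_bigOr]
    simp [CQ.toFO, FO.holdsIn_exs, Conj.holdsIn_toFO]
  rw [h1, Models]
  simp only [h2]
  constructor
  · rintro ⟨q, hq, h⟩ v'
    exact ⟨q, hq, hex q hq _ _ _ h⟩
  · exact fun h => h v

/-! ### Uniqueness of the repair -/

/-- The facts of a consistent subset of `D` are weakly consistent. -/
theorem weaklyConsistent_of_mem {Γ : Finset (Dependency S)} {D E : Set (GroundAtom S)}
    (hED : E ⊆ D) (hE : IsConsistent Γ E) (l : List (Dependency S)) (hl : ∀ τ ∈ l, τ ∈ Γ)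
    {f : GroundAtom S} (hf : f ∈ E) : WeaklyConsistent D l f := by
  induction l generalizing f with
  | nil => trivial
  | cons τ l ih =>
    have ih := @ih fun τ hτ => hl τ (List.mem_cons_of_mem _ hτ)
    refine ⟨fun u hu hi => ?_, ih hf⟩
    obtain ⟨q, hq, u', hu', h⟩ := Dependency.models_toFO.1 (hE τ (hl τ List.mem_cons_self)) u
      ⟨fun β hβ => hu β hβ ▸ hf, hi⟩
    -- The witnesses lie in `E` again, so the induction hypothesis applies to them.
    exact ⟨q, hq, u', hu', ⟨fun α hα => hED (h.1 α hα), h.2⟩, fun β hβ => ih (h.1 β hβ)⟩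

/-- Dependencies whose body atom has another predicate than `f` do not matter. -/
theorem weaklyConsistent_append {D : Set (GroundAtom S)} {l₁ l₂ : List (Dependency S)}
    {f : GroundAtom S} (h : ∀ τ ∈ l₁, ∃ β ∈ τ.body.atoms, β.pred ≠ f.pred)
    (hf : WeaklyConsistent D l₂ f) : WeaklyConsistent D (l₁ ++ l₂) f := by
  induction l₁ with
  | nil => exact hf
  | cons τ l₁ ih =>
    refine ⟨fun u hu => ?_, ih fun τ hτ => h τ (List.mem_cons_of_mem _ hτ)⟩
    obtain ⟨β, hβ, hne⟩ := h τ List.mem_cons_self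
    exact absurd (congrArg GroundAtom.pred (hu β hβ)) hne

theorem WeaklyConsistent.of_append {D : Set (GroundAtom S)} {l₁ l₂ : List (Dependency S)}
    {f : GroundAtom S} (hf : WeaklyConsistent D (l₁ ++ l₂) f) : WeaklyConsistent D l₂ f := by
  induction l₁ with
  | nil => exact hf
  | cons τ l₁ ih => exact ih hf.2

/-- A witness for the head of `τ` is known to be weakly consistent for the dependencies after `τ`.
It triggers none of the others: a match with a body at or before `τ` would be an edge from `τ` that
the topological order forbids. -/
theorem isConsistent_weaklyConsistent {Γ : Finset (Dependency S)} {l : List (Dependency S)}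
    (hl : IsTopologicalOrder Γ l) (hlinear : ∀ τ ∈ Γ, τ.IsLinear) (D : Set (GroundAtom S)) :
    IsConsistent Γ {f | f ∈ D ∧ WeaklyConsistent D l f} := by
  intro τ hτ
  rw [Dependency.models_toFO]
  rintro u ⟨hu, hi⟩
  obtain ⟨β, hβ⟩ := hlinear τ hτ
  obtain ⟨-, hmem, hord⟩ := hl
  obtain ⟨l₁, l₂, rfl⟩ := List.append_of_mem ((hmem τ).2 hτ)
  have hf := (hu β ((hβ β).2 rfl)).2.of_append
  obtain ⟨q, hq, u', hu', h1, h2⟩ := hf.1 u (fun γ hγ => by rw [(hβ γ).1 hγ]) hi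
  refine ⟨q, hq, u', hu', fun α hα => ⟨h1.1 α hα, ?_⟩, h1.2⟩
  -- `τ` is grouped with its predecessors, since a witness must not trigger `τ` itself either.
  have hassoc : l₁ ++ τ :: l₂ = (l₁ ++ [τ]) ++ l₂ := by simp
  rw [hassoc]
  refine weaklyConsistent_append (fun τ' hτ' => ?_) (h2 α hα)
  have hτ'Γ : τ' ∈ Γ := (hmem τ').1 (by rw [hassoc]; exact List.mem_append_left _ hτ')
  obtain ⟨β', hβ'⟩ := hlinear τ' hτ'Γ
  refine ⟨β', (hβ' β').2 rfl, fun hpred => ?_⟩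
  obtain ⟨j, hj, hjτ⟩ := List.mem_iff_getElem.1 hτ'
  have hjl : j ≤ l₁.length := by simp at hj; omega
  refine hord ⟨l₁.length, by simp⟩ ⟨j, by simp; omega⟩ hjl (Relation.TransGen.single ?_)
  have e1 : (l₁ ++ τ :: l₂).get ⟨l₁.length, by simp⟩ = τ := by simp
  have e2 : (l₁ ++ τ :: l₂).get ⟨j, by simp; omega⟩ = τ' := by
    simp only [List.get_eq_getElem, hassoc]
    rw [List.getElem_append_left hj, hjτ]
  rw [e1, e2]
  exact ⟨hτ, hτ'Γ, q, hq, α, hα, β', (hβ' β').2 rfl, hpred.symm⟩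

/-- For linear acyclic dependencies, the weakly consistent facts form the only repair. -/
theorem repairs_eq_singleton {Γ : Finset (Dependency S)} {l : List (Dependency S)}
    (hl : IsTopologicalOrder Γ l) (hlinear : ∀ τ ∈ Γ, τ.IsLinear) (D : Set (GroundAtom S)) :
    repairs Γ D = {{f | f ∈ D ∧ WeaklyConsistent D l f}} := by
  have hcons := isConsistent_weaklyConsistent hl hlinear D
  have hmax : ∀ E, E ⊆ D ∧ IsConsistent Γ E → E ⊆ {f | f ∈ D ∧ WeaklyConsistent D l f} :=
    fun E hE f hf => ⟨hE.1 hf, weaklyConsistent_of_mem hE.1 hE.2 l (fun τ => (hl.2.1 τ).1) hf⟩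
  ext R
  rw [Set.mem_singleton_iff]
  constructor
  · intro hR
    have hR : Maximal (fun E => E ⊆ D ∧ IsConsistent Γ E) R := hR
    exact (hmax R hR.prop).antisymm (hR.le_of_ge ⟨fun f hf => hf.1, hcons⟩ (hmax R hR.prop))
  · rintro rfl
    exact ⟨⟨fun f hf => hf.1, hcons⟩, fun E hE _ => hmax E hE⟩

theorem arEntails_iff_iarEntails {Γ : Finset (Dependency S)} {l : List (Dependency S)}
    (hl : IsTopologicalOrder Γ l) (hlinear : ∀ τ ∈ Γ, τ.IsLinear) (D : Set (GroundAtom S))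
    (φ : FO S) : AREntails Γ D φ ↔ IAREntails Γ D φ := by
  simp [AREntails, IAREntails, repairs_eq_singleton hl hlinear]

/-- Keeping `A` arbitrary serves both the first-order statement and the circuits. -/
theorem iarEntails_iff_holdsIn {Γ : Finset (Dependency S)} {l : List (Dependency S)}
    (hl : IsTopologicalOrder Γ l) (hded : ∀ τ ∈ Γ, τ.IsDED) (hlinear : ∀ τ ∈ Γ, τ.IsLinear)
    {A : Set ℕ} {D : Set (GroundAtom S)} (hA : ∀ f ∈ D, ∀ i, f.args i ∈ A) {Q : UCQ S}
    (hQ : Q.IsSafeBUCQ) (v : ℕ → ℕ) :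
    IAREntails Γ D Q.toFO ↔ FO.HoldsIn A D v (psiIar l Q) := by
  rw [holdsIn_psiIar hA (fun τ hτ => ⟨hded τ ((hl.2.1 τ).1 hτ), hlinear τ ((hl.2.1 τ).1 hτ)⟩) hQ,
    IAREntails, repairs_eq_singleton hl hlinear, Set.sInter_singleton]

/-- By acyclicity reachability is a strict order, so every nonempty finite set has an element that
no other one reaches; it is put first. -/
theorem exists_isTopologicalOrder {Γ : Finset (Dependency S)} (h : IsAcyclic Γ) :
    ∃ l, IsTopologicalOrder Γ l := by
  classical
  let r := Relation.TransGen (DepEdge Γ)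
  have key : ∀ s : Finset (Dependency S), ∃ l : List (Dependency S),
      (∀ τ, τ ∈ l ↔ τ ∈ s) ∧ l.Pairwise fun a b => a ≠ b ∧ ¬ r b a := by
    intro s
    induction s using Finset.strongInduction with
    | H s ih =>
      rcases s.eq_empty_or_nonempty with rfl | hs
      · exact ⟨[], by simp, List.Pairwise.nil⟩
      · have : IsStrictOrder (Dependency S) r :=
          { irrefl := h, trans := fun _ _ _ => Relation.TransGen.trans }
        obtain ⟨m, hm, hmin⟩ : ∃ m ∈ s, ∀ b ∈ s, ¬ r b m := by
          have hwf : (s : Set (Dependency S)).WellFoundedOn r := s.finite_toSet.wellFoundedOn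
          obtain ⟨⟨m, hm⟩, -, hmin⟩ :=
            WellFounded.has_min hwf Set.univ ⟨⟨hs.choose, hs.choose_spec⟩, trivial⟩
          exact ⟨m, hm, fun b hb => hmin ⟨b, hb⟩ trivial⟩
        obtain ⟨l, hl, hp⟩ := ih (s.erase m) (Finset.erase_ssubset hm)
        refine ⟨m :: l, fun τ => ?_, List.pairwise_cons.2 ⟨fun b hb => ?_, hp⟩⟩
        · rw [List.mem_cons, hl, Finset.mem_erase]
          constructor
          · rintro (rfl | h)
            exacts [hm, h.2]
          · intro h
            by_cases hτ : τ = m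
            exacts [Or.inl hτ, Or.inr ⟨hτ, h⟩]
        · have hb := Finset.mem_erase.1 ((hl b).1 hb)
          exact ⟨hb.1.symm, hmin b hb.2⟩
  obtain ⟨l, hl, hp⟩ := key Γ
  refine ⟨l, hp.imp fun h => h.1, hl, fun i j hij => ?_⟩
  rcases hij.lt_or_eq with hlt | rfl
  · exact (List.pairwise_iff_get.1 hp j i hlt).2
  · exact h _

end Rewriting

/-! ### Circuits for first-order sentences -/

section Circuits

variable {S : Signature}

/-! ### Construction of the circuits -/

/-- The list `[n - 1, …, 0]`. -/
def countdown (n : ℕ) : List ℕ := (List.range n).reverse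

theorem mem_countdown {n c : ℕ} : c ∈ countdown n ↔ c < n := by simp [countdown]

theorem countdown_succ (n : ℕ) : countdown (n + 1) = n :: countdown n := by
  simp [countdown, List.range_succ]

theorem nodup_countdown (n : ℕ) : (countdown n).Nodup := by
  simp [countdown, List.nodup_range]

theorem length_countdown (n : ℕ) : (countdown n).length = n := by simp [countdown]

/-- The arity of the `p`-th predicate. -/
def Signature.arityAt (S : Signature) (p : ℕ) : ℕ :=
  if h : p < S.numPred then S.arity ⟨p, h⟩ else 0

theorem Signature.arityAt_val (p : Fin S.numPred) : S.arityAt p = S.arity p := by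
  simp [Signature.arityAt]

/-- The number of bits that encode the relations before the `p`-th predicate. -/
def Signature.offset (S : Signature) (m p : ℕ) : ℕ := ∑ q ∈ Finset.range p, m ^ S.arityAt q

theorem Signature.offset_succ (m p : ℕ) :
    S.offset m (p + 1) = S.offset m p + m ^ S.arityAt p := by
  simp [Signature.offset, Finset.sum_range_succ]

/-- The number with the digits `as` in base `m`, least significant digit first. -/
def digitsValue (m : ℕ) : List ℕ → ℕ
  | [] => 0
  | a :: as => digitsValue m as * m + a

/-- Input gates for the bits `off + i`, where the last digits of `i` in base `m` are `as`. -/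
def tupleGates (L : Label) (m off : ℕ) : ℕ → List ℕ → ℕ → List (Label × Gate)
  | 0, as, b => [(L ++ as, .input (off + b))]
  -- Arguments are chosen from the last, the most significant digit, and `b` carries the value of
  -- the digits chosen so far. Bit positions are thus met in descending order, so that one counter
  -- can produce them.
  | j + 1, as, b => (countdown m).flatMap fun c => tupleGates L m off j (c :: as) (b * m + c)

/-- Input gates for all ground atoms over `0, …, m - 1`. -/
def inputGates (S : Signature) (m : ℕ) : List (Label × Gate) :=
  (countdown S.numPred).flatMap fun p => tupleGates [m, 0, p] m (S.offset m p) (S.arityAt p) [] 0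

/-- Gates for the true equations between constants below `m`. -/
def eqGates (m : ℕ) : List (Label × Gate) := (countdown m).map fun c => ([m, 1, c, c], .and [])

/-- A gate for the equation `s = t`. -/
def eqGate (m : ℕ) (v : ℕ → ℕ) : Term → Term → Gate
  | .const c, .const d => if c = d then .and [] else .or []
  | s, t => .or [[m, 1, s.eval v, t.eval v]]

/-- Gates that evaluate a formula with quantifiers that range over `0, …, m - 1`. The gate for the
formula is named `L`; the names of the others extend `L`. -/
def FO.gates (m : ℕ) : FO S → (ℕ → ℕ) → Label → List (Label × Gate)
  | .top, _, L => [(L, .and [])]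
  | .bot, _, L => [(L, .or [])]
  | .atom α, v, L => [(L, .or [m :: 0 :: α.pred.val :: List.ofFn fun i => (α.args i).eval v])]
  | .eq s t, v, L => [(L, eqGate m v s t)]
  | .neg φ, v, L => φ.gates m v (L ++ [0]) ++ [(L, .not (L ++ [0]))]
  | .and φ ψ, v, L =>
    φ.gates m v (L ++ [0]) ++ ψ.gates m v (L ++ [1]) ++ [(L, .and [L ++ [0], L ++ [1]])]
  | .or φ ψ, v, L =>
    φ.gates m v (L ++ [0]) ++ ψ.gates m v (L ++ [1]) ++ [(L, .or [L ++ [0], L ++ [1]])]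
  | .ex x φ, v, L =>
    ((countdown m).flatMap fun c => φ.gates m (Function.update v x c) (L ++ [c])) ++
      [(L, .or ((countdown m).map fun c => L ++ [c]))]
  | .all x φ, v, L =>
    ((countdown m).flatMap fun c => φ.gates m (Function.update v x c) (L ++ [c])) ++
      [(L, .and ((countdown m).map fun c => L ++ [c]))]

/-- The part of the circuit for databases over `0, …, m - 1`. -/
def blockGates (φ : FO S) (m : ℕ) : List (Label × Gate) :=
  inputGates S m ++ eqGates m ++ φ.gates m (fun _ => 0) [m, 2]

/-- A circuit for inputs of length `n`; it contains a part for every `m` for which databases over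
`0, …, m - 1` are encoded by `n` bits. -/
def foCircuit (φ : FO S) (n : ℕ) : Circuit where
  gates := ((countdown (n + 1)).flatMap fun m =>
      if S.offset m S.numPred = n then blockGates φ m else []) ++
    [([], .or ((countdown (n + 1)).map fun m => [m, 2]))]
  output := []

/-! #### Correctness -/

/-- The values of all gates after the evaluation of a list of gates. -/
def runGates (w : List Bool) (env : Label → Bool) (gs : List (Label × Gate)) : Label → Bool :=
  gs.foldl (fun env g => Function.update env g.1 (g.2.value w env)) env

theorem runGates_append (w : List Bool) (env : Label → Bool) (gs gs' : List (Label × Gate)) :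
    runGates w env (gs ++ gs') = runGates w (runGates w env gs) gs' := List.foldl_append

theorem runGates_cons (w : List Bool) (env : Label → Bool) (g : Label × Gate)
    (gs : List (Label × Gate)) :
    runGates w env (g :: gs) = runGates w (Function.update env g.1 (g.2.value w env)) gs := rfl

theorem runGates_append_singleton (w : List Bool) (env : Label → Bool)
    (gs : List (Label × Gate)) (L : Label) (g : Gate) :
    runGates w env (gs ++ [(L, g)]) L = g.value w (runGates w env gs) := by
  simp [runGates]

theorem runGates_of_forall_ne {w : List Bool} {env : Label → Bool} {gs : List (Label × Gate)}
    {L : Label} (h : ∀ g ∈ gs, g.1 ≠ L) : runGates w env gs L = env L := by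
  induction gs generalizing env with
  | nil => rfl
  | cons g gs ih =>
    rw [runGates_cons, ih fun g' hg' => h g' (by simp [hg']),
      Function.update_of_ne (h g (by simp)).symm]

/-- For gates that read no other gate, neither order nor repetition of names matters. -/
theorem runGates_const {w : List Bool} {env : Label → Bool} {gs : List (Label × Gate)}
    {f : Label → Bool} (h : ∀ g ∈ gs, ∀ env, g.2.value w env = f g.1) (L : Label) :
    ((∃ g ∈ gs, g.1 = L) → runGates w env gs L = f L) ∧
      ((∀ g ∈ gs, g.1 ≠ L) → runGates w env gs L = env L) := by
  refine ⟨fun hL => ?_, runGates_of_forall_ne⟩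
  induction gs generalizing env with
  | nil => simp at hL
  | cons g gs ih =>
    rw [runGates_cons]
    by_cases hgs : ∃ g ∈ gs, g.1 = L
    · exact ih (fun g' hg' => h g' (by simp [hg'])) hgs
    · push Not at hgs
      rw [runGates_of_forall_ne hgs]
      obtain ⟨g', hg', rfl⟩ := hL
      rcases List.mem_cons.1 hg' with rfl | hg'
      · simp [h g' (by simp)]
      · exact absurd rfl (hgs g' hg')

/-- Names are addresses in a tree, so gates of different subformulas or loop values never overwrite
one another. -/
theorem FO.prefix_of_mem_gates {m : ℕ} {φ : FO S} {v : ℕ → ℕ} {L : Label} {g : Label × Gate}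
    (hg : g ∈ φ.gates m v L) : L <+: g.1 := by
  induction φ generalizing v L with
  | top | bot | atom | eq =>
    simp only [gates, List.mem_singleton] at hg
    rw [hg]
  | neg φ ih =>
    rcases List.mem_append.1 hg with hg | hg
    · exact (List.prefix_append _ _).trans (ih hg)
    · rw [List.mem_singleton.1 hg]
  | and φ ψ ih₁ ih₂ | or φ ψ ih₁ ih₂ =>
    rcases List.mem_append.1 hg with hg | hg
    · rcases List.mem_append.1 hg with hg | hg
      · exact (List.prefix_append _ _).trans (ih₁ hg)
      · exact (List.prefix_append _ _).trans (ih₂ hg)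
    · rw [List.mem_singleton.1 hg]
  | ex x φ ih | all x φ ih =>
    rcases List.mem_append.1 hg with hg | hg
    · obtain ⟨c, -, hg⟩ := List.mem_flatMap.1 hg
      exact (List.prefix_append _ _).trans (ih hg)
    · rw [List.mem_singleton.1 hg]

/-- The gates for ground atoms and equations have the right values. -/
structure IsBase (m : ℕ) (D : Set (GroundAtom S)) (env : Label → Bool) : Prop where
  atom : ∀ f : GroundAtom S, env (m :: 0 :: f.pred.val :: List.ofFn f.args) = true ↔ f ∈ D
  eq : ∀ a b, env [m, 1, a, b] = true ↔ a = b ∧ a < m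

theorem IsBase.runGates {m : ℕ} {D : Set (GroundAtom S)} {env : Label → Bool}
    (h : IsBase m D env) {w : List Bool} {gs : List (Label × Gate)}
    (hgs : ∀ g ∈ gs, [m, 2] <+: g.1) : IsBase m D (CQA.runGates w env gs) := by
  constructor
  · intro f
    rw [runGates_of_forall_ne, h.atom]
    intro g hg he
    have := hgs g hg
    rw [he] at this
    simp at this
  · intro a b
    rw [runGates_of_forall_ne, h.eq]
    intro g hg he
    have := hgs g hg
    rw [he] at this
    simp at this

theorem eval_eqGate {w : List Bool} {m : ℕ} {D : Set (GroundAtom S)} {env : Label → Bool}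
    (h : IsBase m D env) {v : ℕ → ℕ} {s t : Term} (hs : ∀ x ∈ s.vars, v x < m)
    (ht : ∀ x ∈ t.vars, v x < m) : (eqGate m v s t).value w env = true ↔ s.eval v = t.eval v := by
  cases s with
  | var x =>
    have := hs x (by simp [Term.vars])
    simp only [eqGate, Gate.value, List.any_cons, List.any_nil, Bool.or_false, h.eq, Term.eval]
    tauto
  | const c =>
    cases t with
    | var y =>
      have := ht y (by simp [Term.vars])
      simp only [eqGate, Gate.value, List.any_cons, List.any_nil, Bool.or_false, h.eq, Term.eval]
      constructor
      · exact fun h => h.1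
      · intro h
        exact ⟨h, h ▸ this⟩
    | const d =>
      simp only [eqGate, Term.eval]
      split_ifs with hcd <;> simp [Gate.value, hcd]

theorem not_append_singleton_prefix {L : Label} {a b : ℕ} (h : a ≠ b) :
    ¬ (L ++ [a]) <+: (L ++ [b]) := by
  rw [List.prefix_append_right_inj]
  simp [h]

theorem runGates_flatMap {w : List Bool} {m : ℕ} {D : Set (GroundAtom S)} {env : Label → Bool}
    (henv : IsBase m D env) {L : Label} (hL : [m, 2] <+: L) {F : ℕ → List (Label × Gate)}
    (hF : ∀ c, ∀ g ∈ F c, (L ++ [c]) <+: g.1) {P : ℕ → Prop} {cs : List ℕ}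
    (h : ∀ c ∈ cs, ∀ env, IsBase m D env → (runGates w env (F c) (L ++ [c]) = true ↔ P c)) :
    ∀ c ∈ cs, (runGates w env (cs.flatMap F) (L ++ [c]) = true ↔ P c) := by
  induction cs generalizing env with
  | nil => simp
  | cons a cs ih =>
    intro c hc
    rw [List.flatMap_cons, runGates_append]
    have hbase := henv.runGates (w := w) fun g hg =>
      (hL.trans (List.prefix_append L [a])).trans (hF a g hg)
    -- If `c` recurs, its last occurrence determines the value; otherwise the later iterations leave
    -- its gate alone.
    by_cases hcs : c ∈ cs
    · exact ih hbase (fun c hc => h c (by simp [hc])) c hcs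
    · obtain rfl : c = a := by simpa [hcs] using hc
      rw [runGates_of_forall_ne, h c (by simp) env henv]
      intro g hg he
      obtain ⟨b, hb, hg⟩ := List.mem_flatMap.1 hg
      have := hF b g hg
      rw [he] at this
      refine not_append_singleton_prefix ?_ this
      rintro rfl
      exact hcs hb

/-- The bound on `v` is needed for equations, as equation gates exist only below `m`. Constants of
the formula may exceed `m`: an equation between a variable and such a constant reads an absent gate,
which is correctly false. -/
theorem FO.runGates_gates {w : List Bool} {m : ℕ} {D : Set (GroundAtom S)} {φ : FO S}
    {env : Label → Bool} (henv : IsBase m D env) {L : Label} (hL : [m, 2] <+: L) {v : ℕ → ℕ}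
    (hv : ∀ x ∈ φ.freeVars, v x < m) :
    runGates w env (φ.gates m v L) L = true ↔ HoldsIn {c | c < m} D v φ := by
  induction φ generalizing env L v with
  | top | bot => simp [gates, runGates, Gate.value, HoldsIn]
  | atom α =>
    simp only [gates, runGates, List.foldl_cons, List.foldl_nil, Function.update_self, Gate.value,
      List.any_cons, List.any_nil, Bool.or_false, HoldsIn]
    exact henv.atom (α.ground v)
  | eq s t =>
    simp only [gates, runGates, List.foldl_cons, List.foldl_nil, Function.update_self, HoldsIn]
    exact eval_eqGate henv (fun x hx => hv x (Or.inl hx)) (fun x hx => hv x (Or.inr hx))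
  | neg φ ih =>
    rw [gates, runGates_append_singleton, HoldsIn,
      ← ih henv (hL.trans (List.prefix_append L [0])) hv]
    simp [Gate.value]
  | and φ ψ ih₁ ih₂ | or φ ψ ih₁ ih₂ =>
    have h₁ := ih₁ henv (hL.trans (List.prefix_append L [0])) fun x hx => hv x (Or.inl hx)
    have hbase := henv.runGates (w := w) (gs := φ.gates m v (L ++ [0])) fun g hg =>
      (hL.trans (List.prefix_append L [0])).trans (prefix_of_mem_gates hg)
    have h₂ := ih₂ hbase (hL.trans (List.prefix_append L [1]))
      fun x hx => hv x (Or.inr hx)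
    rw [gates, runGates_append_singleton, runGates_append, HoldsIn, ← h₁, ← h₂]
    have h₃ : ∀ env, runGates w env (ψ.gates m v (L ++ [1])) (L ++ [0]) = env (L ++ [0]) :=
      fun env => runGates_of_forall_ne fun g hg he =>
        not_append_singleton_prefix (by decide) (he ▸ prefix_of_mem_gates hg)
    simp [Gate.value, h₃]
  | ex x φ ih | all x φ ih =>
    have h : ∀ c ∈ countdown m, _ := runGates_flatMap (w := w) henv hL
      (F := fun c => φ.gates m (Function.update v x c) (L ++ [c]))
      (fun c g hg => prefix_of_mem_gates hg)
      (P := fun c => HoldsIn {c | c < m} D (Function.update v x c) φ)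
      fun c hc env henv => ih henv (hL.trans (List.prefix_append L [c])) fun y hy => by
        by_cases hyx : y = x
        · subst hyx
          simpa using mem_countdown.1 hc
        · rw [Function.update_of_ne hyx]
          exact hv y ⟨hy, hyx⟩
    rw [gates, runGates_append_singleton, HoldsIn]
    simp only [Gate.value, List.any_map, List.all_map, List.any_eq_true, List.all_eq_true,
      Function.comp_apply]
    first
    | exact exists_congr fun c => (and_congr_right (h c)).trans (and_congr_left' mem_countdown)
    | exact forall_congr' fun c => imp_congr_ctx mem_countdown fun hc => h c (mem_countdown.2 hc)

/-- The database over `0, …, m - 1` that is encoded by `w`. -/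
def decodeDB (S : Signature) (m : ℕ) (w : List Bool) : Set (GroundAtom S) :=
  {f | (∀ i, f.args i < m) ∧
    w.getD (S.offset m f.pred + digitsValue m (List.ofFn f.args)) false = true}

theorem mem_tupleGates {L : Label} {m off j : ℕ} {as : List ℕ} {g : Label × Gate} :
    g ∈ tupleGates L m off j as (digitsValue m as) ↔ ∃ bs : List ℕ, bs.length = j ∧
      (∀ b ∈ bs, b < m) ∧ g = (L ++ (bs ++ as), .input (off + digitsValue m (bs ++ as))) := by
  induction j generalizing as with
  | zero => simp [tupleGates]
  | succ j ih =>
    have ih' : ∀ c, g ∈ tupleGates L m off j (c :: as) (digitsValue m as * m + c) ↔ _ :=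
      fun c => ih (as := c :: as)
    simp only [tupleGates, List.mem_flatMap, mem_countdown, ih']
    constructor
    · rintro ⟨c, hc, bs, hlen, hbs, rfl⟩
      refine ⟨bs ++ [c], by simp [hlen], ?_, by simp⟩
      intro b hb
      rcases List.mem_append.1 hb with hb | hb
      · exact hbs b hb
      · rwa [List.mem_singleton.1 hb]
    · rintro ⟨bs, hlen, hbs, rfl⟩
      -- The outer loop chooses the last entry of `bs`.
      rcases List.eq_nil_or_concat bs with rfl | ⟨bs, c, rfl⟩
      · simp at hlen
      · simp only [List.concat_eq_append, List.length_append, List.length_singleton,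
          Nat.add_right_cancel_iff] at hlen hbs ⊢
        exact ⟨c, hbs c (by simp), bs, hlen, fun b hb => hbs b (by simp [hb]), by simp⟩

theorem mem_inputGates {m : ℕ} {g : Label × Gate} : g ∈ inputGates S m ↔
    ∃ p < S.numPred, ∃ bs : List ℕ, bs.length = S.arityAt p ∧ (∀ b ∈ bs, b < m) ∧
      g = (m :: 0 :: p :: bs, .input (S.offset m p + digitsValue m bs)) := by
  simp only [inputGates, List.mem_flatMap, mem_countdown]
  refine exists_congr fun p => and_congr_right fun _ => ?_
  have := mem_tupleGates (L := [m, 0, p]) (m := m) (off := S.offset m p) (j := S.arityAt p)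
    (as := []) (g := g)
  simpa [digitsValue] using this

/-- Absent gates count as false; this covers atoms with arguments outside the domain and false
equations. -/
theorem isBase_decodeDB {w : List Bool} {m : ℕ} {env : Label → Bool}
    (henv : ∀ L, [m] <+: L → env L = false) :
    IsBase m (decodeDB S m w) (runGates w env (inputGates S m ++ eqGates m)) := by
  -- The default `true` is for the equation gates, which are introduced for true equations only.
  let f : Label → Bool := fun L => match L with
    | _ :: 0 :: p :: bs => w.getD (S.offset m p + digitsValue m bs) false
    | _ => true
  have hf : ∀ g ∈ inputGates S m ++ eqGates m, ∀ env, g.2.value w env = f g.1 := by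
    intro g hg env
    rcases List.mem_append.1 hg with hg | hg
    · obtain ⟨p, -, bs, -, -, rfl⟩ := mem_inputGates.1 hg
      rfl
    · obtain ⟨c, -, rfl⟩ := List.mem_map.1 hg
      rfl
  constructor
  · intro a
    by_cases ha : ∀ i, a.args i < m
    · rw [(runGates_const hf _).1]
      · exact ⟨fun h => ⟨ha, h⟩, fun h => h.2⟩
      · refine ⟨_, List.mem_append_left _ (mem_inputGates.2 ⟨a.pred, a.pred.2, List.ofFn a.args,
          by simp [Signature.arityAt_val], ?_, rfl⟩), rfl⟩
        intro b hb
        obtain ⟨i, rfl⟩ := List.mem_ofFn.1 hb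
        exact ha i
    · rw [(runGates_const hf _).2, henv _ (by simp)]
      · exact ⟨fun h => by simp at h, fun h => absurd h.1 ha⟩
      · intro g hg he
        rcases List.mem_append.1 hg with hg | hg
        · obtain ⟨p, -, bs, -, hbs, rfl⟩ := mem_inputGates.1 hg
          simp only [List.cons.injEq, true_and] at he
          exact ha fun i => hbs _ (he.2 ▸ List.mem_ofFn.2 ⟨i, rfl⟩)
        · obtain ⟨c, -, rfl⟩ := List.mem_map.1 hg
          simp at he
  · intro a b
    by_cases hab : a = b ∧ a < m
    · rw [(runGates_const hf _).1]
      · exact ⟨fun _ => hab, fun _ => rfl⟩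
      · obtain ⟨rfl, ha⟩ := hab
        exact ⟨_, List.mem_append_right _ (List.mem_map.2 ⟨a, mem_countdown.2 ha, rfl⟩), rfl⟩
    · rw [(runGates_const hf _).2, henv _ (by simp)]
      · exact ⟨fun h => by simp at h, fun h => absurd h hab⟩
      · intro g hg he
        rcases List.mem_append.1 hg with hg | hg
        · obtain ⟨p, -, bs, -, hbs, rfl⟩ := mem_inputGates.1 hg
          simp at he
        · obtain ⟨c, hc, rfl⟩ := List.mem_map.1 hg
          simp only [List.cons.injEq, true_and, and_true] at he
          exact hab ⟨he.1.symm.trans he.2, he.1 ▸ mem_countdown.1 hc⟩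

theorem prefix_of_mem_blockGates {φ : FO S} {m : ℕ} {g : Label × Gate}
    (hg : g ∈ blockGates φ m) : [m] <+: g.1 := by
  rcases List.mem_append.1 hg with hg | hg
  · rcases List.mem_append.1 hg with hg | hg
    · obtain ⟨p, -, bs, -, -, rfl⟩ := mem_inputGates.1 hg
      simp
    · obtain ⟨c, -, rfl⟩ := List.mem_map.1 hg
      simp
  · exact (show [m] <+: [m, 2] by simp).trans (FO.prefix_of_mem_gates hg)

theorem runGates_blockGates {w : List Bool} {φ : FO S} (hφ : φ.IsSentence) {m : ℕ}
    {env : Label → Bool} (henv : ∀ L, [m] <+: L → env L = false) :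
    runGates w env (blockGates φ m) [m, 2] = true ↔
      FO.HoldsIn {c | c < m} (decodeDB S m w) (fun _ => 0) φ := by
  rw [blockGates, runGates_append]
  exact FO.runGates_gates (isBase_decodeDB henv) (List.prefix_refl _) fun x hx => by
    rw [hφ] at hx
    simp at hx

/-- Names of a block begin with its number `m`, so blocks do not interfere, and a block whose test
fails leaves its output gate false. -/
theorem runGates_blocks {w : List Bool} {φ : FO S} (hφ : φ.IsSentence) {P : ℕ → Prop}
    [DecidablePred P] {ms : List ℕ} (hms : ms.Nodup) {env : Label → Bool}
    (henv : ∀ m ∈ ms, ∀ L, [m] <+: L → env L = false) :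
    ∀ m ∈ ms, (runGates w env (ms.flatMap fun m => if P m then blockGates φ m else [])
      [m, 2] = true ↔ P m ∧ FO.HoldsIn {c | c < m} (decodeDB S m w) (fun _ => 0) φ) := by
  have hpre : ∀ a, ∀ g ∈ (if P a then blockGates φ a else []), [a] <+: g.1 := by
    intro a g hg
    split_ifs at hg
    · exact prefix_of_mem_blockGates hg
    · simp at hg
  have hne : ∀ a b : ℕ, ∀ L : Label, [a] <+: L → [b] <+: L → a = b := by
    rintro a b (_ | ⟨c, L⟩) h h'
    · simp at h
    · simp only [List.cons_prefix_cons, List.nil_prefix, and_true] at h h'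
      exact h.trans h'.symm
  induction ms generalizing env with
  | nil => simp
  | cons a ms ih =>
    obtain ⟨ha, hms⟩ := List.nodup_cons.1 hms
    intro m hm
    rw [List.flatMap_cons, runGates_append]
    rcases List.mem_cons.1 hm with rfl | hm
    · rw [runGates_of_forall_ne]
      · split_ifs with hP
        · rw [runGates_blockGates hφ (henv m (by simp))]
          simp [hP]
        · rw [show runGates w env [] = env from rfl, henv m (by simp) _ (by simp)]
          simp [hP]
      · intro g hg he
        obtain ⟨b, hb, hg⟩ := List.mem_flatMap.1 hg
        have := hne b m g.1 (hpre b g hg) (he ▸ by simp)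
        exact ha (this ▸ hb)
    · refine ih hms (fun b hb L hL => ?_) m hm
      rw [runGates_of_forall_ne]
      · exact henv b (by simp [hb]) L hL
      · intro g hg he
        have := hne a b L (he ▸ hpre a g hg) hL
        exact ha (this ▸ hb)

theorem eval_foCircuit {φ : FO S} (hφ : φ.IsSentence) (w : List Bool) :
    (foCircuit φ w.length).eval w = true ↔ ∃ m ≤ w.length, S.offset m S.numPred = w.length ∧
      FO.HoldsIn {c | c < m} (decodeDB S m w) (fun _ => 0) φ := by
  have h : (foCircuit φ w.length).eval w = runGates w (fun _ => false) _ [] := rfl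
  rw [h, foCircuit, runGates_append_singleton]
  simp only [Gate.value, List.any_map, List.any_eq_true, Function.comp_apply]
  refine exists_congr fun m => (and_congr_right fun hm => ?_).trans
    (and_congr_left' (mem_countdown.trans Nat.lt_succ_iff))
  exact runGates_blocks hφ (nodup_countdown _) (fun _ _ _ _ => rfl) m hm

/-! #### Depth -/

/-- All gates that `g` uses have a smaller rank than `k`. -/
def Gate.RankLt (rk : Label → ℕ) (k : ℕ) : Gate → Prop
  | .input _ => True
  | .not a => rk a < k
  | .and as => 0 < k ∧ ∀ a ∈ as, rk a < k
  | .or as => 0 < k ∧ ∀ a ∈ as, rk a < k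

theorem foldr_max_le {l : List ℕ} {k : ℕ} (h : ∀ a ∈ l, a ≤ k) : l.foldr max 0 ≤ k := by
  induction l with
  | nil => simp
  | cons a l ih => exact max_le (h a (by simp)) (ih fun b hb => h b (by simp [hb]))

theorem Gate.RankLt.depth_le {rk env : Label → ℕ} {k : ℕ} {g : Gate} (hg : g.RankLt rk k)
    (henv : ∀ L, env L ≤ rk L) : g.depth env ≤ k := by
  have key : ∀ as : List Label, (0 < k ∧ ∀ a ∈ as, rk a < k) →
      (as.map env).foldr max 0 + 1 ≤ k := by
    intro as has
    have : (as.map env).foldr max 0 ≤ k - 1 := foldr_max_le fun a ha => by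
      obtain ⟨b, hb, rfl⟩ := List.mem_map.1 ha
      exact Nat.le_sub_one_of_lt ((henv b).trans_lt (has.2 b hb))
    have := has.1
    omega
  cases g with
  | input i => exact Nat.zero_le _
  | not a => exact (henv a).trans_lt hg
  | and as | or as => exact key as hg

/-- It suffices to rank the names so that every gate uses names of smaller rank only. -/
theorem Circuit.depth_le {C : Circuit} {rk : Label → ℕ}
    (h : ∀ g ∈ C.gates, g.2.RankLt rk (rk g.1)) : C.depth ≤ rk C.output := by
  have key : ∀ (gs : List (Label × Gate)) (env : Label → ℕ), (∀ L, env L ≤ rk L) →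
      (∀ g ∈ gs, g.2.RankLt rk (rk g.1)) →
      ∀ L, gs.foldl (fun env g => Function.update env g.1 (g.2.depth env)) env L ≤ rk L := by
    intro gs
    induction gs with
    | nil => exact fun env henv _ => henv
    | cons g gs ih =>
      intro env henv hgs
      refine ih _ (fun L => ?_) fun g' hg' => hgs g' (by simp [hg'])
      by_cases hL : L = g.1
      · subst hL
        dsimp only
        rw [Function.update_self]
        exact (hgs g (by simp)).depth_le henv
      · dsimp only
        rw [Function.update_of_ne hL]
        exact henv L
  exact key C.gates _ (fun _ => Nat.zero_le _) h _

/-- The nesting depth of a formula. -/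
def FO.height : FO S → ℕ
  | .top => 0
  | .bot => 0
  | .atom _ => 0
  | .eq _ _ => 0
  | .neg φ => φ.height + 1
  | .and φ ψ => max φ.height ψ.height + 1
  | .or φ ψ => max φ.height ψ.height + 1
  | .ex _ φ => φ.height + 1
  | .all _ φ => φ.height + 1

/-- A bound on the depth of the gate with a given name. -/
def labelRank (B : ℕ) : Label → ℕ
  | [] => B + 3
  | _ :: 2 :: r => B - r.length + 2
  | _ => 1

theorem labelRank_append_lt {B m a : ℕ} {r : Label} (h : r.length < B) :
    labelRank B ((m :: 2 :: r) ++ [a]) < labelRank B (m :: 2 :: r) := by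
  simp only [labelRank, List.cons_append, List.length_append, List.length_singleton]
  omega

/-- Each connective or quantifier lengthens the address by one and lowers the height; the invariant
keeps the truncated subtraction in `labelRank` exact. -/
theorem FO.rankLt_of_mem_gates {B m : ℕ} {φ : FO S} {v : ℕ → ℕ} {r : Label}
    (hr : r.length + φ.height ≤ B) {g : Label × Gate} (hg : g ∈ φ.gates m v (m :: 2 :: r)) :
    g.2.RankLt (labelRank B) (labelRank B g.1) := by
  have hpos : ∀ s : Label, 0 < labelRank B (m :: 2 :: s) := by simp [labelRank]
  have hone : ∀ s : Label, 1 < labelRank B (m :: 2 :: s) := by simp [labelRank]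
  induction φ generalizing v r with
  | top | bot =>
    simp only [gates, List.mem_singleton] at hg
    rw [hg]
    exact ⟨hpos r, by simp⟩
  | atom α =>
    simp only [gates, List.mem_singleton] at hg
    rw [hg]
    exact ⟨hpos r, by simp [labelRank]⟩
  | eq s t =>
    simp only [gates, List.mem_singleton] at hg
    rw [hg]
    dsimp only
    have h : ∀ a b, (Gate.or [[m, 1, a, b]]).RankLt (labelRank B) (labelRank B (m :: 2 :: r)) :=
      fun a b => ⟨hpos r, by simp [labelRank]⟩
    cases s with
    | var x => exact h _ _
    | const c =>
      cases t with
      | var y => exact h _ _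
      | const d =>
        rw [eqGate]
        split_ifs <;> exact ⟨hpos r, by simp⟩
  | neg φ ih =>
    simp only [height] at hr
    rcases List.mem_append.1 hg with hg | hg
    · exact ih (r := r ++ [0]) (by simp; omega) hg
    · rw [List.mem_singleton.1 hg]
      exact labelRank_append_lt (by omega)
  | and φ ψ ih₁ ih₂ | or φ ψ ih₁ ih₂ =>
    simp only [height] at hr
    rcases List.mem_append.1 hg with hg | hg
    · rcases List.mem_append.1 hg with hg | hg
      · exact ih₁ (r := r ++ [0]) (by simp; omega) hg
      · exact ih₂ (r := r ++ [1]) (by simp; omega) hg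
    · rw [List.mem_singleton.1 hg]
      refine ⟨hpos r, fun a ha => ?_⟩
      simp only [List.mem_cons, List.not_mem_nil, or_false] at ha
      rcases ha with rfl | rfl
      · exact labelRank_append_lt (by omega)
      · exact labelRank_append_lt (by omega)
  | ex x φ ih | all x φ ih =>
    simp only [height] at hr
    rcases List.mem_append.1 hg with hg | hg
    · obtain ⟨c, -, hg⟩ := List.mem_flatMap.1 hg
      exact ih (r := r ++ [c]) (by simp; omega) hg
    · rw [List.mem_singleton.1 hg]
      refine ⟨hpos r, fun a ha => ?_⟩
      obtain ⟨c, -, rfl⟩ := List.mem_map.1 ha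
      exact labelRank_append_lt (by omega)

theorem depth_foCircuit_le (φ : FO S) (n : ℕ) : (foCircuit φ n).depth ≤ φ.height + 3 := by
  refine Circuit.depth_le (rk := labelRank φ.height) fun g hg => ?_
  rcases List.mem_append.1 hg with hg | hg
  · obtain ⟨m, -, hg⟩ := List.mem_flatMap.1 hg
    split_ifs at hg
    · rcases List.mem_append.1 hg with hg | hg
      · rcases List.mem_append.1 hg with hg | hg
        · obtain ⟨p, -, bs, -, -, rfl⟩ := mem_inputGates.1 hg
          trivial
        · obtain ⟨c, -, rfl⟩ := List.mem_map.1 hg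
          exact ⟨Nat.one_pos, by simp⟩
      · exact FO.rankLt_of_mem_gates (by simp) hg
    · simp at hg
  · rw [List.mem_singleton.1 hg]
    refine ⟨by simp [labelRank], fun a ha => ?_⟩
    obtain ⟨c, -, rfl⟩ := List.mem_map.1 ha
    simp [labelRank]

/-! #### Size -/

/-- The number of gates and wires. -/
def gatesSize (gs : List (Label × Gate)) : ℕ := (gs.map fun g => g.2.fanIn + 1).sum

theorem gatesSize_append (gs gs' : List (Label × Gate)) :
    gatesSize (gs ++ gs') = gatesSize gs + gatesSize gs' := by
  simp [gatesSize]

theorem gatesSize_singleton (L : Label) (g : Gate) : gatesSize [(L, g)] = g.fanIn + 1 := by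
  simp [gatesSize]

theorem gatesSize_flatMap_le {l : List ℕ} {F : ℕ → List (Label × Gate)} {k : ℕ}
    (h : ∀ c ∈ l, gatesSize (F c) ≤ k) : gatesSize (l.flatMap F) ≤ l.length * k := by
  induction l with
  | nil => simp [gatesSize]
  | cons c l ih =>
    rw [List.flatMap_cons, gatesSize_append, List.length_cons, Nat.succ_mul, Nat.add_comm]
    exact Nat.add_le_add (ih fun c hc => h c (by simp [hc])) (h c (by simp))

theorem gatesSize_tupleGates_le (L : Label) (m off j : ℕ) (as : List ℕ) (b : ℕ) :
    gatesSize (tupleGates L m off j as b) ≤ m ^ j := by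
  induction j generalizing as b with
  | zero => simp [tupleGates, gatesSize, Gate.fanIn]
  | succ j ih =>
    rw [tupleGates, pow_succ']
    have := gatesSize_flatMap_le (l := countdown m) fun c _ => ih (c :: as) (b * m + c)
    rwa [length_countdown] at this

theorem gatesSize_inputGates_le (m : ℕ) : gatesSize (inputGates S m) ≤ S.offset m S.numPred := by
  rw [inputGates]
  generalize S.numPred = k
  induction k with
  | zero => simp [countdown, gatesSize]
  | succ k ih =>
    rw [countdown_succ, List.flatMap_cons, gatesSize_append, Signature.offset_succ, Nat.add_comm]
    exact Nat.add_le_add ih (gatesSize_tupleGates_le _ _ _ _ _ _)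

/-- Boundedness by a polynomial. -/
def PolyBounded (f : ℕ → ℕ) : Prop := ∃ k, ∀ n, f n ≤ (n + 2) ^ k

/-- The base `n + 2` is at least `2`, so powers of it absorb constants and sums. -/
theorem PolyBounded.const (c : ℕ) : PolyBounded fun _ => c :=
  ⟨c, fun n => (Nat.lt_two_pow_self.le).trans (Nat.pow_le_pow_left (by omega) c)⟩

theorem PolyBounded.id : PolyBounded fun n => n := ⟨1, fun n => by simp⟩

theorem PolyBounded.mul {f g : ℕ → ℕ} (hf : PolyBounded f) (hg : PolyBounded g) :
    PolyBounded fun n => f n * g n := by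
  obtain ⟨a, ha⟩ := hf
  obtain ⟨b, hb⟩ := hg
  exact ⟨a + b, fun n => by rw [pow_add]; exact Nat.mul_le_mul (ha n) (hb n)⟩

theorem PolyBounded.add {f g : ℕ → ℕ} (hf : PolyBounded f) (hg : PolyBounded g) :
    PolyBounded fun n => f n + g n := by
  obtain ⟨a, ha⟩ := hf
  obtain ⟨b, hb⟩ := hg
  refine ⟨a + b + 1, fun n => ?_⟩
  have h1 : (n + 2) ^ a ≤ (n + 2) ^ (a + b) := Nat.pow_le_pow_right (by omega) (by omega)
  have h2 : (n + 2) ^ b ≤ (n + 2) ^ (a + b) := Nat.pow_le_pow_right (by omega) (by omega)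
  calc f n + g n ≤ (n + 2) ^ (a + b) * 2 := by linarith [ha n, hb n]
    _ ≤ (n + 2) ^ (a + b) * (n + 2) := Nat.mul_le_mul_left _ (by omega)

/-- A bound on the size of the part of a circuit that evaluates a formula. -/
def FO.cost : FO S → ℕ → ℕ
  | .top, _ => 1
  | .bot, _ => 1
  | .atom _, _ => 2
  | .eq _ _, _ => 2
  | .neg φ, m => φ.cost m + 2
  | .and φ ψ, m => φ.cost m + ψ.cost m + 3
  | .or φ ψ, m => φ.cost m + ψ.cost m + 3
  | .ex _ φ, m => m * φ.cost m + (m + 1)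
  | .all _ φ, m => m * φ.cost m + (m + 1)

theorem FO.polyBounded_cost (φ : FO S) : PolyBounded φ.cost := by
  induction φ with
  | top | bot | atom | eq => exact PolyBounded.const _
  | neg φ ih => exact ih.add (PolyBounded.const 2)
  | and φ ψ ih₁ ih₂ | or φ ψ ih₁ ih₂ => exact (ih₁.add ih₂).add (PolyBounded.const 3)
  | ex x φ ih | all x φ ih =>
    exact (PolyBounded.id.mul ih).add (PolyBounded.id.add (PolyBounded.const 1))

theorem FO.cost_mono (φ : FO S) : Monotone φ.cost := by
  intro m n h
  induction φ with
  | top | bot | atom | eq => exact le_rfl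
  | neg φ ih => exact Nat.add_le_add_right ih _
  | and φ ψ ih₁ ih₂ | or φ ψ ih₁ ih₂ =>
    exact Nat.add_le_add_right (Nat.add_le_add ih₁ ih₂) _
  | ex x φ ih | all x φ ih =>
    exact Nat.add_le_add (Nat.mul_le_mul h ih) (Nat.add_le_add_right h 1)

theorem FO.gatesSize_gates_le (m : ℕ) (φ : FO S) (v : ℕ → ℕ) (L : Label) :
    gatesSize (φ.gates m v L) ≤ φ.cost m := by
  induction φ generalizing v L with
  | top | bot | atom => simp [gates, gatesSize_singleton, Gate.fanIn, cost]
  | eq s t =>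
    rw [gates, gatesSize_singleton, cost]
    cases s with
    | var x => exact le_rfl
    | const c =>
      cases t with
      | var y => exact le_rfl
      | const d =>
        rw [eqGate]
        split_ifs <;> simp [Gate.fanIn]
  | neg φ ih =>
    rw [gates, gatesSize_append, gatesSize_singleton]
    exact Nat.add_le_add_right (ih _ _) _
  | and φ ψ ih₁ ih₂ | or φ ψ ih₁ ih₂ =>
    rw [gates, gatesSize_append, gatesSize_append, gatesSize_singleton]
    exact Nat.add_le_add_right (Nat.add_le_add (ih₁ _ _) (ih₂ _ _)) _
  | ex x φ ih | all x φ ih =>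
    rw [gates, gatesSize_append, gatesSize_singleton]
    have := gatesSize_flatMap_le (l := countdown m) fun c _ =>
      ih (Function.update v x c) (L ++ [c])
    rw [length_countdown] at this
    refine Nat.add_le_add this ?_
    simp [Gate.fanIn, length_countdown]

/-- There are at most `n + 1` blocks. In a block that is present the input gates number at most the
encoding length, which is `n`, and `m ≤ n` bounds the rest. -/
theorem size_foCircuit_le (φ : FO S) :
    ∃ c : ℕ, ∀ n, (foCircuit φ n).size ≤ c * (n + 1) ^ c := by
  have hbound : ∀ n, (foCircuit φ n).size ≤ (n + 1) * (n + n + φ.cost n) + (n + 2) := by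
    intro n
    rw [show (foCircuit φ n).size = gatesSize (foCircuit φ n).gates from rfl, foCircuit,
      gatesSize_append, gatesSize_singleton]
    refine Nat.add_le_add ?_ (by simp [Gate.fanIn, length_countdown])
    have := gatesSize_flatMap_le (l := countdown (n + 1))
      (F := fun m => if S.offset m S.numPred = n then blockGates φ m else [])
      (k := n + n + φ.cost n) fun m hm => ?_
    · rwa [length_countdown] at this
    have hmn : m ≤ n := Nat.lt_succ_iff.1 (mem_countdown.1 hm)
    split_ifs with h
    · rw [blockGates, gatesSize_append, gatesSize_append]
      refine Nat.add_le_add (Nat.add_le_add ((gatesSize_inputGates_le m).trans h.le) ?_)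
        ((FO.gatesSize_gates_le m φ _ _).trans (φ.cost_mono hmn))
      simpa [eqGates, gatesSize, Function.comp_def, Gate.fanIn, length_countdown] using hmn
    · simp [gatesSize]
  obtain ⟨k, hk⟩ := (((PolyBounded.id.add (.const 1)).mul
    ((PolyBounded.id.add .id).add φ.polyBounded_cost)).add (PolyBounded.id.add (.const 2)))
  -- One constant has to serve as factor and as exponent: `n + 2 ≤ 2 * (n + 1)` asks for the factor
  -- `2 ^ k`, which also exceeds `k`.
  refine ⟨2 ^ k, fun n => (hbound n).trans ((hk n).trans ?_)⟩
  calc (n + 2) ^ k ≤ (2 * (n + 1)) ^ k := Nat.pow_le_pow_left (by omega) k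
    _ = 2 ^ k * (n + 1) ^ k := mul_pow _ _ _
    _ ≤ 2 ^ k * (n + 1) ^ 2 ^ k :=
      Nat.mul_le_mul_left _ (Nat.pow_le_pow_right (by omega) Nat.lt_two_pow_self.le)

end Circuits

/-! ### Machines whose heads serve as counters -/

section Machines

variable {H : ℕ}

/-- A part of a machine without work tapes. It is left when the next state is `none`. -/
structure Fragment (H : ℕ) where
  State : Type
  finite_state : Finite State
  start : State
  next : State → (Fin H → InputCell) → Option State × (Fin H → Move) × List DescSym

/-- The cells scanned by heads at the positions `ρ` on the input `1ⁿ`. -/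
def scan (n : ℕ) (ρ : Fin H → ℕ) : Fin H → InputCell :=
  fun h => readInput (List.replicate n true) (ρ h)

def moveHeads (n : ℕ) (mv : Fin H → Move) (ρ : Fin H → ℕ) : Fin H → ℕ :=
  fun h => min ((mv h).apply (ρ h)) (n + 1)

namespace Fragment

/-- From state `s` with head positions `ρ`, the fragment is left with head positions `ρ'` after
writing `out`. -/
inductive Exec (A : Fragment H) (n : ℕ) :
    A.State → (Fin H → ℕ) → (Fin H → ℕ) → List DescSym → Prop
  | exit {s ρ mv o} (h : A.next s (scan n ρ) = (none, mv, o)) : Exec A n s ρ (moveHeads n mv ρ) o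
  | step {s s' ρ ρ' mv o out} (h : A.next s (scan n ρ) = (some s', mv, o))
      (h' : Exec A n s' (moveHeads n mv ρ) ρ' out) : Exec A n s ρ ρ' (o ++ out)

/-- Started with head positions `ρ` on the input `1ⁿ`, the fragment is left with head positions `ρ'`
after writing `out`. -/
def Runs (A : Fragment H) (n : ℕ) (ρ ρ' : Fin H → ℕ) (out : List DescSym) : Prop :=
  (∀ h, ρ h ≤ n + 1) → (∀ h, ρ' h ≤ n + 1) ∧ A.Exec n A.start ρ ρ' out

theorem Runs.congr {A : Fragment H} {n : ℕ} {ρ ρ' σ σ' : Fin H → ℕ} {o o' : List DescSym}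
    (h : A.Runs n ρ ρ' o) (hρ : ρ = σ) (hρ' : ρ' = σ') (ho : o = o') : A.Runs n σ σ' o' := by
  subst hρ hρ' ho
  exact h

/-- A single move. -/
def move (mv : Fin H → Move) (o : List DescSym) : Fragment H where
  State := Unit
  finite_state := inferInstance
  start := ()
  next _ _ := (none, mv, o)

/-- First `A`, then `B`. -/
def seq (A B : Fragment H) : Fragment H where
  State := A.State ⊕ B.State
  finite_state := by
    have := A.finite_state
    have := B.finite_state
    infer_instance
  start := .inl A.start
  next
    | .inl s, c => match A.next s c with
      | (some s', r) => (some (.inl s'), r)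
      | (none, r) => (some (.inr B.start), r)
    | .inr s, c => match B.next s c with
      | (some s', r) => (some (.inr s'), r)
      | (none, r) => (none, r)

/-- Repeat `A` as long as the cell scanned by the head `h` passes the test `t`. -/
def loop (h : Fin H) (t : InputCell → Bool) (A : Fragment H) : Fragment H where
  State := Option A.State
  finite_state := by
    have := A.finite_state
    infer_instance
  start := none
  next
    | none, c => (if t (c h) then some (some A.start) else none, fun _ => .stay, [])
    -- When `A` is left, its `none` becomes the state in which the loop tests again.
    | some s, c => match A.next s c with
      | (s', r) => (some s', r)

/-- `A` if the cell scanned by the head `h` passes the test `t`, and `B` otherwise. -/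
def ite (h : Fin H) (t : InputCell → Bool) (A B : Fragment H) : Fragment H where
  State := Option (A.State ⊕ B.State)
  finite_state := by
    have := A.finite_state
    have := B.finite_state
    infer_instance
  start := none
  next
    | none, c => (some (some (if t (c h) then .inl A.start else .inr B.start)), fun _ => .stay, [])
    | some (.inl s), c => match A.next s c with
      | (some s', r) => (some (some (.inl s')), r)
      | (none, r) => (none, r)
    | some (.inr s), c => match B.next s c with
      | (some s', r) => (some (some (.inr s')), r)
      | (none, r) => (none, r)

variable {n : ℕ} {ρ ρ' ρ'' : Fin H → ℕ} {o o' : List DescSym} {A B : Fragment H}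

/-! ### Rules for composed fragments -/

theorem moveHeads_stay (hρ : ∀ h, ρ h ≤ n + 1) : moveHeads n (fun _ => .stay) ρ = ρ := by
  funext h
  simp [moveHeads, Move.apply, hρ h]

theorem runs_move (mv : Fin H → Move) (o : List DescSym) :
    (move mv o).Runs n ρ (moveHeads n mv ρ) o :=
  fun _ => ⟨fun _ => min_le_right _ _, .exit rfl⟩

theorem exec_seq_right {s : B.State} (h : B.Exec n s ρ ρ' o) :
    (seq A B).Exec n (.inr s) ρ ρ' o := by
  induction h with
  | exit h => exact .exit (by simp [seq, h])
  | step h _ ih => exact .step (by simp only [seq, h]) ih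

theorem exec_seq_left {s : A.State} (h : A.Exec n s ρ ρ' o) (h' : B.Exec n B.start ρ' ρ'' o') :
    (seq A B).Exec n (.inl s) ρ ρ'' (o ++ o') := by
  induction h with
  | exit h => exact .step (by simp only [seq, h]) (exec_seq_right h')
  | step h _ ih =>
    rw [List.append_assoc]
    exact .step (by simp only [seq, h]) (ih h')

theorem Runs.seq (h : A.Runs n ρ ρ' o) (h' : B.Runs n ρ' ρ'' o') :
    (A.seq B).Runs n ρ ρ'' (o ++ o') := fun hρ =>
  ⟨(h' (h hρ).1).1, exec_seq_left (h hρ).2 (h' (h hρ).1).2⟩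

theorem exec_ite_left {h : Fin H} {t : InputCell → Bool} {s : A.State} (hA : A.Exec n s ρ ρ' o) :
    (ite h t A B).Exec n (some (.inl s)) ρ ρ' o := by
  induction hA with
  | exit h => exact .exit (by simp [ite, h])
  | step h _ ih => exact .step (by simp only [ite, h]) ih

theorem exec_ite_right {h : Fin H} {t : InputCell → Bool} {s : B.State} (hB : B.Exec n s ρ ρ' o) :
    (ite h t A B).Exec n (some (.inr s)) ρ ρ' o := by
  induction hB with
  | exit h => exact .exit (by simp [ite, h])
  | step h _ ih => exact .step (by simp only [ite, h]) ih

theorem Runs.ite {h : Fin H} {t : InputCell → Bool}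
    (hA : t (scan n ρ h) = true → A.Runs n ρ ρ' o)
    (hB : t (scan n ρ h) = false → B.Runs n ρ ρ' o) : (ite h t A B).Runs n ρ ρ' o := by
  intro hρ
  cases ht : t (scan n ρ h) with
  | true =>
    refine ⟨(hA ht hρ).1, ?_⟩
    refine .step (o := []) (mv := fun _ => .stay) (s' := some (.inl A.start))
      (by simp [Fragment.ite, ht]) ?_
    rw [moveHeads_stay hρ]
    exact exec_ite_left (hA ht hρ).2
  | false =>
    refine ⟨(hB ht hρ).1, ?_⟩
    refine .step (o := []) (mv := fun _ => .stay) (s' := some (.inr B.start))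
      (by simp [Fragment.ite, ht]) ?_
    rw [moveHeads_stay hρ]
    exact exec_ite_right (hB ht hρ).2

theorem runs_loop_exit {h : Fin H} {t : InputCell → Bool} (ht : t (scan n ρ h) = false) :
    (loop h t A).Runs n ρ ρ [] := by
  refine fun hρ => ⟨hρ, ?_⟩
  have := Exec.exit (A := loop h t A) (n := n) (s := none) (ρ := ρ) (mv := fun _ => .stay) (o := [])
    (by simp [loop, ht])
  rwa [moveHeads_stay hρ] at this

theorem exec_loop {h : Fin H} {t : InputCell → Bool} {s : A.State} (hA : A.Exec n s ρ ρ' o)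
    (h' : (loop h t A).Exec n none ρ' ρ'' o') : (loop h t A).Exec n (some s) ρ ρ'' (o ++ o') := by
  induction hA with
  | exit h => exact .step (by simp only [loop, h]) h'
  | step h _ ih =>
    rw [List.append_assoc]
    exact .step (by simp only [loop, h]) (ih h')

theorem runs_loop_step {h : Fin H} {t : InputCell → Bool} (ht : t (scan n ρ h) = true)
    (hA : A.Runs n ρ ρ' o) (h' : (loop h t A).Runs n ρ' ρ'' o') :
    (loop h t A).Runs n ρ ρ'' (o ++ o') := by
  intro hρ
  refine ⟨(h' (hA hρ).1).1, .step (o := []) (mv := fun _ => .stay) (s' := some A.start)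
    (by simp [loop, ht]) ?_⟩
  rw [moveHeads_stay hρ]
  exact exec_loop (hA hρ).2 (h' (hA hρ).1).2

/-! ### Heads as counters -/

/-- The test that a head is not at the left end marker. -/
def isPos : InputCell → Bool
  | .leftEnd => false
  | _ => true

/-- The test that a head is not at the right end marker. -/
def notFull : InputCell → Bool
  | .rightEnd => false
  | _ => true

theorem isPos_scan {h : Fin H} : isPos (scan n ρ h) = true ↔ ρ h ≠ 0 := by
  rw [scan]
  cases ρ h with
  | zero => simp [readInput, isPos]
  | succ i =>
    rw [readInput]
    split_ifs <;> simp [isPos]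

theorem notFull_scan {h : Fin H} : notFull (scan n ρ h) = true ↔ ρ h ≤ n := by
  rw [scan]
  cases ρ h with
  | zero => simp [readInput, notFull]
  | succ i =>
    rw [readInput]
    split_ifs with hi
    · simpa [notFull] using hi
    · simpa [notFull] using hi

def emit (o : List DescSym) : Fragment H := move (fun _ => .stay) o

def inc (h : Fin H) : Fragment H := move (Function.update (fun _ => .stay) h .right) []

def dec (h : Fin H) : Fragment H := move (Function.update (fun _ => .stay) h .left) []

theorem runs_emit (o : List DescSym) : (emit o).Runs n ρ ρ o := fun hρ =>
  (runs_move _ o).congr rfl (moveHeads_stay hρ) rfl hρ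

theorem runs_inc (h : Fin H) :
    (inc h).Runs n ρ (Function.update ρ h (min (ρ h + 1) (n + 1))) [] := fun hρ =>
  (runs_move _ []).congr rfl (by
    funext k
    by_cases hk : k = h
    · subst hk
      simp [moveHeads, Move.apply]
    · simp [moveHeads, Move.apply, hk, hρ k]) rfl hρ

theorem runs_dec (h : Fin H) : (dec h).Runs n ρ (Function.update ρ h (ρ h - 1)) [] := fun hρ =>
  (runs_move _ []).congr rfl (by
    funext k
    by_cases hk : k = h
    · subst hk
      have := hρ k
      simp only [moveHeads, Function.update_self, Move.apply]
      omega
    · simp [moveHeads, Move.apply, hk, hρ k]) rfl hρ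

/-- Decrease the head `h` to `0`, and perform `A` after each step. -/
def down (h : Fin H) (A : Fragment H) : Fragment H := loop h isPos ((dec h).seq A)

/-- `R k` is the loop invariant when the counter is `k`. Zero is recognised by the left end marker,
so loops run downwards; this is why the circuits list their gates in `countdown` order. -/
theorem runs_down {h : Fin H} {R : ℕ → Fin H → ℕ} {out : ℕ → List DescSym} {m : ℕ}
    (hR : ∀ k ≤ m, R k h = k)
    (hA : ∀ k < m, A.Runs n (Function.update (R (k + 1)) h k) (R k) (out k)) :
    (down h A).Runs n (R m) (R 0) ((countdown m).flatMap out) := by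
  induction m with
  | zero =>
    refine runs_loop_exit ?_
    rw [← Bool.not_eq_true, isPos_scan, hR 0 le_rfl]
    simp
  | succ m ih =>
    rw [countdown_succ, List.flatMap_cons]
    refine runs_loop_step (by rw [isPos_scan, hR _ le_rfl]; simp)
      (((runs_dec h).seq ((hA m (Nat.lt_succ_self m)).congr ?_ rfl rfl)).congr rfl rfl
        (List.nil_append _))
      (ih (fun k hk => hR k (by omega)) fun k hk => hA k (by omega))
    rw [hR _ le_rfl, Nat.add_sub_cancel]

theorem runs_down_inc {h k : Fin H} (hhk : h ≠ k) (h0 : ρ k = 0) (hρ : ρ h ≤ n + 1) :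
    (down h (inc k)).Runs n ρ (Function.update (Function.update ρ k (ρ h)) h 0) [] := by
  refine (runs_down (R := fun i => Function.update (Function.update ρ k (ρ h - i)) h i)
    (out := fun _ => []) (m := ρ h) (fun i _ => by simp) fun i hi => (runs_inc k).congr rfl ?_ rfl
    ).congr ?_ ?_ (by simp)
  · funext j
    by_cases hj : j = k
    · subst hj
      simp only [Function.update_self, Function.update_idem, ne_eq, hhk.symm, not_false_eq_true,
        Function.update_of_ne]
      omega
    · by_cases hj' : j = h
      · subst hj'
        simp [hhk]
      · simp [hj, hj']
  · rw [Nat.sub_self, ← h0, Function.update_eq_self, Function.update_eq_self]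
  · simp

theorem runs_reset {h : Fin H} : (down h (emit [])).Runs n ρ (Function.update ρ h 0) [] := by
  refine (runs_down (R := fun i => Function.update ρ h i) (out := fun _ => []) (m := ρ h)
    (fun i _ => by simp) fun i hi => (runs_emit []).congr rfl (by simp) rfl).congr ?_ rfl (by simp)
  simp

/-- Copy the position of the head `k` to the head `h` with the help of the head `t`. -/
def copy (t k h : Fin H) : Fragment H := (down k (inc t)).seq (down t ((inc k).seq (inc h)))

/-- Reading a counter destroys it, so its value is first moved to `t` and then back to `k` and `h`
together. -/
theorem runs_copy {t k h : Fin H} (htk : t ≠ k) (hth : t ≠ h) (hkh : k ≠ h) (ht : ρ t = 0)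
    (hh : ρ h = 0) : (copy t k h).Runs n ρ (Function.update ρ h (ρ k)) [] := by
  intro hρ
  refine (Runs.seq (o := []) (o' := []) (runs_down_inc htk.symm ht (hρ k)) ?_) hρ
  refine (runs_down (m := ρ k) (out := fun _ => []) (R := fun i => Function.update (Function.update
      (Function.update ρ k (ρ k - i)) h (ρ k - i)) t i) (fun i _ => by simp)
      fun i hi => ((runs_inc k).seq (runs_inc h)).congr rfl ?_ rfl).congr ?_ ?_ (by simp)
  · have := hρ k
    funext j
    by_cases hjt : j = t
    · subst hjt
      simp [hth, htk]
    · by_cases hjk : j = k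
      · subst hjk
        simp only [Function.update_idem, ne_eq, hkh, not_false_eq_true, Function.update_of_ne,
          htk.symm, Function.update_self]
        omega
      · by_cases hjh : j = h
        · subst hjh
          simp only [Function.update_idem, ne_eq, hkh.symm, not_false_eq_true,
            Function.update_of_ne, hth.symm, Function.update_self]
          omega
        · simp [hjt, hjk, hjh]
  · funext j
    by_cases hjt : j = t
    · subst hjt
      simp [htk]
    · by_cases hjk : j = k
      · subst hjk
        simp [hkh, htk.symm]
      · by_cases hjh : j = h
        · subst hjh
          simp [hjt, hjk, hh]
        · simp [hjt, hjk, hjh]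
  · funext j
    by_cases hjt : j = t
    · subst hjt
      simp [hth, ht]
    · by_cases hjk : j = k
      · subst hjk
        simp [hkh, hjt]
      · simp [hjt, Function.update_apply]

/-- Perform `A` with the head `h` at the positions below the position of the head `k`. -/
def forBelow (t k h : Fin H) (A : Fragment H) : Fragment H := (copy t k h).seq (down h A)

theorem runs_forBelow {t k h : Fin H} (htk : t ≠ k) (hth : t ≠ h) (hkh : k ≠ h) {m : ℕ}
    {R : ℕ → Fin H → ℕ} (ht : R m t = 0) (hk : R m k = m) (hh : ∀ c ≤ m, R c h = 0)
    {out : ℕ → List DescSym}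
    (hA : ∀ c < m, A.Runs n (Function.update (R (c + 1)) h c) (Function.update (R c) h c) (out c)) :
    (forBelow t k h A).Runs n (R m) (R 0) ((countdown m).flatMap out) := by
  refine (Runs.seq (runs_copy htk hth hkh ht (hh m le_rfl)) (o' := (countdown m).flatMap out)
    ((runs_down (m := m) (R := fun c => Function.update (R c) h c) (by simp) fun c hc =>
      (hA c hc).congr (by simp) rfl rfl).congr ?_ ?_ rfl)).congr rfl rfl (List.nil_append _)
  · simp [hk]
  · exact Function.update_eq_iff.2 ⟨(hh 0 (Nat.zero_le m)).symm, fun _ _ => rfl⟩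

/-- Move the head `h` to the right end marker. -/
def fill (h : Fin H) : Fragment H := loop h notFull (inc h)

theorem runs_fill {h : Fin H} : (fill h).Runs n ρ (Function.update ρ h (n + 1)) [] := by
  intro hρ
  -- Induction on the distance to the right end marker.
  obtain ⟨i, hi⟩ : ∃ i, i = n + 1 - ρ h := ⟨_, rfl⟩
  induction i generalizing ρ with
  | zero =>
    have : ρ h = n + 1 := by have := hρ h; omega
    refine (runs_loop_exit ?_).congr rfl ?_ rfl hρ
    · rw [← Bool.not_eq_true, notFull_scan]
      omega
    · rw [← this, Function.update_eq_self]
  | succ i ih =>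
    refine (runs_loop_step (o := []) (o' := []) ?_ (runs_inc h) fun h' => ih h' ?_).congr rfl ?_ rfl
      hρ
    · rw [notFull_scan]
      omega
    · rw [Function.update_self]
      omega
    · simp

/-- Write the position of the head `h` as a number. -/
def emitHead (t h : Fin H) : Fragment H :=
  (down h ((inc t).seq (emit [.tick]))).seq ((down t (inc h)).seq (emit [.numEnd]))

theorem runs_emitHead {t h : Fin H} (hth : t ≠ h) (ht : ρ t = 0) :
    (emitHead t h).Runs n ρ ρ (describeNum (ρ h)) := by
  intro hρ
  have hh := hρ h
  have h1 : (down h ((inc t).seq (emit [.tick]))).Runs n ρ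
      (Function.update (Function.update ρ t (ρ h)) h 0) (List.replicate (ρ h) .tick) := by
    refine (runs_down (R := fun i => Function.update (Function.update ρ t (ρ h - i)) h i)
      (out := fun _ => [.tick]) (m := ρ h) (fun i _ => by simp) fun i hi =>
        ((runs_inc t).seq (runs_emit _)).congr rfl ?_ rfl).congr ?_ ?_ ?_
    · funext j
      by_cases hj : j = t
      · subst hj
        simp only [Function.update_self, Function.update_idem, ne_eq, hth, not_false_eq_true,
          Function.update_of_ne]
        omega
      · by_cases hj' : j = h
        · subst hj'
          simp [hj]
        · simp [hj, hj']
    · rw [Nat.sub_self, ← ht, Function.update_eq_self, Function.update_eq_self]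
    · simp
    · generalize ρ h = k
      induction k with
      | zero => rfl
      | succ k ih =>
        rw [countdown_succ, List.flatMap_cons, ih, List.replicate_succ]
        rfl
  refine (h1.seq (((runs_down_inc hth (by simp) ?_).seq (runs_emit _)))).congr rfl ?_ rfl hρ
  · simp only [ne_eq, hth, not_false_eq_true, Function.update_of_ne, Function.update_self]
    exact hh
  · funext j
    by_cases hj : j = t
    · subst hj
      simp [ht]
    · by_cases hj' : j = h
      · subst hj'
        simp [hj, hth]
      · simp [hj, hj']

/-- The machine that consists of one fragment. -/
def toTransducer (A : Fragment H) : Transducer DescSym where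
  State := Option A.State
  Cell := Unit
  finite_state := by
    have := A.finite_state
    infer_instance
  finite_cell := inferInstance
  numHeads := H
  numTapes := 0
  start := some A.start
  blank := ()
  next
    | none, _, _ => none
    | some s, c, _ => some ((A.next s c).1, (A.next s c).2.1, fun k => k.elim0, (A.next s c).2.2)

theorem step_toTransducer (A : Fragment H) {s : A.State} {s' : Option A.State} {mv : Fin H → Move}
    (h : A.next s (scan n ρ) = (s', mv, o)) (T : Fin 0 → ℕ → Unit) (W : Fin 0 → ℕ)
    (out : List DescSym) :
    A.toTransducer.step (List.replicate n true) ⟨some s, ρ, T, W, out⟩ =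
      some ⟨s', moveHeads n mv ρ, T, W, out ++ o⟩ := by
  have h' : A.next s (fun h => readInput (List.replicate n true) (ρ h)) = (s', mv, o) := h
  simp only [Transducer.step, toTransducer, h', Option.map_some, List.length_replicate]
  congr 2
  funext k
  exact k.elim0

theorem Exec.reflTransGen {s : A.State} (h : A.Exec n s ρ ρ' o) (T : Fin 0 → ℕ → Unit)
    (W : Fin 0 → ℕ) (out : List DescSym) :
    Relation.ReflTransGen
      (fun a b => A.toTransducer.step (List.replicate n true) a = some b)
      ⟨some s, ρ, T, W, out⟩ ⟨none, ρ', T, W, out ++ o⟩ := by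
  induction h generalizing out with
  | exit h => exact .single (step_toTransducer A h T W out)
  | step h _ ih =>
    rw [← List.append_assoc]
    exact .head (step_toTransducer A h T W out) (ih _)

/-- Without work tapes the space condition is vacuous. -/
theorem Runs.outputsInSpace (h : A.Runs n (fun _ => 0) ρ' o) (s : ℕ) :
    A.toTransducer.OutputsInSpace (List.replicate n true) s o := by
  refine ⟨fun c _ k => k.elim0, ⟨none, ρ', fun _ _ => (), fun _ => 0, o⟩, ?_, rfl, rfl⟩
  exact (h fun _ => Nat.zero_le _).2.reflTransGen (fun _ _ => ()) (fun _ => 0) []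

end Fragment

end Machines

/-! ### A machine that describes the circuits -/

section Description

variable {S : Signature}

/-- A constant, or the position of a head. -/
inductive Operand (H : ℕ) where
  | const (c : ℕ)
  | head (h : Fin H)

namespace Operand

variable {H : ℕ}

def value (ρ : Fin H → ℕ) : Operand H → ℕ
  | .const c => c
  | .head h => ρ h

/-- The operand is not the position of a head in `I`. -/
def Avoids (I : Set (Fin H)) : Operand H → Prop
  | .const _ => True
  | .head h => h ∉ I

theorem value_const (ρ : Fin H → ℕ) (c : ℕ) : (const c).value ρ = c := rfl

theorem value_head (ρ : Fin H → ℕ) (h : Fin H) : (head h).value ρ = ρ h := rfl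

theorem Avoids.mono {I J : Set (Fin H)} (hIJ : J ⊆ I) {o : Operand H} (h : o.Avoids I) :
    o.Avoids J := by
  cases o with
  | const c => trivial
  | head k => exact fun hk => h (hIJ hk)

theorem value_update {I : Set (Fin H)} {o : Operand H} (ho : o.Avoids I) {h : Fin H} (hh : h ∈ I)
    (ρ : Fin H → ℕ) (c : ℕ) : o.value (Function.update ρ h c) = o.value ρ := by
  cases o with
  | const c => rfl
  | head k =>
    refine Function.update_of_ne ?_ _ _
    rintro rfl
    exact ho hh

theorem map_value_update {I : Set (Fin H)} {L : List (Operand H)} (hL : ∀ o ∈ L, o.Avoids I)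
    {h : Fin H} (hh : h ∈ I) (ρ : Fin H → ℕ) (c : ℕ) :
    L.map (value (Function.update ρ h c)) = L.map (value ρ) :=
  List.map_congr_left fun o ho => value_update (hL o ho) hh ρ c

theorem map_value_concat (ρ : Fin H → ℕ) (L : List (Operand H)) (o : Operand H) :
    (L ++ [o]).map (value ρ) = L.map (value ρ) ++ [o.value ρ] := by simp

theorem avoids_concat {I : Set (Fin H)} {L : List (Operand H)} (hL : ∀ o ∈ L, o.Avoids I)
    {o : Operand H} (ho : o.Avoids I) : ∀ o' ∈ L ++ [o], o'.Avoids I := by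
  simpa [or_imp, forall_and] using And.intro hL ho

end Operand

def describeGates (gs : List (Label × Gate)) : List DescSym :=
  gs.flatMap fun g => describeLabel g.1 ++ describeGate g.2 ++ [.gateEnd]

theorem describeGates_append (gs gs' : List (Label × Gate)) :
    describeGates (gs ++ gs') = describeGates gs ++ describeGates gs' := List.flatMap_append

theorem describeGates_flatMap {l : List ℕ} (F : ℕ → List (Label × Gate)) :
    describeGates (l.flatMap F) = l.flatMap fun c => describeGates (F c) := List.flatMap_assoc

theorem describeGates_singleton (L : Label) (g : Gate) :
    describeGates [(L, g)] = describeLabel L ++ describeGate g ++ [.gateEnd] := by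
  simp [describeGates]

namespace Fragment

section Emission

variable {H n : ℕ} {ρ : Fin H → ℕ} {t : Fin H}

def emitOperand (t : Fin H) : Operand H → Fragment H
  | .const c => emit (describeNum c)
  | .head h => emitHead t h

theorem runs_emitOperand (ht : ρ t = 0) {o : Operand H} (ho : o.Avoids {t}) :
    (emitOperand t o).Runs n ρ ρ (describeNum (o.value ρ)) := by
  cases o with
  | const c => exact runs_emit _
  | head h => exact runs_emitHead (fun he => ho he.symm) ht

def emitName (t : Fin H) : List (Operand H) → Fragment H
  | [] => emit [.labelEnd]
  | o :: L => (emitOperand t o).seq (emitName t L)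

theorem runs_emitName (ht : ρ t = 0) {L : List (Operand H)} (hL : ∀ o ∈ L, o.Avoids {t}) :
    (emitName t L).Runs n ρ ρ (describeLabel (L.map (Operand.value ρ))) := by
  induction L with
  | nil => exact runs_emit _
  | cons o L ih =>
    exact ((runs_emitOperand ht (hL o (by simp))).seq (ih fun o ho => hL o (by simp [ho]))).congr
      rfl rfl (by simp [describeLabel])

/-- Write the description of a gate named `L`; the fragment `A` writes the gates that it uses. -/
def emitGate (t : Fin H) (L : List (Operand H)) (s : DescSym) (A : Fragment H) : Fragment H :=
  (emitName t L).seq ((emit [s]).seq (A.seq (emit [.gateEnd])))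

theorem runs_emitGate (ht : ρ t = 0) {L : List (Operand H)} (hL : ∀ o ∈ L, o.Avoids {t})
    {s : DescSym} {A : Fragment H} {out : List DescSym} (hA : A.Runs n ρ ρ out) {g : Gate}
    (hg : describeGate g = s :: out) : (emitGate t L s A).Runs n ρ ρ
      (describeGates [(L.map (Operand.value ρ), g)]) :=
  ((runs_emitName ht hL).seq ((runs_emit _).seq (hA.seq (runs_emit _)))).congr rfl rfl
    (by simp [describeGates_singleton, hg])

theorem runs_emitGate_conj (ht : ρ t = 0) {L : List (Operand H)} (hL : ∀ o ∈ L, o.Avoids {t})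
    {A : Fragment H} {as : List Label} (hA : A.Runs n ρ ρ (as.flatMap describeLabel)) :
    (emitGate t L .conj A).Runs n ρ ρ (describeGates [(L.map (Operand.value ρ), .and as)]) :=
  runs_emitGate ht hL hA rfl

theorem runs_emitGate_disj (ht : ρ t = 0) {L : List (Operand H)} (hL : ∀ o ∈ L, o.Avoids {t})
    {A : Fragment H} {as : List Label} (hA : A.Runs n ρ ρ (as.flatMap describeLabel)) :
    (emitGate t L .disj A).Runs n ρ ρ (describeGates [(L.map (Operand.value ρ), .or as)]) :=
  runs_emitGate ht hL hA rfl

end Emission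

/-! ### Allocation of the heads -/

variable {N n m : ℕ} {ρ : Fin (N + 3) → ℕ}

/-- A head that is used in loops to restore the positions of other heads. -/
def tmpHead : Fin (N + 3) := ⟨0, by omega⟩

/-- A head that stores the number of constants. -/
def sizeHead : Fin (N + 3) := ⟨1, by omega⟩

/-- A head that counts positions of the input. -/
def countHead : Fin (N + 3) := ⟨2, by omega⟩

/-- The head that stores the value of the `k`-th variable. -/
def varHead (k : ℕ) : Fin (N + 3) := if h : k < N then ⟨k + 3, by omega⟩ else tmpHead

theorem varHead_val {k : ℕ} (hk : k < N) : (varHead k : Fin (N + 3)).val = k + 3 := by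
  simp [varHead, hk]

theorem tmpHead_ne_sizeHead : (tmpHead : Fin (N + 3)) ≠ sizeHead := by
  simp [tmpHead, sizeHead]

theorem tmpHead_ne_countHead : (tmpHead : Fin (N + 3)) ≠ countHead := by
  simp [tmpHead, countHead]

theorem sizeHead_ne_countHead : (sizeHead : Fin (N + 3)) ≠ countHead := by
  simp [sizeHead, countHead]

theorem tmpHead_ne_varHead {k : ℕ} (hk : k < N) : (tmpHead : Fin (N + 3)) ≠ varHead k := by
  simp [Fin.ext_iff, tmpHead, varHead_val hk]

theorem sizeHead_ne_varHead {k : ℕ} (hk : k < N) : (sizeHead : Fin (N + 3)) ≠ varHead k := by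
  simp [Fin.ext_iff, sizeHead, varHead_val hk]

theorem countHead_ne_varHead {k : ℕ} (hk : k < N) : (countHead : Fin (N + 3)) ≠ varHead k := by
  simp [Fin.ext_iff, countHead, varHead_val hk]

theorem varHead_ne_varHead {j k : ℕ} (hj : j < N) (hk : k < N) (h : j ≠ k) :
    (varHead j : Fin (N + 3)) ≠ varHead k := by
  simpa [Fin.ext_iff, varHead_val hj, varHead_val hk] using h

/-- A loop over the values of the `k`-th variable. -/
def forVar (k : ℕ) (A : Fragment (N + 3)) : Fragment (N + 3) :=
  forBelow tmpHead sizeHead (varHead k) A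

theorem runs_forVar {k : ℕ} (hk : k < N) (htmp : ρ tmpHead = 0) (hsize : ρ sizeHead = m)
    (hvar : ρ (varHead k) = 0) {A : Fragment (N + 3)} {out : ℕ → List DescSym}
    (hA : ∀ c < m, A.Runs n (Function.update ρ (varHead k) c) (Function.update ρ (varHead k) c)
      (out c)) : (forVar k A).Runs n ρ ρ ((countdown m).flatMap out) :=
  runs_forBelow (R := fun _ => ρ) tmpHead_ne_sizeHead (tmpHead_ne_varHead hk)
    (sizeHead_ne_varHead hk) htmp hsize (fun _ _ => hvar) hA

/-- A loop over the values of the `k`-th variable that changes the counter. -/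
theorem runs_forVar_count {k : ℕ} (hk : k < N) (htmp : ρ tmpHead = 0) (hsize : ρ sizeHead = m)
    (hvar : ρ (varHead k) = 0) {A : Fragment (N + 3)} {out : ℕ → List DescSym} {f : ℕ → ℕ}
    (hA : ∀ c < m, A.Runs n (Function.update (Function.update ρ (varHead k) c) countHead (f (c + 1)))
      (Function.update (Function.update ρ (varHead k) c) countHead (f c)) (out c)) :
    (forVar k A).Runs n (Function.update ρ countHead (f m)) (Function.update ρ countHead (f 0))
      ((countdown m).flatMap out) := by
  have hne := countHead_ne_varHead hk
  refine runs_forBelow (R := fun c => Function.update ρ countHead (f c)) tmpHead_ne_sizeHead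
    (tmpHead_ne_varHead hk) (sizeHead_ne_varHead hk) ?_ ?_ (fun c _ => ?_) fun c hc =>
      (hA c hc).congr (Function.update_comm hne.symm _ _ _) (Function.update_comm hne.symm _ _ _) rfl
  · rw [Function.update_of_ne tmpHead_ne_countHead, htmp]
  · rw [Function.update_of_ne sizeHead_ne_countHead, hsize]
  · rw [Function.update_of_ne hne.symm, hvar]

/-! #### Formulas -/

/-- The heads that are not in use when `d` variables have values. -/
def idleFrom (d : ℕ) : Set (Fin (N + 3)) := {h | h = tmpHead ∨ d + 3 ≤ h.val}

theorem tmpHead_mem_idleFrom {d : ℕ} : (tmpHead : Fin (N + 3)) ∈ idleFrom d := Or.inl rfl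

theorem varHead_mem_idleFrom {d k : ℕ} (hdk : d ≤ k) (hk : k < N) :
    (varHead k : Fin (N + 3)) ∈ idleFrom d := by
  refine Or.inr ?_
  rw [varHead_val hk]
  omega

theorem idleFrom_succ_subset {d : ℕ} : (idleFrom (d + 1) : Set (Fin (N + 3))) ⊆ idleFrom d := by
  rintro h (hh | hh)
  · exact Or.inl hh
  · exact Or.inr (by omega)

theorem varHead_notMem_idleFrom {d : ℕ} (hd : d < N) :
    (varHead d : Fin (N + 3)) ∉ idleFrom (d + 1) := by
  rintro (h | h)
  · exact tmpHead_ne_varHead hd h.symm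
  · rw [varHead_val hd] at h
    omega

def operandOf (e : ℕ → Operand (N + 3)) : Term → Operand (N + 3)
  | .var x => e x
  | .const c => .const c

theorem value_operandOf (e : ℕ → Operand (N + 3)) (t : Term) :
    (operandOf e t).value ρ = t.eval fun x => (e x).value ρ := by
  cases t <;> rfl

theorem avoids_operandOf {I : Set (Fin (N + 3))} {e : ℕ → Operand (N + 3)}
    (he : ∀ x, (e x).Avoids I) (t : Term) : (operandOf e t).Avoids I := by
  cases t with
  | var x => exact he x
  | const c => trivial

/-- Writes the gate for an equation. -/
def eqFragment (e : ℕ → Operand (N + 3)) (L : List (Operand (N + 3))) :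
    Term → Term → Fragment (N + 3)
  | .const c, .const d => if c = d then emitGate tmpHead L .conj (emit [])
    else emitGate tmpHead L .disj (emit [])
  | s, t => emitGate tmpHead L .disj
    (emitName tmpHead [.head sizeHead, .const 1, operandOf e s, operandOf e t])

/-- Writes the gates for a formula in the scope of `d` quantifiers. -/
def ofFormula : FO S → ℕ → (ℕ → Operand (N + 3)) → List (Operand (N + 3)) → Fragment (N + 3)
  | .top, _, _, L => emitGate tmpHead L .conj (emit [])
  | .bot, _, _, L => emitGate tmpHead L .disj (emit [])
  | .atom α, _, e, L => emitGate tmpHead L .disj (emitName tmpHead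
      (.head sizeHead :: .const 0 :: .const α.pred :: List.ofFn fun i => operandOf e (α.args i)))
  | .eq s t, _, e, L => eqFragment e L s t
  | .neg φ, d, e, L => (ofFormula φ d e (L ++ [.const 0])).seq
      (emitGate tmpHead L .neg (emitName tmpHead (L ++ [.const 0])))
  | .and φ ψ, d, e, L => ((ofFormula φ d e (L ++ [.const 0])).seq
      (ofFormula ψ d e (L ++ [.const 1]))).seq (emitGate tmpHead L .conj
        ((emitName tmpHead (L ++ [.const 0])).seq (emitName tmpHead (L ++ [.const 1]))))
  | .or φ ψ, d, e, L => ((ofFormula φ d e (L ++ [.const 0])).seq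
      (ofFormula ψ d e (L ++ [.const 1]))).seq (emitGate tmpHead L .disj
        ((emitName tmpHead (L ++ [.const 0])).seq (emitName tmpHead (L ++ [.const 1]))))
  | .ex x φ, d, e, L => (forVar d (ofFormula φ (d + 1) (Function.update e x (.head (varHead d)))
      (L ++ [.head (varHead d)]))).seq
        (emitGate tmpHead L .disj (forVar d (emitName tmpHead (L ++ [.head (varHead d)]))))
  | .all x φ, d, e, L => (forVar d (ofFormula φ (d + 1) (Function.update e x (.head (varHead d)))
      (L ++ [.head (varHead d)]))).seq
        (emitGate tmpHead L .conj (forVar d (emitName tmpHead (L ++ [.head (varHead d)]))))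

theorem runs_eqFragment (htmp : ρ tmpHead = 0) (hsize : ρ sizeHead = m)
    {e : ℕ → Operand (N + 3)} (he : ∀ x, (e x).Avoids {tmpHead}) {L : List (Operand (N + 3))}
    (hL : ∀ o ∈ L, o.Avoids {tmpHead}) (s t : Term) :
    (eqFragment e L s t).Runs n ρ ρ (describeGates
      [(L.map (Operand.value ρ), eqGate m (fun x => (e x).value ρ) s t)]) := by
  have key : (emitGate tmpHead L .disj (emitName tmpHead
      [.head sizeHead, .const 1, operandOf e s, operandOf e t])).Runs n ρ ρ (describeGates
        [(L.map (Operand.value ρ), .or [[m, 1, s.eval fun x => (e x).value ρ,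
          t.eval fun x => (e x).value ρ]])]) := by
    refine runs_emitGate htmp hL (runs_emitName htmp ?_) ?_
    · simp only [List.mem_cons, List.not_mem_nil, or_false]
      rintro o (rfl | rfl | rfl | rfl)
      · exact tmpHead_ne_sizeHead.symm
      · trivial
      · exact avoids_operandOf he _
      · exact avoids_operandOf he _
    · simp [describeGate, value_operandOf, Operand.value_const, Operand.value_head, hsize]
  cases s with
  | var x => exact key
  | const c =>
    cases t with
    | var y => exact key
    | const d =>
      simp only [eqFragment, eqGate]
      split_ifs
      · exact runs_emitGate htmp hL (runs_emit []) rfl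
      · exact runs_emitGate htmp hL (runs_emit []) rfl

/-- The `d` enclosing quantifiers occupy the first `d` variable heads, and `e` and `L` refer to
values and name components held there. Since they avoid the idle heads, inner loops do not disturb
them, and all positions are restored at the end. -/
theorem runs_ofFormula {φ : FO S} {d : ℕ} (hd : d + φ.height ≤ N) (htmp : ρ tmpHead = 0)
    (hsize : ρ sizeHead = m) (hvar : ∀ k, d ≤ k → k < N → ρ (varHead k) = 0)
    {e : ℕ → Operand (N + 3)} (he : ∀ x, (e x).Avoids (idleFrom d)) {L : List (Operand (N + 3))}
    (hL : ∀ o ∈ L, o.Avoids (idleFrom d)) :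
    (ofFormula φ d e L).Runs n ρ ρ
      (describeGates (φ.gates m (fun x => (e x).value ρ) (L.map (Operand.value ρ)))) := by
  have htmpI : ∀ d, ({tmpHead} : Set (Fin (N + 3))) ⊆ idleFrom d := fun d =>
    Set.singleton_subset_iff.2 tmpHead_mem_idleFrom
  induction φ generalizing d e L ρ with
  | top | bot =>
    exact runs_emitGate htmp (fun o ho => (hL o ho).mono (htmpI d)) (runs_emit []) rfl
  | atom α =>
    refine runs_emitGate htmp (fun o ho => (hL o ho).mono (htmpI d)) (runs_emitName htmp ?_) ?_
    · intro o ho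
      simp only [List.mem_cons] at ho
      rcases ho with rfl | rfl | rfl | ho
      · exact tmpHead_ne_sizeHead.symm
      · trivial
      · trivial
      · obtain ⟨i, rfl⟩ := List.mem_ofFn.1 ho
        exact avoids_operandOf (fun x => (he x).mono (htmpI d)) _
    · simp [describeGate, Operand.value_const, Operand.value_head, hsize, List.map_ofFn,
        Function.comp_def, value_operandOf]
  | eq s t =>
    exact runs_eqFragment htmp hsize (fun x => (he x).mono (htmpI d))
      (fun o ho => (hL o ho).mono (htmpI d)) s t
  | neg φ ih =>
    simp only [FO.height] at hd
    have hL0 := Operand.avoids_concat hL (o := .const 0) trivial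
    refine ((ih (by omega) htmp hsize hvar he hL0).seq (runs_emitGate
      (g := .not (L.map (Operand.value ρ) ++ [0])) htmp (fun o ho => (hL o ho).mono (htmpI d))
      (runs_emitName htmp fun o ho => (hL0 o ho).mono (htmpI d)) ?_)).congr rfl rfl ?_
    · rw [Operand.map_value_concat]
      rfl
    · rw [FO.gates, describeGates_append, Operand.map_value_concat, Operand.value_const]
  | and φ ψ ih₁ ih₂ | or φ ψ ih₁ ih₂ =>
    simp only [FO.height] at hd
    have hL0 := Operand.avoids_concat hL (o := .const 0) trivial
    have hL1 := Operand.avoids_concat hL (o := .const 1) trivial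
    have hnames := (runs_emitName (n := n) htmp fun o ho => (hL0 o ho).mono (htmpI d)).seq
      (runs_emitName htmp fun o ho => (hL1 o ho).mono (htmpI d))
    rw [Operand.map_value_concat, Operand.map_value_concat] at hnames
    have hdesc : ∀ a b : Label, describeLabel a ++ describeLabel b =
        [a, b].flatMap describeLabel := by simp
    rw [hdesc] at hnames
    have hsub := (ih₁ (by omega) htmp hsize hvar he hL0).seq
      (ih₂ (by omega) htmp hsize hvar he hL1)
    rw [Operand.map_value_concat, Operand.map_value_concat] at hsub
    rw [FO.gates, describeGates_append, describeGates_append]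
    first
    | exact hsub.seq (runs_emitGate_conj htmp (fun o ho => (hL o ho).mono (htmpI d)) hnames)
    | exact hsub.seq (runs_emitGate_disj htmp (fun o ho => (hL o ho).mono (htmpI d)) hnames)
  | ex x φ ih | all x φ ih =>
    simp only [FO.height] at hd
    have hdN : d < N := by omega
    have hidle := varHead_mem_idleFrom (N := N) le_rfl hdN
    have hnot := varHead_notMem_idleFrom hdN
    have hmap : ∀ c, (L ++ [Operand.head (varHead d)]).map
        (Operand.value (Function.update ρ (varHead d) c)) = L.map (Operand.value ρ) ++ [c] := by
      intro c
      rw [Operand.map_value_concat, Operand.map_value_update hL hidle, Operand.value_head,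
        Function.update_self]
    have hL' : ∀ o ∈ L ++ [.head (varHead d)], o.Avoids (idleFrom (d + 1)) :=
      Operand.avoids_concat (fun o ho => (hL o ho).mono idleFrom_succ_subset) hnot
    have htmp' : ∀ c, Function.update ρ (varHead d) c tmpHead = 0 := fun c => by
      rw [Function.update_of_ne (tmpHead_ne_varHead hdN), htmp]
    have hbody : ∀ c < m, (ofFormula φ (d + 1) (Function.update e x (.head (varHead d)))
        (L ++ [.head (varHead d)])).Runs n (Function.update ρ (varHead d) c)
        (Function.update ρ (varHead d) c) (describeGates (φ.gates m
          (Function.update (fun x => (e x).value ρ) x c) (L.map (Operand.value ρ) ++ [c]))) := by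
      intro c _
      refine (ih (ρ := Function.update ρ (varHead d) c) (by omega) (htmp' c) ?_ ?_ ?_ hL').congr
        rfl rfl ?_
      · rw [Function.update_of_ne (sizeHead_ne_varHead hdN), hsize]
      · intro k hk hkN
        rw [Function.update_of_ne (varHead_ne_varHead hkN hdN (by omega)), hvar k (by omega) hkN]
      · intro y
        by_cases hy : y = x
        · subst hy
          rw [Function.update_self]
          exact hnot
        · rw [Function.update_of_ne hy]
          exact (he y).mono idleFrom_succ_subset
      · rw [hmap]
        congr 2
        funext y
        by_cases hy : y = x
        · subst hy
          simp [Operand.value_head]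
        · simp only [ne_eq, hy, not_false_eq_true, Function.update_of_ne]
          exact Operand.value_update (he y) hidle _ _
    have hnames : (forVar d (emitName tmpHead (L ++ [.head (varHead d)]))).Runs n ρ ρ
        (((countdown m).map fun c => L.map (Operand.value ρ) ++ [c]).flatMap describeLabel) := by
      rw [List.flatMap_map]
      exact runs_forVar hdN htmp hsize (hvar d le_rfl hdN) fun c _ =>
        (runs_emitName (htmp' c) fun o ho => (hL' o ho).mono (htmpI _)).congr rfl rfl
          (by rw [hmap])
    have hsub := runs_forVar hdN htmp hsize (hvar d le_rfl hdN) hbody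
    rw [FO.gates, describeGates_append, describeGates_flatMap]
    first
    | exact hsub.seq (runs_emitGate_conj htmp (fun o ho => (hL o ho).mono (htmpI d)) hnames)
    | exact hsub.seq (runs_emitGate_disj htmp (fun o ho => (hL o ho).mono (htmpI d)) hnames)

/-! #### Input gates -/

/-- Writes the input gates for the ground atoms whose last arguments are `as`. -/
def tupleFragment (L : List (Operand (N + 3))) : ℕ → List (Operand (N + 3)) → Fragment (N + 3)
  | 0, as => (dec countHead).seq
      (emitGate tmpHead (L ++ as) .inp (emitHead tmpHead countHead))
  | j + 1, as => forVar j (tupleFragment L j (.head (varHead j) :: as))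

/-- The heads that are not in use, or change, when all variables from the `j`-th one on have
values. -/
def idleBelow (j : ℕ) : Set (Fin (N + 3)) :=
  {h | h = tmpHead ∨ h = countHead ∨ 3 ≤ h.val ∧ h.val < j + 3}

/-- No arithmetic is needed for the bit positions: they are met in descending order without gaps, so
one decrement before each gate keeps the counter right. The `m ^ j` completions of the chosen digits
take up exactly the interval crossed. -/
theorem runs_tupleFragment {L as : List (Operand (N + 3))} {j off b : ℕ} (hj : j ≤ N)
    (htmp : ρ tmpHead = 0) (hsize : ρ sizeHead = m) (hvar : ∀ k < j, ρ (varHead k) = 0)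
    (hL : ∀ o ∈ L, o.Avoids (idleBelow j)) (has : ∀ o ∈ as, o.Avoids (idleBelow j)) :
    (tupleFragment L j as).Runs n (Function.update ρ countHead (off + (b + 1) * m ^ j))
      (Function.update ρ countHead (off + b * m ^ j))
      (describeGates (tupleGates (L.map (Operand.value ρ)) m off j
        (as.map (Operand.value ρ)) b)) := by
  induction j generalizing ρ as b with
  | zero =>
    have hLas : ∀ o ∈ L ++ as, o.Avoids (idleBelow 0) := fun o ho =>
      (List.mem_append.1 ho).elim (hL o) (has o)
    have htmp' : Function.update ρ countHead (off + b) tmpHead = 0 := by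
      rw [Function.update_of_ne tmpHead_ne_countHead, htmp]
    have h1 := (runs_emitHead (n := n) (ρ := Function.update ρ countHead (off + b))
      tmpHead_ne_countHead htmp')
    rw [Function.update_self] at h1
    refine (((runs_dec countHead).congr rfl ?_ rfl).seq (runs_emitGate (g := .input (off + b)) htmp'
      (fun o ho => (hLas o ho).mono ?_) h1 rfl)).congr rfl ?_ ?_
    · simp only [pow_zero, mul_one, Function.update_self, Function.update_idem]
      rfl
    · exact Set.singleton_subset_iff.2 (Or.inl rfl)
    · simp
    · rw [List.nil_append, Operand.map_value_update hLas (Or.inr (Or.inl rfl)), List.map_append]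
      rfl
  | succ j ih =>
    have hjN : j < N := hj
    have hsub : (idleBelow j : Set (Fin (N + 3))) ⊆ idleBelow (j + 1) := by
      rintro h (hh | hh | hh)
      · exact Or.inl hh
      · exact Or.inr (Or.inl hh)
      · exact Or.inr (Or.inr ⟨hh.1, by omega⟩)
    have hmem : (varHead j : Fin (N + 3)) ∈ idleBelow (j + 1) :=
      Or.inr (Or.inr (by rw [varHead_val hjN]; omega))
    have hnot : (varHead j : Fin (N + 3)) ∉ idleBelow j := by
      rintro (h | h | h)
      · exact tmpHead_ne_varHead hjN h.symm
      · exact countHead_ne_varHead hjN h.symm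
      · rw [varHead_val hjN] at h
        omega
    refine (runs_forVar_count (f := fun c => off + (b * m + c) * m ^ j)
      (out := fun c => describeGates (tupleGates (L.map (Operand.value ρ)) m off j
        (c :: as.map (Operand.value ρ)) (b * m + c))) hjN htmp hsize (hvar j (by omega))
      fun c _ => ?_).congr ?_ ?_ ?_
    · refine (ih (ρ := Function.update ρ (varHead j) c) (b := b * m + c)
        (as := .head (varHead j) :: as) (by omega) ?_ ?_ ?_ ?_ ?_).congr ?_ rfl ?_
      · rw [Function.update_of_ne (tmpHead_ne_varHead hjN), htmp]
      · rw [Function.update_of_ne (sizeHead_ne_varHead hjN), hsize]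
      · intro k hk
        rw [Function.update_of_ne (varHead_ne_varHead (by omega) hjN (by omega)),
          hvar k (by omega)]
      · exact fun o ho => (hL o ho).mono hsub
      · intro o ho
        rcases List.mem_cons.1 ho with rfl | ho
        · exact hnot
        · exact (has o ho).mono hsub
      · rfl
      · rw [Operand.map_value_update hL hmem, List.map_cons, Operand.map_value_update has hmem]
        simp [Operand.value]
    · congr 2
      ring
    · congr 2
      ring
    · rw [tupleGates, describeGates_flatMap]

/-- Writes the input gates for the first `k` predicates. -/
def inputFragment (S : Signature) : ℕ → Fragment (N + 3)
  | 0 => emit []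
  | k + 1 => (tupleFragment [.head sizeHead, .const 0, .const k] (S.arityAt k) []).seq
      (inputFragment S k)

/-- Predicates are treated from the last to the first, so the counter left by one is the end of the
previous one's range. -/
theorem runs_inputFragment {k : ℕ} (hk : ∀ p < k, S.arityAt p ≤ N) (htmp : ρ tmpHead = 0)
    (hsize : ρ sizeHead = m) (hvar : ∀ k < N, ρ (varHead k) = 0) :
    (inputFragment S k).Runs n (Function.update ρ countHead (S.offset m k))
      (Function.update ρ countHead 0) (describeGates ((countdown k).flatMap fun p =>
        tupleGates [m, 0, p] m (S.offset m p) (S.arityAt p) [] 0)) := by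
  induction k with
  | zero => exact runs_emit []
  | succ k ih =>
    refine ((runs_tupleFragment (off := S.offset m k) (b := 0) (hk k (by omega)) htmp hsize
      (fun j hj => hvar j (hj.trans_le (hk k (by omega)))) ?_ (by simp)).seq
        ((ih fun p hp => hk p (by omega)).congr ?_ rfl rfl)).congr ?_ rfl ?_
    · simp only [List.mem_cons, List.not_mem_nil, or_false]
      rintro o (rfl | rfl | rfl)
      · rintro (h | h | h)
        · exact tmpHead_ne_sizeHead h.symm
        · exact sizeHead_ne_countHead h
        · simp [sizeHead] at h
      · trivial
      · trivial
    · simp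
    · rw [Signature.offset_succ, Nat.zero_add, Nat.one_mul]
    · rw [countdown_succ, List.flatMap_cons, describeGates_append]
      simp [Operand.value, hsize]

/-- Adds `m ^ j` to the counter. -/
def countTuples : ℕ → Fragment (N + 3)
  | 0 => inc countHead
  | j + 1 => forVar j (countTuples j)

/-- A head stops at the right end marker, so the counter saturates at `n + 1`. -/
theorem runs_countTuples {j x : ℕ} (hj : j ≤ N) (htmp : ρ tmpHead = 0) (hsize : ρ sizeHead = m)
    (hvar : ∀ k < j, ρ (varHead k) = 0) :
    (countTuples j).Runs n (Function.update ρ countHead (min x (n + 1)))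
      (Function.update ρ countHead (min (x + m ^ j) (n + 1))) [] := by
  induction j generalizing ρ x with
  | zero =>
    refine (runs_inc countHead).congr rfl ?_ rfl
    rw [Function.update_self, Function.update_idem]
    congr 1
    rw [pow_zero]
    omega
  | succ j ih =>
    have hjN : j < N := hj
    refine (runs_forVar_count (f := fun c => min (x + (m - c) * m ^ j) (n + 1))
      (out := fun _ => []) hjN htmp hsize (hvar j (by omega)) fun c hc => ?_).congr ?_ ?_ ?_
    · refine (ih (ρ := Function.update ρ (varHead j) c) (x := x + (m - (c + 1)) * m ^ j) (by omega)
        ?_ ?_ ?_).congr rfl ?_ rfl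
      · rw [Function.update_of_ne (tmpHead_ne_varHead hjN), htmp]
      · rw [Function.update_of_ne (sizeHead_ne_varHead hjN), hsize]
      · intro k hk
        rw [Function.update_of_ne (varHead_ne_varHead (by omega) hjN (by omega)),
          hvar k (by omega)]
      · rw [show m - c = m - (c + 1) + 1 by omega, Nat.succ_mul, Nat.add_assoc]
    · simp
    · simp [pow_succ']
    · simp

/-- Adds the number of bits that encode the first `k` relations to the counter. -/
def countBits (S : Signature) : ℕ → Fragment (N + 3)
  | 0 => emit []
  | k + 1 => (countBits S k).seq (countTuples (S.arityAt k))

theorem runs_countBits {k : ℕ} (hk : ∀ p < k, S.arityAt p ≤ N) (htmp : ρ tmpHead = 0)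
    (hsize : ρ sizeHead = m) (hvar : ∀ k < N, ρ (varHead k) = 0) (hcount : ρ countHead = 0) :
    (countBits S k).Runs n ρ
      (Function.update ρ countHead (min (S.offset m k) (n + 1))) [] := by
  induction k with
  | zero =>
    refine (runs_emit []).congr rfl ?_ rfl
    rw [Signature.offset, Finset.sum_range_zero, Nat.zero_min, ← hcount, Function.update_eq_self]
  | succ k ih =>
    rw [Signature.offset_succ]
    exact (ih fun p hp => hk p (by omega)).seq (runs_countTuples (hk k (by omega)) htmp hsize
      fun j hj => hvar j (hj.trans_le (hk k (by omega))))

/-! #### The complete machine -/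

/-- Writes the gates for true equations. -/
def eqsFragment : Fragment (N + 3) :=
  forVar 0 (emitGate tmpHead
    [.head sizeHead, .const 1, .head (varHead 0), .head (varHead 0)] .conj (emit []))

theorem runs_eqsFragment (hN : 0 < N) (htmp : ρ tmpHead = 0)
    (hsize : ρ sizeHead = m) (hvar : ∀ k < N, ρ (varHead k) = 0) :
    (eqsFragment : Fragment (N + 3)).Runs n ρ ρ (describeGates (eqGates m)) := by
  refine (runs_forVar (out := fun c => describeGates [([m, 1, c, c], .and [])]) hN htmp hsize
    (hvar 0 hN) fun c _ => (runs_emitGate ?_ ?_ (runs_emit []) (g := .and []) rfl).congr rfl rfl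
      ?_).congr rfl rfl ?_
  · rw [Function.update_of_ne (tmpHead_ne_varHead hN), htmp]
  · simp only [List.mem_cons, List.not_mem_nil, or_false]
    rintro o (rfl | rfl | rfl | rfl)
    · exact tmpHead_ne_sizeHead.symm
    · trivial
    · exact (tmpHead_ne_varHead hN).symm
    · exact (tmpHead_ne_varHead hN).symm
  · simp [Operand.value, Function.update_of_ne (sizeHead_ne_varHead hN), hsize]
  · simp [eqGates, describeGates, List.flatMap_map]

/-- Writes the part of the circuit for databases over `0, …, m - 1`. -/
def blockFragment (φ : FO S) : Fragment (N + 3) :=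
  (inputFragment S S.numPred).seq (eqsFragment.seq
    (ofFormula φ 0 (fun _ => .const 0) [.head sizeHead, .const 2]))

theorem runs_blockFragment {φ : FO S} (hS : ∀ p < S.numPred, S.arityAt p ≤ N)
    (hφ : φ.height ≤ N) (hN : 0 < N) (htmp : ρ tmpHead = 0) (hsize : ρ sizeHead = m)
    (hvar : ∀ k < N, ρ (varHead k) = 0) (hcount : ρ countHead = 0) :
    (blockFragment φ).Runs n (Function.update ρ countHead (S.offset m S.numPred)) ρ
      (describeGates (blockGates φ m)) := by
  have h1 := runs_inputFragment (n := n) hS htmp hsize hvar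
  rw [← hcount, Function.update_eq_self, hcount] at h1
  have h2 := runs_eqsFragment (n := n) hN htmp hsize hvar
  have h3 := runs_ofFormula (n := n) (φ := φ) (d := 0) (e := fun _ => .const 0)
    (L := [.head sizeHead, .const 2]) (by omega) htmp hsize (fun k _ hk => hvar k hk)
    (fun _ => trivial) (by
      simp only [List.mem_cons, List.not_mem_nil, or_false]
      rintro o (rfl | rfl)
      · rintro (h | h)
        · exact tmpHead_ne_sizeHead h.symm
        · simp [sizeHead] at h
      · trivial)
  refine (h1.seq (h2.seq h3)).congr rfl rfl ?_
  rw [blockGates, describeGates_append, describeGates_append, List.append_assoc, inputGates]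
  simp [Operand.value, hsize]

/-- Writes the part of the circuit for databases over `0, …, m - 1`, if they are encoded by as many
bits as the input has. -/
def checkedBlock (φ : FO S) : Fragment (N + 3) :=
  (countBits S S.numPred).seq ((ite countHead notFull ((inc countHead).seq
    (ite countHead notFull (emit []) ((dec countHead).seq (blockFragment φ)))) (emit [])).seq
      (down countHead (emit [])))

theorem runs_checkedBlock {φ : FO S} (hS : ∀ p < S.numPred, S.arityAt p ≤ N)
    (hφ : φ.height ≤ N) (hN : 0 < N) (htmp : ρ tmpHead = 0) (hsize : ρ sizeHead = m)
    (hvar : ∀ k < N, ρ (varHead k) = 0) (hcount : ρ countHead = 0) :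
    (checkedBlock φ).Runs n ρ ρ
      (describeGates (if S.offset m S.numPred = n then blockGates φ m else [])) := by
  have hreset : ∀ x, (down countHead (emit [])).Runs n (Function.update ρ countHead x) ρ [] := by
    intro x
    refine runs_reset.congr rfl ?_ rfl
    rw [Function.update_idem, ← hcount, Function.update_eq_self]
  have hreset' : (down countHead (emit [])).Runs n ρ ρ [] :=
    (hreset (ρ countHead)).congr (Function.update_eq_self _ _) rfl rfl
  have hcnt := runs_countBits (n := n) hS htmp hsize hvar hcount
  generalize hx : S.offset m S.numPred = x at hcnt
  -- The saturated counter still distinguishes the cases: `x = n` iff it is not full but full after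
  -- one increment. Undoing that increment leaves `x`, the start value for the input gates.
  rcases lt_trichotomy x n with hlt | heq | hgt
  · rw [if_neg hlt.ne]
    rw [min_eq_left (by omega)] at hcnt
    refine (hcnt.seq ((Runs.ite (o := []) (ρ' := Function.update ρ countHead (x + 1))
      (fun _ => (((runs_inc countHead).congr rfl ?_ rfl).seq
        (Runs.ite (o := []) (fun _ => runs_emit []) fun h => ?_)).congr rfl rfl rfl)
      fun h => ?_).seq (hreset _))).congr rfl rfl rfl
    · rw [Function.update_self, Function.update_idem, min_eq_left (by omega)]
    · rw [← Bool.not_eq_true, notFull_scan, Function.update_self] at h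
      omega
    · rw [← Bool.not_eq_true, notFull_scan, Function.update_self] at h
      omega
  · rw [if_pos heq]
    rw [min_eq_left (by omega)] at hcnt
    have hblock := runs_blockFragment (n := n) (φ := φ) hS hφ hN htmp hsize hvar hcount
    rw [hx] at hblock
    refine (hcnt.seq ((Runs.ite (o := describeGates (blockGates φ m)) (ρ' := ρ)
      (fun _ => (((runs_inc countHead).congr rfl (ρ' := _)
        (σ' := Function.update ρ countHead (x + 1)) ?_ rfl).seq
        (Runs.ite (o := describeGates (blockGates φ m)) (fun h => ?_) fun _ =>
          ((runs_dec countHead).seq (hblock.congr ?_ rfl rfl)).congr rfl rfl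
            (List.nil_append _))).congr rfl rfl (List.nil_append _))
      fun h => ?_).seq hreset')).congr rfl rfl (by simp)
    · rw [Function.update_self, Function.update_idem, min_eq_left (by omega)]
    · rw [notFull_scan, Function.update_self] at h
      omega
    · rw [Function.update_self, Function.update_idem, Nat.add_sub_cancel]
    · rw [← Bool.not_eq_true, notFull_scan, Function.update_self] at h
      omega
  · rw [if_neg hgt.ne']
    refine (hcnt.seq ((Runs.ite (o := []) (fun h => ?_) fun _ => runs_emit []).seq
      (hreset _))).congr rfl rfl rfl
    rw [notFull_scan, Function.update_self] at h
    omega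

/-- Writes the circuit for a sentence. -/
def ofSentence (φ : FO S) : Fragment (N + 3) :=
  (fill sizeHead).seq ((down sizeHead (checkedBlock φ)).seq
    ((emitGate tmpHead [] .disj ((fill sizeHead).seq
      (down sizeHead (emitName tmpHead [.head sizeHead, .const 2])))).seq (emit [.labelEnd])))

theorem runs_ofSentence {φ : FO S} (hS : ∀ p < S.numPred, S.arityAt p ≤ N)
    (hφ : φ.height ≤ N) (hN : 0 < N) :
    (ofSentence φ : Fragment (N + 3)).Runs n (fun _ => 0) (fun _ => 0)
      (foCircuit φ n).describe := by
  have hfill : ((fill sizeHead : Fragment (N + 3))).Runs n (fun _ => 0)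
      (Function.update (fun _ => 0) sizeHead (n + 1)) [] := runs_fill
  have hz : ∀ m, ∀ h ≠ sizeHead,
      Function.update (fun _ : Fin (N + 3) => 0) sizeHead m h = 0 := fun m h hh =>
    Function.update_of_ne hh _ _
  have hblocks : (down sizeHead (checkedBlock φ : Fragment (N + 3))).Runs n
      (Function.update (fun _ => 0) sizeHead (n + 1)) (fun _ => 0) (describeGates
        ((countdown (n + 1)).flatMap fun m =>
          if S.offset m S.numPred = n then blockGates φ m else [])) := by
    rw [describeGates_flatMap]
    refine (runs_down (R := fun m => Function.update (fun _ => 0) sizeHead m)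
      (fun m _ => by simp) fun m _ => (runs_checkedBlock (m := m)
        (ρ := Function.update (fun _ => 0) sizeHead m) hS hφ hN (hz m _ tmpHead_ne_sizeHead)
        (by simp) (fun k hk => hz m _ (sizeHead_ne_varHead hk).symm)
        (hz m _ sizeHead_ne_countHead.symm)).congr (by simp) rfl rfl).congr rfl (by simp) rfl
  have hnames : (down sizeHead (emitName tmpHead
      [.head sizeHead, .const 2] : Fragment (N + 3))).Runs n
      (Function.update (fun _ => 0) sizeHead (n + 1)) (fun _ => 0)
      ((countdown (n + 1)).flatMap fun m => describeLabel [m, 2]) := by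
    refine (runs_down (R := fun m => Function.update (fun _ => 0) sizeHead m)
      (fun m _ => by simp) fun m _ => (runs_emitName
        (ρ := Function.update (fun _ => 0) sizeHead m) (hz m _ tmpHead_ne_sizeHead)
        (L := [.head sizeHead, .const 2]) ?_).congr (by simp) rfl (by simp [Operand.value])).congr
          rfl (by simp) rfl
    simp only [List.mem_cons, List.not_mem_nil, or_false]
    rintro o (rfl | rfl)
    · exact tmpHead_ne_sizeHead.symm
    · trivial
  refine (hfill.seq (hblocks.seq ((runs_emitGate rfl (by simp) (hfill.seq hnames)
    (g := .or ((countdown (n + 1)).map fun m => [m, 2])) (by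
      rw [describeGate, List.flatMap_map]; rfl)).seq (runs_emit [.labelEnd])))).congr rfl rfl ?_
  rw [List.nil_append, ← List.append_assoc, List.map_nil, ← describeGates_append]
  rfl

end Fragment

theorem isLogspaceUniform_foCircuit (φ : FO S) : IsLogspaceUniform (foCircuit φ) := by
  refine ⟨(Fragment.ofSentence φ : Fragment
    -- Enough variable heads for the nested quantifiers, for the arguments of any predicate, and for
    -- the loop over equations; the other three heads are `tmpHead`, `sizeHead` and `countHead`.
    (φ.height + ∑ p : Fin S.numPred, S.arity p + 1 + 3)).toTransducer, 0, fun n => ?_⟩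
  refine (Fragment.runs_ofSentence (fun p hp => ?_) (by omega) (by omega)).outputsInSpace _
  have h : S.arityAt p = S.arity ⟨p, hp⟩ := dif_pos hp
  have := Finset.single_le_sum (f := fun q => S.arity q) (fun _ _ => Nat.zero_le _)
    (Finset.mem_univ (⟨p, hp⟩ : Fin S.numPred))
  rw [h]
  omega

end Description

/-! ### The encoding of databases -/

section Encoding

variable {S : Signature}

theorem digitsValue_ofFn (m : ℕ) {k : ℕ} (a : Fin k → ℕ) :
    digitsValue m (List.ofFn a) = ∑ i, a i * m ^ (i : ℕ) := by
  induction k with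
  | zero => simp [digitsValue]
  | succ k ih =>
    rw [List.ofFn_succ, digitsValue, ih, Fin.sum_univ_succ, Finset.sum_mul, Nat.add_comm]
    congr 1
    · simp
    · exact Finset.sum_congr rfl fun i _ => by rw [Fin.val_succ, pow_succ, mul_assoc]

/-- Links the equivalences behind `encodeDB` with the bit positions computed by the circuit, whose
first argument is the least significant digit. -/
theorem finSigmaFinEquiv_val (m : ℕ) (p : Fin S.numPred) (a : Fin (S.arity p) → Fin m) :
    (finSigmaFinEquiv (n := fun p => m ^ S.arity p) ⟨p, finFunctionFinEquiv a⟩ : ℕ) =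
      S.offset m p + digitsValue m (List.ofFn fun i => (a i : ℕ)) := by
  rw [finSigmaFinEquiv_apply, digitsValue_ofFn, finFunctionFinEquiv_apply, Signature.offset,
    Finset.sum_range]
  congr 1
  refine Finset.sum_congr rfl fun q _ => ?_
  rw [← Signature.arityAt_val]
  rfl

theorem length_encodeDB (m : ℕ) (D : Set (GroundAtom S)) :
    (encodeDB m D).length = S.offset m S.numPred := by
  rw [encodeDB, List.length_ofFn, Signature.offset, Finset.sum_range]
  exact Finset.sum_congr rfl fun q _ => by rw [Signature.arityAt_val]

theorem getD_encodeDB (m : ℕ) (D : Set (GroundAtom S)) (p : Fin S.numPred)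
    (a : Fin (S.arity p) → Fin m) :
    (encodeDB m D).getD (S.offset m p + digitsValue m (List.ofFn fun i => (a i : ℕ))) false = true ↔
      (⟨p, fun i => a i⟩ : GroundAtom S) ∈ D := by
  classical
  rw [← finSigmaFinEquiv_val, List.getD_eq_getElem?_getD, encodeDB, List.getElem?_ofFn,
    dif_pos (Fin.is_lt _)]
  simp only [Fin.eta, Option.getD_some, decide_eq_true_eq]
  rw [Equiv.symm_apply_apply (finSigmaFinEquiv (n := fun p : Fin S.numPred => m ^ S.arity p))]
  simp only [Equiv.symm_apply_apply]

theorem decodeDB_encodeDB {m : ℕ} {D : Set (GroundAtom S)} (hD : ConstantsBelow m D) :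
    decodeDB S m (encodeDB m D) = D := by
  have key : ∀ f : GroundAtom S, (∀ i, f.args i < m) → ((encodeDB m D).getD
      (S.offset m f.pred + digitsValue m (List.ofFn f.args)) false = true ↔ f ∈ D) :=
    fun f hf => getD_encodeDB m D f.pred fun i => ⟨f.args i, hf i⟩
  ext f
  exact ⟨fun h => (key f h.1).1 h.2, fun h => ⟨hD f h, (key f (hD f h)).2 h⟩⟩

/-- Every string of the right length is an encoding, so the circuit has to check only the length and
the absence of `⊥`. -/
theorem encodeDB_decodeDB {m : ℕ} {w : List Bool} (hw : S.offset m S.numPred = w.length) :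
    encodeDB m (decodeDB S m w) = w := by
  refine List.ext_getElem ((length_encodeDB _ _).trans hw) fun j hj hj' => ?_
  have hj2 : j < ∑ p : Fin S.numPred, m ^ S.arity p := by
    rw [length_encodeDB, Signature.offset, Finset.sum_range] at hj
    simpa only [Signature.arityAt_val] using hj
  obtain ⟨⟨p, x⟩, hk⟩ :=
    (finSigmaFinEquiv (n := fun p : Fin S.numPred => m ^ S.arity p)).surjective ⟨j, hj2⟩
  obtain ⟨a, rfl⟩ := finFunctionFinEquiv.surjective x
  have hidx : j = S.offset m p + digitsValue m (List.ofFn fun i => (a i : ℕ)) := by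
    rw [← finSigmaFinEquiv_val, hk]
  have h := getD_encodeDB m (decodeDB S m w) p a
  rw [← hidx, List.getD_eq_getElem _ _ hj] at h
  have h' : (⟨p, fun i => a i⟩ : GroundAtom S) ∈ decodeDB S m w ↔ w[j] = true := by
    rw [← List.getD_eq_getElem w false hj', hidx]
    exact ⟨fun h => h.2, fun h => ⟨fun i => (a i).2, h⟩⟩
  exact Bool.eq_iff_iff.2 (h.trans h')

theorem constantsBelow_decodeDB (m : ℕ) (w : List Bool) : ConstantsBelow m (decodeDB S m w) :=
  fun _ hf => hf.1

/-- The number of constants is bounded by the length of the encoding, unless it is irrelevant. -/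
theorem exists_le_length {m : ℕ} {w : List Bool} (hw : S.offset m S.numPred = w.length) :
    ∃ k ≤ w.length, S.offset k S.numPred = w.length ∧ decodeDB S k w = decodeDB S m w := by
  by_cases h : ∃ p : Fin S.numPred, S.arity p ≠ 0
  · obtain ⟨p, hp⟩ := h
    refine ⟨m, ?_, hw, rfl⟩
    rw [← hw, Signature.offset]
    refine (Nat.le_self_pow hp m).trans ?_
    rw [← Signature.arityAt_val]
    exact Finset.single_le_sum (f := fun q => m ^ S.arityAt q) (fun _ _ => Nat.zero_le _)
      (Finset.mem_range.2 p.2)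
  · push Not at h
    have harity : ∀ q, S.arityAt q = 0 := by
      intro q
      rw [Signature.arityAt]
      split_ifs
      · exact h _
      · rfl
    have hoff : ∀ k, S.offset 0 k = S.offset m k := by simp [Signature.offset, harity]
    -- If all predicates are nullary, the encoding does not depend on `m`, so `0` represents every
    -- `m`.
    refine ⟨0, Nat.zero_le _, (hoff _).trans hw, ?_⟩
    ext f
    have hdig : ∀ k, digitsValue k (List.ofFn f.args) = 0 := by
      intro k
      rw [digitsValue_ofFn]
      exact Finset.sum_eq_zero fun i _ => ((h f.pred ▸ i : Fin 0)).elim0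
    have hlt : ∀ k i, f.args i < k := fun k i => ((h f.pred ▸ i : Fin 0)).elim0
    simp only [decodeDB, Set.mem_ofPred_eq, hoff, hdig, hlt, implies_true]

/-- Bounds the search for `m` by the input length, in the form that the circuit evaluates. -/
theorem mem_dataProblem {P : Set (GroundAtom S) → Prop} {w : List Bool} :
    w ∈ dataProblem P ↔ ∃ m ≤ w.length, S.offset m S.numPred = w.length ∧
      IsDatabase (decodeDB S m w) ∧ P (decodeDB S m w) := by
  constructor
  · rintro ⟨m, D, hD, hm, rfl, hP⟩
    obtain ⟨k, hk, hk', hdec⟩ := exists_le_length (length_encodeDB m D).symm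
    rw [decodeDB_encodeDB hm] at hdec
    refine ⟨k, hk, hk', ?_⟩
    rw [hdec]
    exact ⟨hD, hP⟩
  · rintro ⟨m, -, hm, hD, hP⟩
    exact ⟨m, _, hD, constantsBelow_decodeDB m w, (encodeDB_decodeDB hm).symm, hP⟩

/-- The sentence that says that a structure is a database. -/
def FO.noBot (S : Signature) : FO S := .neg (.atom ⟨S.bot, fun _ => .const 0⟩)

theorem FO.holdsIn_noBot {A : Set ℕ} {D : Set (GroundAtom S)} {v : ℕ → ℕ} :
    HoldsIn A D v (noBot S) ↔ IsDatabase D := by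
  constructor
  · rintro h ⟨p, a⟩ hf (rfl : p = S.bot)
    refine h ?_
    have : (⟨S.bot, fun _ => .const 0⟩ : Atom S).ground v = ⟨S.bot, a⟩ := by
      simp only [Atom.ground, GroundAtom.mk.injEq, heq_eq_eq, true_and]
      funext i
      exact (S.arity_bot ▸ i : Fin 0).elim0
    rwa [HoldsIn, this]
  · intro h hf
    exact h _ hf rfl

/-- Every property of databases that is defined by a domain independent sentence is in logspace
uniform AC⁰. -/
theorem inAC0_dataProblem {P : Set (GroundAtom S) → Prop} {φ : FO S} (hφ : φ.IsSentence)
    (h : ∀ m (D : Set (GroundAtom S)), IsDatabase D → ConstantsBelow m D →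
      (P D ↔ FO.HoldsIn {c | c < m} D (fun _ => 0) φ)) : InAC0 (dataProblem P) := by
  -- Strings that set the bit of `⊥` encode no database; the extra conjunct rejects them.
  have hφ' : (FO.and φ (.noBot S)).IsSentence := by
    have hbot : (FO.noBot S).freeVars = ∅ :=
      Set.eq_empty_of_forall_notMem fun x hx => by
        obtain ⟨i, hi⟩ := Atom.mem_vars.1 hx
        simp [Term.vars] at hi
    rw [FO.IsSentence, FO.freeVars, hbot, Set.union_empty]
    exact hφ
  refine ⟨foCircuit (.and φ (.noBot S)), isLogspaceUniform_foCircuit _, size_foCircuit_le _,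
    ⟨_, depth_foCircuit_le _⟩, fun w => ?_⟩
  rw [eval_foCircuit hφ', mem_dataProblem]
  refine exists_congr fun m => and_congr_right fun _ => and_congr_right fun _ => ?_
  rw [FO.HoldsIn, FO.holdsIn_noBot, and_comm]
  exact and_congr_right fun hD => (h m _ hD (constantsBelow_decodeDB m w)).symm

end Encoding

end CQA

/-! ### The theorem -/

open CQA
theorem mainTheorem4 (S : Signature) (Γ : Finset (Dependency S))
    (hded : ∀ τ ∈ Γ, τ.IsDED) (hacyclic : IsAcyclic Γ) (hlinear : ∀ τ ∈ Γ, τ.IsLinear) :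
    (∃ l, IsTopologicalOrder Γ l) ∧
    (∀ l, IsTopologicalOrder Γ l → ∀ Q : UCQ S, Q.IsSafeBUCQ →
      (psiIar l Q).IsSentence ∧
      ∀ D : Set (GroundAtom S), IsDatabase D →
        (IAREntails Γ D Q.toFO ↔ Models D (psiIar l Q)) ∧
        (AREntails Γ D Q.toFO ↔ Models D (psiIar l Q))) ∧
    (∀ Q : UCQ S, Q.IsSafeBUCQ →
      InAC0 (dataProblem fun D : Set (GroundAtom S) => IAREntails Γ D Q.toFO) ∧
      InAC0 (dataProblem fun D : Set (GroundAtom S) => AREntails Γ D Q.toFO)) := by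
  have hsentence : ∀ l, IsTopologicalOrder Γ l → ∀ Q : UCQ S, Q.IsSafeBUCQ →
      (psiIar l Q).IsSentence := fun l hl Q hQ =>
    isSentence_psiIar (fun τ hτ => ⟨hded τ ((hl.2.1 τ).1 hτ), hlinear τ ((hl.2.1 τ).1 hτ)⟩) hQ
  obtain ⟨l₀, hl₀⟩ := exists_isTopologicalOrder hacyclic
  refine ⟨⟨l₀, hl₀⟩, fun l hl Q hQ => ⟨hsentence l hl Q hQ, fun D _ => ?_⟩, fun Q hQ => ?_⟩
  · have h : IAREntails Γ D Q.toFO ↔ Models D (psiIar l Q) := by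
      have := fun v => iarEntails_iff_holdsIn hl hded hlinear (A := Set.univ) (D := D)
        (fun _ _ _ => trivial) hQ v
      simp only [FO.holdsIn_univ] at this
      exact ⟨fun h v => (this v).1 h, fun h => (this fun _ => 0).2 (h _)⟩
    exact ⟨h, (arEntails_iff_iarEntails hl hlinear D _).trans h⟩
  · have h : InAC0 (dataProblem fun D : Set (GroundAtom S) => IAREntails Γ D Q.toFO) :=
      inAC0_dataProblem (hsentence l₀ hl₀ Q hQ) fun m D _ hD =>
        -- Domain independence: the rewriting may be evaluated over the encoded constants only, even
        -- if the query or the dependencies mention others.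
        iarEntails_iff_holdsIn hl₀ hded hlinear (A := {c | c < m}) hD hQ _
    refine ⟨h, ?_⟩
    simp only [arEntails_iff_iarEntails hl₀ hlinear]
    exact h
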